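/- Let $S^2\subset\mathbb R^3$ be the round unit sphere with area measure $dA$. For $\varepsilon>0$ and $u\in W^{2,2}(S^2,\mathbb R^3)$ let $$E_\varepsilon(u)=\frac12\int_{S^2}\big(|\nabla u|^2+\varepsilon|\Delta u|^2\big)\,dA ,$$ and let $W^{2,2}(S^2,S^2)$ be the set of $u\in W^{2,2}(S^2,\mathbb R^3)$ with $|u|=1$, each identified with its continuous representative. A map $u\in W^{2,2}(S^2,S^2)$ is called $\varepsilon$-harmonic if it is a critical point of $E_\varepsilon$, that is, if $\frac{d}{dt}\big|_{t=0}E_\varepsilon\big(\frac{u+t\varphi}{|u+t\varphi|}\big)=0$ for all $\varphi\in C^\infty(S^2,\mathbb R^3)$. Its degree is $\deg(u)=\frac1{4\pi}\int_{S^2}u\cdot\big(e_1(u)\times e_2(u)\big)\,dA$, where $(e_1,e_2)$ is a local oriented orthonormal frame of $TS^2$ and $e_i(u)$ is the derivative of $u$ along $e_i$. **Theorem.** For every $\delta>0$ there exists $\varepsilon_0>0$, depending only on $\delta$, such that for every $0<\varepsilon<\varepsilon_0$ there exists a nonconstant $\varepsilon$-harmonic map $u_\varepsilon:S^2\to S^2$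 with $\deg(u_\varepsilon)=0$ and $$8\pi<E_\varepsilon(u_\varepsilon)<8\pi+\delta .$$ -/

import Mathlib

open MeasureTheory
open scoped ContDiff RealInnerProductSpace

noncomputable section

namespace EpsHarmonic

/-- Euclidean three-space. -/
abbrev E3 : Type := EuclideanSpace ℝ (Fin 3)

/-- The round unit sphere in Euclidean three-space. -/
abbrev S2 : Type := Metric.sphere (0 : E3) 1

/-- The area measure of the round sphere (total mass `4π`). -/
def area : Measure S2 := (volume : Measure E3).toSphere

/-- The standard basis vectors of Euclidean three-space. -/
def stdVec (i : Fin 3) : E3 := EuclideanSpace.single i 1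

/-- The cross product. -/
def cross (a b : E3) : E3 :=
  !₂[a 1 * b 2 - a 2 * b 1, a 2 * b 0 - a 0 * b 2, a 0 * b 1 - a 1 * b 0]

/-- Smooth vector fields on the sphere, given by a smooth extension to Euclidean space. -/
def IsSmoothTangentField (X : E3 → E3) : Prop :=
  ContDiff ℝ ∞ X ∧ ∀ x : S2, ⟪X x, (x : E3)⟫ = 0

/-- The divergence on the sphere, i.e. the trace of `DX` over the tangent plane at `x`: the full
trace minus the normal-normal entry. -/
def sphereDiv (X : E3 → E3) (x : S2) : ℝ :=
  (∑ i, ⟪fderiv ℝ X x (stdVec i), stdVec i⟫) - ⟪fderiv ℝ X x (x : E3), (x : E3)⟫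

/-- `A` is the weak differential of `u : S² → ℝ³`, both square integrable. The linear map `A x`
on the tangent plane at `x` is extended by zero in the normal direction, and the defining
integration by parts `∫ du(X) = - ∫ (div X) u` is tested with all smooth tangent fields `X`. -/
structure HasWeakDifferential (u : S2 → E3) (A : S2 → E3 →L[ℝ] E3) : Prop where
  memLp_map : MemLp u 2 area
  memLp_diff : MemLp A 2 area
  normal : ∀ x : S2, A x (x : E3) = 0
  integral_eq : ∀ X : E3 → E3, IsSmoothTangentField X →
    ∫ x, A x (X x) ∂area = - ∫ x, sphereDiv X x • u x ∂area

/-- The Sobolev space `W^{1,2}(S², ℝ³)`. -/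
def MemW12 (u : S2 → E3) : Prop := ∃ A, HasWeakDifferential u A

open Classical in
/-- The weak differential of a map in `W^{1,2}(S², ℝ³)` (unique up to null sets). -/
def weakDiff (u : S2 → E3) : S2 → E3 →L[ℝ] E3 :=
  if h : MemW12 u then h.choose else 0

/-- The `j`-th tangential derivative `D_j u`: the weak differential of `u` applied to the tangential
part of the `j`-th standard basis vector (it vanishes on the normal part). -/
def tangDeriv (u : S2 → E3) (j : Fin 3) : S2 → E3 := fun x => weakDiff u x (stdVec j)

/-- The Sobolev space `W^{2,2}(S², ℝ³)`: the map and all its first tangential derivatives are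
in `W^{1,2}`. -/
def MemW22 (u : S2 → E3) : Prop := MemW12 u ∧ ∀ j, MemW12 (tangDeriv u j)

/-- The squared norm `|∇u|²` of the weak differential. -/
def gradSq (u : S2 → E3) (x : S2) : ℝ := ∑ j, ‖tangDeriv u j x‖ ^ 2

/-- The (weak) Laplace-Beltrami operator, `Δu = ∑ D_j D_j u`. -/
def laplacian (u : S2 → E3) (x : S2) : E3 := ∑ j, tangDeriv (tangDeriv u j) j x

/-- The energy `E_ε(u) = ½ ∫ |∇u|² + ε |Δu|²`, for `u` in `W^{2,2}(S², ℝ³)`. -/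
def energy (ε : ℝ) (u : S2 → E3) : ℝ :=
  (1 / 2) * ∫ x, (gradSq u x + ε * ‖laplacian u x‖ ^ 2) ∂area

/-- The Jacobian `J(u) = u · (e₁(u) × e₂(u))`, with `(e₁, e₂)` an oriented orthonormal basis of the
tangent plane at `x` (so `e₁ × e₂ = x`), written out without choosing `(e₁, e₂)`. -/
def jacobian (u : S2 → E3) (x : S2) : ℝ :=
  ⟪u x, (x : E3) 0 • cross (tangDeriv u 1 x) (tangDeriv u 2 x)
    + (x : E3) 1 • cross (tangDeriv u 2 x) (tangDeriv u 0 x)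
    + (x : E3) 2 • cross (tangDeriv u 0 x) (tangDeriv u 1 x)⟫

/-- The Jacobian is the frame expression, for every oriented orthonormal frame. -/
theorem jacobian_eq_frame (u : S2 → E3) (x : S2) (e₁ e₂ : E3) (h : cross e₁ e₂ = (x : E3)) :
    jacobian u x = ⟪u x, cross (weakDiff u x e₁) (weakDiff u x e₂)⟫ := by
  have key : ∀ v : E3, weakDiff u x v
      = v 0 • tangDeriv u 0 x + v 1 • tangDeriv u 1 x + v 2 • tangDeriv u 2 x := by
    intro v
    have hv : v = v 0 • stdVec 0 + v 1 • stdVec 1 + v 2 • stdVec 2 := by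
      ext i
      fin_cases i <;> simp [stdVec]
    conv_lhs => rw [hv]
    simp only [map_add, map_smul, tangDeriv]
  unfold jacobian
  rw [key e₁, key e₂, ← h]
  congr 1
  ext i
  fin_cases i <;> simp [cross] <;> ring

/-- The degree `(1 / 4π) ∫ J(u)` of a map from the sphere to itself. -/
def degree (u : S2 → E3) : ℝ := (1 / (4 * Real.pi)) * ∫ x, jacobian u x ∂area

/-- The nearest point projection `ℝ³ ∖ {0} → S²`. -/
def nearestPoint (y : E3) : E3 := ‖y‖⁻¹ • y

/-- `u : S² → S²` is `ε`-harmonic: a critical point of `E_ε` in `W^{2,2}(S², S²)`, where an element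
of `W^{2,2}(S², S²)` is identified with its continuous representative. Criticality means that the
first variation vanishes in the direction of every smooth `φ : S² → ℝ³` (given by a smooth
extension), along the maps obtained by projecting `u + tφ` to the sphere. -/
structure IsEpsHarmonic (ε : ℝ) (u : S2 → S2) : Prop where
  continuous : Continuous u
  memW22 : MemW22 (fun x => (u x : E3))
  critical : ∀ φ : E3 → E3, ContDiff ℝ ∞ φ →
    HasDerivAt (fun t : ℝ => energy ε (fun x : S2 => nearestPoint ((u x : E3) + t • φ x))) 0 0

end EpsHarmonic

end

/-!
The maps are corotational: in the conformal (Mercator) parametrization `cyl` of the sphere minus the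
poles by a cylinder, with axis `s` and angle `a`, they are `(sin (f s) e^{i a}, cos (f s))` with an
angle function `f` that runs from `0` to `2π`. Such a map covers the sphere once in each orientation
and sends both poles to the north pole, hence has degree `0` (`Profile.degree_eq_zero`). Its energy
is `π` times a one-dimensional energy of `f` (`Profile.energy_eq`), in which the second derivative
only enters through `T = cosh (f'' - sin f cos f)`.

*Existence.* For fixed `ε > 0` the one-dimensional energy attains its minimum among all such `f`
(`Profile.exists_minimizer`). Without the bending term the two bubbles of a minimizing sequence would
escape to the two poles. The bending term bounds `∫ cosh² (f')⁴`, and this gives a bound on the tails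
of `f` (`abs_le_of_quartic_bound`) that preserves the boundary values `0` and `2π` under weak limits.

*Energy.* As `f` passes through `π`, the inequality `f'² + sin² f ≥ 2 |(cos f)'|` bounds the
one-dimensional Dirichlet energy below by `8`, and the bending term makes the bound strict
(`Profile.eight_lt_profileEnergy`). Superposing two bubbles at distance `2t` gives competitors of
Dirichlet energy `8 + O(1 / t)` with finite bending energy (`exists_profile_le`), so the minimum is
close to `8` for small `ε`.

*Regularity.* By the Euler-Lagrange equation and the lemma of du Bois-Reymond, minimal profiles are
of class `C²` (`Profile.exists_continuous`). The energy controls the Laplacian of the map; the rest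
of its Hessian is controlled by a decay estimate at the poles for the mixed second derivative
(`memLp_cosh_mul_of_hasDerivAt`), so the map is in `W^{2,2}` (`Profile.cylW22`, `memW22_of_cyl`).

*Criticality.* Minimality is only known among corotational maps. The first variation at a
corotational map in the direction of an arbitrary field `φ` is computed explicitly: after integration
over the angle, it is the first variation of the one-dimensional energy in the direction of the
angular integral of the meridian component of `φ` (`Profile.first_variation_eq_zero`). This
direction is admissible (`Profile.exists_variation_angInt`), as the horizontal radial component of a
smooth field has angular mean zero at the poles.

The link to Sobolev spaces on the sphere is `hasWeakDifferential_cylDiff`, by which the pointwise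
differential in cylindrical coordinates is the weak differential, together with the uniqueness of
weak differentials (`HasWeakDifferential.ae_eq`). The energy is differentiated along the projected
variations in `hasDerivAt_energy_nearestPoint`.
-/

open MeasureTheory
open scoped ContDiff RealInnerProductSpace

noncomputable section

namespace EpsHarmonic

/-! ### Cylindrical coordinates on the sphere -/

/-- The horizontal unit vector at angle `a`. -/
def rotVec (a : ℝ) : E3 := Real.cos a • stdVec 0 + Real.sin a • stdVec 1

/-- The conformal parametrization of the sphere without its poles by the cylinder `ℝ × ℝ / 2πℤ`
(the inverse of the Mercator projection). -/
def cyl (p : ℝ × ℝ) : E3 := (Real.cosh p.1)⁻¹ • rotVec p.2 + Real.tanh p.1 • stdVec 2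

theorem tanh_sq_add_inv_cosh_sq (s : ℝ) : Real.tanh s ^ 2 + (Real.cosh s)⁻¹ ^ 2 = 1 := by
  have h := Real.cosh_sq_sub_sinh_sq s
  have h0 := (Real.cosh_pos s).ne'
  rw [Real.tanh_eq_sinh_div_cosh]
  field_simp
  linarith

@[simp] theorem stdVec_apply (i j : Fin 3) : stdVec i j = if j = i then 1 else 0 := by
  simp [stdVec]

@[simp] theorem cyl_zero (p : ℝ × ℝ) : cyl p 0 = (Real.cosh p.1)⁻¹ * Real.cos p.2 := by
  simp [cyl, rotVec]

@[simp] theorem cyl_one (p : ℝ × ℝ) : cyl p 1 = (Real.cosh p.1)⁻¹ * Real.sin p.2 := by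
  simp [cyl, rotVec]

@[simp] theorem cyl_two (p : ℝ × ℝ) : cyl p 2 = Real.tanh p.1 := by
  simp [cyl, rotVec]

theorem norm_sq_eq (x : E3) : ‖x‖ ^ 2 = x 0 ^ 2 + x 1 ^ 2 + x 2 ^ 2 := by
  rw [EuclideanSpace.norm_sq_eq, Fin.sum_univ_three]; simp

theorem inner_eq (x y : E3) : ⟪x, y⟫ = x 0 * y 0 + x 1 * y 1 + x 2 * y 2 := by
  simp [PiLp.inner_apply, Fin.sum_univ_three, mul_comm]

theorem E3_ext {x y : E3} (h0 : x 0 = y 0) (h1 : x 1 = y 1) (h2 : x 2 = y 2) : x = y := by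
  ext i; fin_cases i <;> assumption

theorem norm_cyl (p : ℝ × ℝ) : ‖cyl p‖ = 1 := by
  have h : ‖cyl p‖ ^ 2 = 1 := by
    rw [norm_sq_eq, cyl_zero, cyl_one, cyl_two]
    linear_combination tanh_sq_add_inv_cosh_sq p.1
      + (Real.cosh p.1)⁻¹ ^ 2 * Real.cos_sq_add_sin_sq p.2
  nlinarith [norm_nonneg (cyl p)]

/-- The parametrization `cyl` as a map into the sphere. -/
def cylS (p : ℝ × ℝ) : S2 := ⟨cyl p, by simp [norm_cyl]⟩

@[simp] theorem coe_cylS (p : ℝ × ℝ) : (cylS p : E3) = cyl p := rfl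

/-- The cylindrical coordinates of a point of the sphere (with junk values at the poles). -/
def coord (x : S2) : ℝ × ℝ := (Real.artanh ((x : E3) 2), Complex.arg ⟨(x : E3) 0, (x : E3) 1⟩)

theorem sphere_eq (x : S2) : (x : E3) 0 ^ 2 + (x : E3) 1 ^ 2 + (x : E3) 2 ^ 2 = 1 := by
  rw [← norm_sq_eq]; simp

theorem contDiff_tanh {n : WithTop ℕ∞} : ContDiff ℝ n Real.tanh := by
  have : Real.tanh = fun s => Real.sinh s / Real.cosh s := by
    funext s; exact Real.tanh_eq_sinh_div_cosh s
  rw [this]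
  exact Real.contDiff_sinh.div Real.contDiff_cosh fun s => (Real.cosh_pos s).ne'

theorem contDiff_rotVec {n : WithTop ℕ∞} : ContDiff ℝ n rotVec := by
  unfold rotVec
  exact (Real.contDiff_cos.smul contDiff_const).add (Real.contDiff_sin.smul contDiff_const)

theorem contDiff_cyl {n : WithTop ℕ∞} : ContDiff ℝ n cyl := by
  unfold cyl
  refine ((ContDiff.inv (Real.contDiff_cosh.comp contDiff_fst)
    fun p => (Real.cosh_pos _).ne').smul (contDiff_rotVec.comp contDiff_snd)).add
    ((contDiff_tanh.comp contDiff_fst).smul contDiff_const)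

theorem measurable_cylS : Measurable cylS :=
  (contDiff_cyl (n := 0)).continuous.measurable.subtype_mk

theorem measurable_artanh : Measurable Real.artanh := by
  unfold Real.artanh; fun_prop

theorem measurable_coord : Measurable coord := by
  unfold coord
  refine Measurable.prodMk (measurable_artanh.comp (by fun_prop)) ?_
  refine Complex.measurable_arg.comp ?_
  have h : (fun x : S2 => (⟨(x : E3) 0, (x : E3) 1⟩ : ℂ))
      = fun x : S2 => ((x : E3) 0 : ℂ) + ((x : E3) 1 : ℂ) * Complex.I := by
    funext x; exact Complex.mk_eq_add_mul_I _ _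
  rw [h]
  refine Measurable.add (Complex.measurable_ofReal.comp (by fun_prop))
    ((Complex.measurable_ofReal.comp (by fun_prop)).mul_const _)

theorem coord_cylS {p : ℝ × ℝ} (h : p.2 ∈ Set.Ioc (-Real.pi) Real.pi) : coord (cylS p) = p := by
  unfold coord
  refine Prod.ext (by simp [Real.artanh_tanh]) ?_
  have : (⟨cyl p 0, cyl p 1⟩ : ℂ)
      = ((Real.cosh p.1)⁻¹ : ℝ) * (Complex.cos p.2 + Complex.sin p.2 * Complex.I) := by
    rw [← Complex.ofReal_cos, ← Complex.ofReal_sin]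
    apply Complex.ext
    · rw [Complex.re_ofReal_mul]; simp [-Complex.ofReal_cos, -Complex.ofReal_sin]
    · rw [Complex.im_ofReal_mul]; simp [-Complex.ofReal_cos, -Complex.ofReal_sin]
  simp only [coe_cylS, this]
  exact Complex.arg_mul_cos_add_sin_mul_I (inv_pos.2 (Real.cosh_pos _)) h

theorem cylS_coord {x : S2} (h : (x : E3) 2 ∈ Set.Ioo (-1 : ℝ) 1) : cylS (coord x) = x := by
  apply Subtype.ext
  have hz : 0 < 1 - (x : E3) 2 ^ 2 := by nlinarith [h.1, h.2]
  have hs := sphere_eq x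
  have hn : ‖(⟨(x : E3) 0, (x : E3) 1⟩ : ℂ)‖ = √(1 - (x : E3) 2 ^ 2) := by
    rw [Complex.norm_def]
    simp only [Complex.normSq_mk]
    congr 1; linarith
  have hne : (⟨(x : E3) 0, (x : E3) 1⟩ : ℂ) ≠ 0 := by
    intro h0
    rw [h0, norm_zero] at hn
    exact (Real.sqrt_pos.2 hz).ne hn
  have hc : (Real.cosh (coord x).1)⁻¹ = √(1 - (x : E3) 2 ^ 2) := by
    simp [coord, Real.cosh_artanh h]
  apply E3_ext
  · rw [coe_cylS, cyl_zero, hc]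
    simp only [coord]
    rw [Complex.cos_arg hne, hn]
    field_simp [(Real.sqrt_pos.2 hz).ne']
  · rw [coe_cylS, cyl_one, hc]
    simp only [coord]
    rw [Complex.sin_arg, hn]
    field_simp [(Real.sqrt_pos.2 hz).ne']
  · rw [coe_cylS, cyl_two]
    simp only [coord]
    exact Real.tanh_artanh h

/-- Lebesgue measure on the strip `ℝ × (-π, π)`, a fundamental domain of the cylinder. -/
def strip : Measure (ℝ × ℝ) := volume.restrict (Set.univ ×ˢ Set.Ioo (-Real.pi) Real.pi)

/-- The area density `1 / cosh² s` in cylindrical coordinates. -/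
def dens (p : ℝ × ℝ) : NNReal := ⟨(Real.cosh p.1)⁻¹ ^ 2, by positivity⟩

theorem continuous_dens : Continuous dens := by
  unfold dens
  refine Continuous.subtype_mk ?_ _
  exact ((Real.continuous_cosh.comp continuous_fst).inv₀ fun p => (Real.cosh_pos _).ne').pow 2

/-- `(r, s, a) ↦ r • cyl (s, a)` in the coordinates of `Fin 3 → ℝ`. -/
def coneMap (x : Fin 3 → ℝ) : Fin 3 → ℝ :=
  ![x 0 * (Real.cosh (x 1))⁻¹ * Real.cos (x 2), x 0 * (Real.cosh (x 1))⁻¹ * Real.sin (x 2),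
    x 0 * Real.tanh (x 1)]

theorem hasDerivAt_tanh (s : ℝ) : HasDerivAt Real.tanh ((Real.cosh s)⁻¹ ^ 2) s := by
  have h0 := (Real.cosh_pos s).ne'
  have h := (Real.hasDerivAt_sinh s).div (Real.hasDerivAt_cosh s) h0
  have e : Real.tanh = Real.sinh / Real.cosh := by
    funext s; exact Real.tanh_eq_sinh_div_cosh s
  rw [e]
  refine h.congr_deriv ?_
  have := Real.cosh_sq_sub_sinh_sq s
  rw [inv_pow, ← one_div]
  congr 1
  linarith

theorem hasDerivAt_inv_cosh (s : ℝ) :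
    HasDerivAt (fun s => (Real.cosh s)⁻¹) (-Real.tanh s * (Real.cosh s)⁻¹) s := by
  have h0 := (Real.cosh_pos s).ne'
  have h := (Real.hasDerivAt_cosh s).inv h0
  refine h.congr_deriv ?_
  rw [Real.tanh_eq_sinh_div_cosh]
  field_simp

/-- The Jacobian matrix of `coneMap`. -/
def coneJac (x : Fin 3 → ℝ) : Matrix (Fin 3) (Fin 3) ℝ :=
  !![(Real.cosh (x 1))⁻¹ * Real.cos (x 2),
      x 0 * (-Real.tanh (x 1) * (Real.cosh (x 1))⁻¹) * Real.cos (x 2),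
      - (x 0 * (Real.cosh (x 1))⁻¹ * Real.sin (x 2));
    (Real.cosh (x 1))⁻¹ * Real.sin (x 2),
      x 0 * (-Real.tanh (x 1) * (Real.cosh (x 1))⁻¹) * Real.sin (x 2),
      x 0 * (Real.cosh (x 1))⁻¹ * Real.cos (x 2);
    Real.tanh (x 1), x 0 * (Real.cosh (x 1))⁻¹ ^ 2, 0]

theorem hasFDerivAt_coneMap (x : Fin 3 → ℝ) :
    HasFDerivAt coneMap (LinearMap.toContinuousLinearMap (Matrix.toLin' (coneJac x))) x := by
  refine hasFDerivAt_pi'.2 fun i => ?_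
  have p0 : HasFDerivAt (fun x : Fin 3 → ℝ => x 0)
      (ContinuousLinearMap.proj (R := ℝ) (φ := fun _ : Fin 3 => ℝ) 0) x :=
    hasFDerivAt_apply (𝕜 := ℝ) 0 x
  have p1 : HasFDerivAt (fun x : Fin 3 → ℝ => x 1)
      (ContinuousLinearMap.proj (R := ℝ) (φ := fun _ : Fin 3 => ℝ) 1) x :=
    hasFDerivAt_apply (𝕜 := ℝ) 1 x
  have p2 : HasFDerivAt (fun x : Fin 3 → ℝ => x 2)
      (ContinuousLinearMap.proj (R := ℝ) (φ := fun _ : Fin 3 => ℝ) 2) x :=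
    hasFDerivAt_apply (𝕜 := ℝ) 2 x
  have hc := (hasDerivAt_inv_cosh (x 1)).comp_hasFDerivAt x p1
  have ht := (hasDerivAt_tanh (x 1)).comp_hasFDerivAt x p1
  have hcos := (Real.hasDerivAt_cos (x 2)).comp_hasFDerivAt x p2
  have hsin := (Real.hasDerivAt_sin (x 2)).comp_hasFDerivAt x p2
  fin_cases i
  · refine ((p0.mul hc).mul hcos).congr_fderiv ?_
    ext v
    simp [coneJac, Matrix.toLin'_apply, dotProduct, Fin.sum_univ_three]
    ring
  · refine ((p0.mul hc).mul hsin).congr_fderiv ?_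
    ext v
    simp [coneJac, Matrix.toLin'_apply, dotProduct, Fin.sum_univ_three]
    ring
  · refine (p0.mul ht).congr_fderiv ?_
    ext v
    simp [coneJac, Matrix.toLin'_apply, dotProduct, Fin.sum_univ_three]
    ring

theorem det_coneJac (x : Fin 3 → ℝ) :
    (coneJac x).det = -(x 0 ^ 2 * (Real.cosh (x 1))⁻¹ ^ 2) := by
  have h1 := tanh_sq_add_inv_cosh_sq (x 1)
  have h2 := Real.cos_sq_add_sin_sq (x 2)
  set t := Real.tanh (x 1)
  set c := (Real.cosh (x 1))⁻¹
  rw [Matrix.det_fin_three]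
  simp only [coneJac, Matrix.of_apply, Matrix.cons_val', Matrix.cons_val_zero,
    Matrix.cons_val_one, Matrix.cons_val]
  linear_combination (-(x 0) ^ 2 * c ^ 2 * (c ^ 2 + t ^ 2)) * h2 - (x 0) ^ 2 * c ^ 2 * h1

theorem coneMap_eq (x : Fin 3 → ℝ) : coneMap x = (x 0 • cyl (x 1, x 2)).ofLp := by
  ext i
  fin_cases i <;> simp [coneMap, mul_assoc]

/-- Spherical polar coordinates are injective off the origin; the angle ranges over a half open
interval so that `coord_cylS` applies. -/
theorem coneMap_injOn :
    Set.InjOn coneMap {x | 0 < x 0 ∧ x 2 ∈ Set.Ioc (-Real.pi) Real.pi} := by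
  intro x hx y hy h
  rw [coneMap_eq, coneMap_eq] at h
  have h' : x 0 • cyl (x 1, x 2) = y 0 • cyl (y 1, y 2) := by
    ext i; exact congrFun h i
  have h0 : x 0 = y 0 := by
    have := congrArg norm h'
    simpa [norm_smul, norm_cyl, abs_of_pos hx.1, abs_of_pos hy.1] using this
  rw [h0] at h'
  have h1 : cylS (x 1, x 2) = cylS (y 1, y 2) :=
    Subtype.ext (smul_right_injective _ hy.1.ne' h')
  have h2 := congrArg coord h1
  rw [coord_cylS hx.2, coord_cylS hy.2, Prod.mk.injEq] at h2
  funext i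
  fin_cases i
  · exact h0
  · exact h2.1
  · exact h2.2

/-- The coordinates `(r, (s, a))` of a triple, as a measurable equivalence. -/
def splitThree : (Fin 3 → ℝ) ≃ᵐ ℝ × (ℝ × ℝ) :=
  (MeasurableEquiv.piFinSuccAbove (fun _ : Fin 3 => ℝ) 0).trans
    ((MeasurableEquiv.refl ℝ).prodCongr MeasurableEquiv.finTwoArrow)

theorem splitThree_apply (x : Fin 3 → ℝ) : splitThree x = (x 0, (x 1, x 2)) := rfl

theorem measurePreserving_splitThree : MeasurePreserving splitThree := by
  refine MeasurePreserving.trans (volume_preserving_piFinSuccAbove (fun _ : Fin 3 => ℝ) 0) ?_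
  exact (MeasurePreserving.id volume).prod (volume_preserving_finTwoArrow ℝ)

theorem volume_coordPlane : volume {x : Fin 3 → ℝ | x 1 = 0} = 0 := by
  have h : {x : Fin 3 → ℝ | x 1 = 0}
      = splitThree ⁻¹' (Set.univ ×ˢ ({0} ×ˢ Set.univ)) := by
    ext x; simp [splitThree_apply]
  rw [h, measurePreserving_splitThree.measure_preimage_equiv]
  rw [Measure.volume_eq_prod, Measure.prod_prod, Measure.volume_eq_prod, Measure.prod_prod]
  simp

theorem lintegral_sq_Ioo : ∫⁻ r in Set.Ioo (0 : ℝ) 1, ENNReal.ofReal (r ^ 2)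
    = ENNReal.ofReal (1 / 3) := by
  rw [← ofReal_integral_eq_lintegral_ofReal]
  · rw [← integral_Ioc_eq_integral_Ioo, ← intervalIntegral.integral_of_le zero_le_one,
      integral_pow]
    norm_num
  · exact ((continuous_pow 2).integrableOn_Icc (a := 0) (b := 1)).mono_set Set.Ioo_subset_Icc_self
  · exact Filter.Eventually.of_forall fun r => sq_nonneg r

open scoped Pointwise in
/-- The area measure is the image of `ds da / cosh² s` on the strip. -/
theorem area_eq_map :
    area = (strip.withDensity fun p => (dens p : ENNReal)).map cylS := by
  ext S hS
  have hpre : MeasurableSet (cylS ⁻¹' S) := measurable_cylS hS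
  rw [Measure.map_apply measurable_cylS hS, withDensity_apply _ hpre, area,
    Measure.toSphere_apply' _ hS]
  set T' : Set (ℝ × ℝ) := cylS ⁻¹' S ∩ Set.univ ×ˢ Set.Ioo (-Real.pi) Real.pi with hT'
  have hT'm : MeasurableSet T' := hpre.inter (MeasurableSet.univ.prod measurableSet_Ioo)
  set T : Set (Fin 3 → ℝ) := splitThree ⁻¹' (Set.Ioo 0 1 ×ˢ T') with hT
  have hTm : MeasurableSet T := splitThree.measurable (measurableSet_Ioo.prod hT'm)
  have hinj : Set.InjOn coneMap T := coneMap_injOn.mono fun x hx => by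
    simp only [hT, splitThree_apply, Set.mem_preimage, Set.mem_prod, hT', Set.mem_inter_iff] at hx
    exact ⟨hx.1.1, Set.Ioo_subset_Ioc_self hx.2.2.2⟩
  -- the cone over `S` is the image of `T`, up to a subset of a coordinate plane
  have hcone : volume (Set.Ioo (0 : ℝ) 1 • ((↑) '' S : Set E3)) = volume (coneMap '' T) := by
    have e1 : volume (Set.Ioo (0 : ℝ) 1 • ((↑) '' S : Set E3))
        = volume ((WithLp.toLp 2 : (Fin 3 → ℝ) → E3) ⁻¹' (Set.Ioo (0 : ℝ) 1 • ((↑) '' S))) :=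
      ((PiLp.volume_preserving_toLp (Fin 3)).measure_preimage_equiv
        (f := MeasurableEquiv.toLp 2 (Fin 3 → ℝ)) _).symm
    rw [e1]
    refine measure_congr (Filter.EventuallyEq.symm ?_)
    refine (Filter.eventuallyLE_antisymm_iff.2 ⟨?_, ?_⟩)
    · refine LE.le.eventuallyLE ?_
      rintro _ ⟨x, hx, rfl⟩
      simp only [hT, splitThree_apply, Set.mem_preimage, Set.mem_prod, hT', Set.mem_inter_iff] at hx
      rw [coneMap_eq]
      exact Set.smul_mem_smul hx.1 ⟨_, hx.2.1, rfl⟩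
    · have : ∀ᵐ y : Fin 3 → ℝ, y 1 ≠ 0 := by
        rw [ae_iff]; simpa using volume_coordPlane
      filter_upwards [this] with y hy hyS
      obtain ⟨r, hr, _, ⟨x, hxS, rfl⟩, hxy⟩ := Set.mem_smul.1 hyS
      have hy' : ∀ i, y i = r * (x : E3) i := fun i => by
        have := congrArg (fun v : E3 => v i) hxy
        simpa using this.symm
      have hx1 : (x : E3) 1 ≠ 0 := fun h => hy (by rw [hy', h, mul_zero])
      have hz : (x : E3) 2 ∈ Set.Ioo (-1 : ℝ) 1 := by
        have h1 := sphere_eq x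
        have h2 : 0 < (x : E3) 1 ^ 2 := by positivity
        constructor <;> nlinarith [sq_nonneg ((x : E3) 0)]
      have hc := cylS_coord hz
      have harg : (coord x).2 ∈ Set.Ioo (-Real.pi) Real.pi := by
        refine ⟨Complex.neg_pi_lt_arg _, lt_of_le_of_ne (Complex.arg_le_pi _) fun h => ?_⟩
        exact hx1 (Complex.arg_eq_pi_iff.1 h).2
      refine ⟨![r, (coord x).1, (coord x).2], ?_, ?_⟩
      · simp only [hT, splitThree_apply, Set.mem_preimage, hT']
        refine ⟨hr, ?_, Set.mem_univ _, harg⟩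
        change cylS (coord x) ∈ S
        rwa [hc]
      · rw [coneMap_eq]
        funext i
        rw [hy' i, ← congrArg (fun x : S2 => (x : E3) i) hc]
        rfl
  -- change of variables; the factor `1 / 3 = ∫ r² dr` cancels the dimension factor of `toSphere`
  have hvol : volume (coneMap '' T) = ENNReal.ofReal (1 / 3) * ∫⁻ p in T', (dens p : ENNReal) := by
    have h := lintegral_image_eq_lintegral_abs_det_fderiv_mul volume hTm
      (fun x _ => (hasFDerivAt_coneMap x).hasFDerivWithinAt) hinj (fun _ => 1)
    rw [setLIntegral_one] at h
    rw [h]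
    have hd : ∀ x : Fin 3 → ℝ, ENNReal.ofReal
        |(LinearMap.toContinuousLinearMap (Matrix.toLin' (coneJac x))).det| * 1
        = (fun q : ℝ × (ℝ × ℝ) => ENNReal.ofReal (q.1 ^ 2) * (dens q.2 : ENNReal))
          (splitThree x) := by
      intro x
      rw [LinearMap.det_toContinuousLinearMap, LinearMap.det_toLin', det_coneJac, abs_neg,
        abs_of_nonneg (by positivity), mul_one, ENNReal.ofReal_mul (by positivity)]
      congr 1
      exact ENNReal.ofReal_eq_coe_nnreal _
    rw [lintegral_congr hd, hT]
    refine (measurePreserving_splitThree.setLIntegral_comp_preimage_emb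
      splitThree.measurableEmbedding (fun q : ℝ × (ℝ × ℝ) =>
        ENNReal.ofReal (q.1 ^ 2) * (dens q.2 : ENNReal)) (Set.Ioo 0 1 ×ˢ T')).trans ?_
    rw [Measure.volume_eq_prod, ← Measure.prod_restrict,
      lintegral_prod_mul (f := fun r : ℝ => ENNReal.ofReal (r ^ 2))
        (g := fun p : ℝ × ℝ => (dens p : ENNReal)) (by fun_prop)
        (continuous_dens.measurable.coe_nnreal_ennreal.aemeasurable), lintegral_sq_Ioo]
  rw [hcone, hvol, ← mul_assoc]
  have h3 : ((Module.finrank ℝ E3 : ℕ) : ENNReal) * ENNReal.ofReal (1 / 3) = 1 := by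
    rw [finrank_euclideanSpace_fin, ← ENNReal.ofReal_natCast, ← ENNReal.ofReal_mul (by positivity)]
    norm_num
  rw [h3, one_mul, strip, Measure.restrict_restrict hpre]

instance : IsFiniteMeasure area := by unfold area; infer_instance

theorem ae_cylS_coord : ∀ᵐ x ∂area, cylS (coord x) = x := by
  rw [area_eq_map, ae_map_iff measurable_cylS.aemeasurable
    (show MeasurableSet {x | cylS (coord x) = x} from
      measurableSet_eq_fun (measurable_cylS.comp measurable_coord) measurable_id)]
  refine (withDensity_absolutelyContinuous _ _).ae_le ?_
  refine (ae_restrict_mem (MeasurableSet.univ.prod measurableSet_Ioo)).mono fun p hp => ?_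
  rw [coord_cylS (Set.Ioo_subset_Ioc_self hp.2)]

theorem integral_area {F : Type*} [NormedAddCommGroup F] [NormedSpace ℝ F] {f : S2 → F}
    (hf : AEStronglyMeasurable f area) :
    ∫ x, f x ∂area = ∫ p, (Real.cosh p.1)⁻¹ ^ 2 • f (cylS p) ∂strip := by
  rw [area_eq_map] at hf ⊢
  rw [integral_map measurable_cylS.aemeasurable hf,
    integral_withDensity_eq_integral_smul continuous_dens.measurable]
  rfl

theorem ae_strip {q : ℝ × ℝ → Prop} (h : ∀ p : ℝ × ℝ, p.2 ∈ Set.Ioo (-Real.pi) Real.pi → q p) :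
    ∀ᵐ p ∂strip, q p :=
  (ae_restrict_mem (MeasurableSet.univ.prod measurableSet_Ioo)).mono fun p hp => h p hp.2

theorem stronglyMeasurable_comp_coord {F : Type*} [NormedAddCommGroup F] {g : ℝ × ℝ → F}
    (hg : Continuous g) : StronglyMeasurable fun x => g (coord x) :=
  hg.stronglyMeasurable.comp_measurable measurable_coord

theorem memLp_comp_coord {F : Type*} [NormedAddCommGroup F] [NormedSpace ℝ F] {g : ℝ × ℝ → F}
    (hg : Continuous g) (h : MemLp (fun p => (Real.cosh p.1)⁻¹ • g p) 2 strip) :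
    MemLp (fun x => g (coord x)) 2 area := by
  have hm := (stronglyMeasurable_comp_coord hg).aestronglyMeasurable (μ := area)
  rw [memLp_two_iff_integrable_sq_norm hm, area_eq_map,
    integrable_map_measure (hm.norm.pow 2 |> fun h => by rwa [← area_eq_map])
      measurable_cylS.aemeasurable,
    integrable_withDensity_iff_integrable_smul continuous_dens.measurable]
  rw [memLp_two_iff_integrable_sq_norm h.1] at h
  refine h.congr (ae_strip fun p hp => ?_)
  simp only [norm_smul, Function.comp, coord_cylS (Set.Ioo_subset_Ioc_self hp), dens,
    mul_pow, norm_inv, Real.norm_eq_abs, sq_abs, inv_pow]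
  rfl

/-! ### Calculus on the cylinder -/

section Calculus

variable {F G : Type*} [NormedAddCommGroup F] [NormedSpace ℝ F] [NormedAddCommGroup G]
  [NormedSpace ℝ G]

/-- The derivative of a function on the cylinder along a constant direction. -/
def pd (e : ℝ × ℝ) (v : ℝ × ℝ → F) (p : ℝ × ℝ) : F := fderiv ℝ v p e

/-- The derivative along the axis of the cylinder. -/
notation "∂ₛ" => pd ((1 : ℝ), (0 : ℝ))

/-- The angular derivative. -/
notation "∂ₐ" => pd ((0 : ℝ), (1 : ℝ))

theorem contDiff_pd {v : ℝ × ℝ → F} {n m : WithTop ℕ∞} (hv : ContDiff ℝ n v) (h : m + 1 ≤ n)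
    (e : ℝ × ℝ) : ContDiff ℝ m (pd e v) :=
  (hv.fderiv_right h).clm_apply contDiff_const

theorem hasDerivAt_ds {v : ℝ × ℝ → F} (hv : Differentiable ℝ v) (s a : ℝ) :
    HasDerivAt (fun s => v (s, a)) (∂ₛ v (s, a)) s :=
  (hv (s, a)).hasFDerivAt.comp_hasDerivAt s ((hasDerivAt_id s).prodMk (hasDerivAt_const s a))

theorem hasDerivAt_da {v : ℝ × ℝ → F} (hv : Differentiable ℝ v) (s a : ℝ) :
    HasDerivAt (fun a => v (s, a)) (∂ₐ v (s, a)) a :=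
  (hv (s, a)).hasFDerivAt.comp_hasDerivAt a ((hasDerivAt_const a s).prodMk (hasDerivAt_id a))

theorem ds_eq {v : ℝ × ℝ → F} (hv : Differentiable ℝ v) {s a : ℝ} {d : F}
    (h : HasDerivAt (fun s => v (s, a)) d s) : ∂ₛ v (s, a) = d :=
  (hasDerivAt_ds hv s a).unique h

theorem da_eq {v : ℝ × ℝ → F} (hv : Differentiable ℝ v) {s a : ℝ} {d : F}
    (h : HasDerivAt (fun a => v (s, a)) d a) : ∂ₐ v (s, a) = d :=
  (hasDerivAt_da hv s a).unique h

theorem pd_add {v w : ℝ × ℝ → F} (hv : Differentiable ℝ v) (hw : Differentiable ℝ w)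
    (e p : ℝ × ℝ) : pd e (fun p => v p + w p) p = pd e v p + pd e w p := by
  unfold pd
  rw [fderiv_fun_add (hv p) (hw p)]; rfl

theorem pd_const_smul {v : ℝ × ℝ → F} (hv : Differentiable ℝ v) (c : ℝ)
    (e p : ℝ × ℝ) : pd e (fun p => c • v p) p = c • pd e v p := by
  unfold pd
  rw [fderiv_fun_const_smul (hv p)]; rfl

theorem pd_smul {c : ℝ × ℝ → ℝ} {v : ℝ × ℝ → F} (hc : Differentiable ℝ c)
    (hv : Differentiable ℝ v) (e p : ℝ × ℝ) :
    pd e (fun p => c p • v p) p = c p • pd e v p + pd e c p • v p := by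
  unfold pd
  rw [fderiv_fun_smul (hc p) (hv p)]; rfl

theorem pd_inner {E : Type*} [NormedAddCommGroup E] [InnerProductSpace ℝ E] {v w : ℝ × ℝ → E}
    (hv : Differentiable ℝ v) (hw : Differentiable ℝ w) (e p : ℝ × ℝ) :
    pd e (fun p => ⟪v p, w p⟫) p = ⟪v p, pd e w p⟫ + ⟪pd e v p, w p⟫ := by
  unfold pd
  rw [fderiv_inner_apply ℝ (hv p) (hw p)]

theorem pd_comp {v : ℝ × ℝ → F} {g : F → G} {p : ℝ × ℝ} (hg : DifferentiableAt ℝ g (v p))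
    (hv : Differentiable ℝ v) (e : ℝ × ℝ) :
    pd e (fun p => g (v p)) p = fderiv ℝ g (v p) (pd e v p) := by
  unfold pd
  rw [show (fun p => g (v p)) = g ∘ v from rfl, fderiv_comp p hg (hv p)]
  rfl

theorem pd_comm {v : ℝ × ℝ → F} (hv : ContDiff ℝ 2 v) (e e' p : ℝ × ℝ) :
    pd e (pd e' v) p = pd e' (pd e v) p := by
  have hd : Differentiable ℝ (fderiv ℝ v) :=
    (hv.fderiv_right (m := 1) (by norm_num)).differentiable (by norm_num)
  have h : ∀ x y : ℝ × ℝ, pd x (pd y v) p = fderiv ℝ (fderiv ℝ v) p x y := by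
    intro x y
    unfold pd
    rw [fderiv_clm_apply (hd p) (differentiableAt_const _)]
    simp
  rw [h, h]
  exact (hv.contDiffAt.isSymmSndFDerivAt (by simp)).eq e e'

/-- A function on the cylinder, seen as a `2π`-periodic function of its second variable. -/
def AnglePeriodic {F : Type*} (v : ℝ × ℝ → F) : Prop :=
  ∀ s a, v (s, a + 2 * Real.pi) = v (s, a)

theorem AnglePeriodic.pd {v : ℝ × ℝ → F} (h : AnglePeriodic v) (e : ℝ × ℝ) :
    AnglePeriodic (pd e v) := by
  intro s a
  have hv : v = fun p => v (p + (0, 2 * Real.pi)) := by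
    funext ⟨s, a⟩; rw [Prod.mk_add_mk, add_zero, h]
  unfold EpsHarmonic.pd
  conv_rhs => rw [hv, fderiv_comp_add_right]
  simp

theorem AnglePeriodic.eq_neg_pi {F : Type*} {v : ℝ × ℝ → F} (h : AnglePeriodic v) (s : ℝ) :
    v (s, Real.pi) = v (s, -Real.pi) := by
  have := h s (-Real.pi)
  rwa [show -Real.pi + 2 * Real.pi = Real.pi by ring] at this

/-- The integral over the angle. -/
def angInt (v : ℝ × ℝ → F) (s : ℝ) : F := ∫ a in (-Real.pi)..Real.pi, v (s, a)

theorem neg_pi_le_pi : -Real.pi ≤ Real.pi := by linarith [Real.pi_pos]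

theorem intervalIntegrable_angle {F : Type*} [NormedAddCommGroup F] {v : ℝ × ℝ → F}
    (hv : Continuous v) (s x y : ℝ) :
    IntervalIntegrable (fun a => v (s, a)) volume x y :=
  (hv.comp (Continuous.prodMk_right s)).intervalIntegrable _ _

theorem hasDerivAt_angInt [CompleteSpace F] {v : ℝ × ℝ → F} (hv : ContDiff ℝ 1 v) (s : ℝ) :
    HasDerivAt (angInt v) (angInt (∂ₛ v) s) s := by
  have hc : Continuous (∂ₛ v) := (contDiff_pd (m := 0) hv (by norm_num) _).continuous
  obtain ⟨C, hC⟩ := ((isCompact_Icc (a := s - 1) (b := s + 1)).prod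
    (isCompact_Icc (a := -Real.pi) (b := Real.pi))).exists_bound_of_continuousOn hc.continuousOn
  refine (intervalIntegral.hasDerivAt_integral_of_dominated_loc_of_deriv_le
    (F := fun s a => v (s, a)) (F' := fun s a => ∂ₛ v (s, a)) (bound := fun _ => C)
    (Icc_mem_nhds (by linarith : s - 1 < s) (by linarith : s < s + 1)) ?_
    (intervalIntegrable_angle hv.continuous _ _ _) ?_ ?_ ?_ ?_).2
  · exact Filter.Eventually.of_forall fun x =>
      (hv.continuous.comp (Continuous.prodMk_right x)).aestronglyMeasurable
  · exact (hc.comp (Continuous.prodMk_right s)).aestronglyMeasurable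
  · refine Filter.Eventually.of_forall fun a ha x hx => hC (x, a) ⟨hx, ?_⟩
    rw [Set.uIoc_of_le neg_pi_le_pi] at ha
    exact Set.Ioc_subset_Icc_self ha
  · exact intervalIntegrable_const
  · exact Filter.Eventually.of_forall fun a _ x _ =>
      hasDerivAt_ds (hv.differentiable (by norm_num)) x a

theorem angInt_da [CompleteSpace F] {v : ℝ × ℝ → F} (hv : ContDiff ℝ 1 v) (hp : AnglePeriodic v)
    (s : ℝ) : angInt (∂ₐ v) s = 0 := by
  unfold angInt
  rw [intervalIntegral.integral_eq_sub_of_hasDerivAt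
    (fun a _ => hasDerivAt_da (hv.differentiable (by norm_num)) s a)
    (intervalIntegrable_angle
      (contDiff_pd (m := 0) hv (by norm_num) _).continuous _ _ _), hp.eq_neg_pi, sub_self]

theorem angInt_add {v w : ℝ × ℝ → F} (hv : Continuous v) (hw : Continuous w) (s : ℝ) :
    angInt (fun p => v p + w p) s = angInt v s + angInt w s :=
  intervalIntegral.integral_add (intervalIntegrable_angle hv _ _ _)
    (intervalIntegrable_angle hw _ _ _)

theorem strip_eq_prod :
    strip = (volume : Measure ℝ).prod (volume.restrict (Set.Ioo (-Real.pi) Real.pi)) := by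
  rw [strip, Measure.volume_eq_prod, ← Measure.prod_restrict, Measure.restrict_univ]

theorem angInt_eq (v : ℝ × ℝ → F) (s : ℝ) :
    angInt v s = ∫ a in Set.Ioo (-Real.pi) Real.pi, v (s, a) := by
  rw [angInt, intervalIntegral.integral_of_le neg_pi_le_pi, integral_Ioc_eq_integral_Ioo]

theorem integrable_angInt {v : ℝ × ℝ → F} (hv : Integrable v strip) : Integrable (angInt v) := by
  rw [strip_eq_prod] at hv
  exact hv.integral_prod_left.congr (Filter.Eventually.of_forall fun s => (angInt_eq v s).symm)

theorem integral_strip {v : ℝ × ℝ → F} (hv : Integrable v strip) :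
    ∫ p, v p ∂strip = ∫ s, angInt v s := by
  rw [strip_eq_prod] at hv ⊢
  rw [integral_prod _ hv]
  exact integral_congr_ae (Filter.Eventually.of_forall fun s => (angInt_eq v s).symm)

theorem norm_angInt_le {v : ℝ × ℝ → F} {s C : ℝ} (h : ∀ a, ‖v (s, a)‖ ≤ C) :
    ‖angInt v s‖ ≤ C * (2 * Real.pi) := by
  refine (intervalIntegral.norm_integral_le_of_norm_le_const fun a _ => h a).trans_eq ?_
  rw [abs_of_nonneg (by linarith [neg_pi_le_pi])]; ring

/-- The Cauchy-Schwarz inequality over the circle. -/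
theorem norm_angInt_sq_le {v : ℝ × ℝ → F} (hv : Continuous v) (s : ℝ) :
    ‖angInt v s‖ ^ 2 ≤ 2 * Real.pi * angInt (fun p => ‖v p‖ ^ 2) s := by
  set m := angInt (fun p => ‖v p‖) s with hm
  have h1 : ‖angInt v s‖ ≤ m := intervalIntegral.norm_integral_le_integral_norm neg_pi_le_pi
  have hpi := Real.pi_pos
  -- the variance of `‖v‖` over the circle is nonnegative
  have h2 : 0 ≤ ∫ a in (-Real.pi)..Real.pi, (‖v (s, a)‖ - m / (2 * Real.pi)) ^ 2 :=
    intervalIntegral.integral_nonneg neg_pi_le_pi fun a _ => sq_nonneg _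
  have h3 : ∫ a in (-Real.pi)..Real.pi, (‖v (s, a)‖ - m / (2 * Real.pi)) ^ 2
      = angInt (fun p => ‖v p‖ ^ 2) s - m ^ 2 / (2 * Real.pi) := by
    have e : ∀ a, (‖v (s, a)‖ - m / (2 * Real.pi)) ^ 2
        = ‖v (s, a)‖ ^ 2 - (m / Real.pi * ‖v (s, a)‖ - (m / (2 * Real.pi)) ^ 2) := by
      intro a; field_simp; ring
    simp_rw [e]
    have i1 : IntervalIntegrable (fun a => ‖v (s, a)‖) volume (-Real.pi) Real.pi :=
      intervalIntegrable_angle (v := fun p => ‖v p‖) hv.norm s _ _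
    rw [intervalIntegral.integral_sub
      (intervalIntegrable_angle (v := fun p => ‖v p‖ ^ 2) (hv.norm.pow 2) s _ _)
      ((i1.const_mul _).sub intervalIntegrable_const),
      intervalIntegral.integral_sub (i1.const_mul _) intervalIntegrable_const,
      intervalIntegral.integral_const_mul, intervalIntegral.integral_const]
    change angInt (fun p => ‖v p‖ ^ 2) s - (m / Real.pi * m - _) = _
    rw [smul_eq_mul]
    field_simp
    ring
  rw [h3] at h2
  have h4 : m ^ 2 ≤ 2 * Real.pi * angInt (fun p => ‖v p‖ ^ 2) s := by
    have : m ^ 2 / (2 * Real.pi) ≤ angInt (fun p => ‖v p‖ ^ 2) s := by linarith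
    rwa [div_le_iff₀ (by positivity), mul_comm] at this
  exact (pow_le_pow_left₀ (norm_nonneg _) h1 2).trans h4

/-- A function on the line with an integrable derivative whose square is integrable has an integral
derivative of integral zero: its limits at `±∞` exist and must vanish. -/
theorem integral_deriv_eq_zero_of_sq_integrable [CompleteSpace F] {f f' : ℝ → F}
    (hd : ∀ s, HasDerivAt f (f' s) s) (hf' : Integrable f')
    (hf : Integrable fun s => ‖f s‖ ^ 2) : ∫ s, f' s = 0 := by
  have ht := tendsto_limUnder_of_hasDerivAt_of_integrableOn_Ioi (a := 0)
    (fun x _ => hd x) hf'.integrableOn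
  have hb := tendsto_limUnder_of_hasDerivAt_of_integrableOn_Iic (a := 0)
    (fun x _ => hd x) hf'.integrableOn
  have zt : Filter.limUnder Filter.atTop f = 0 := by
    have := IntegrableAtFilter.eq_zero_of_tendsto (f := fun s => ‖f s‖ ^ 2) (μ := volume)
      (l := Filter.atTop) ⟨Set.univ, Filter.univ_mem, hf.integrableOn⟩ ?_ (ht.norm.pow 2)
    · simpa using this
    · intro u hu
      obtain ⟨b, hb⟩ : ∃ b : ℝ, Set.Ici b ⊆ u := Filter.mem_atTop_sets.1 hu
      exact measure_mono_top hb (by simp)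
  have zb : Filter.limUnder Filter.atBot f = 0 := by
    have := IntegrableAtFilter.eq_zero_of_tendsto (f := fun s => ‖f s‖ ^ 2) (μ := volume)
      (l := Filter.atBot) ⟨Set.univ, Filter.univ_mem, hf.integrableOn⟩ ?_ (hb.norm.pow 2)
    · simpa using this
    · intro u hu
      obtain ⟨b, hb⟩ : ∃ b : ℝ, Set.Iic b ⊆ u := Filter.mem_atBot_sets.1 hu
      exact measure_mono_top hb (by simp)
  rw [integral_of_hasDerivAt_of_tendsto hd hf' hb ht, zt, zb, sub_zero]

/-- The divergence theorem on the cylinder, under the weakest decay that is needed below: the axial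
component is square integrable and the divergence is integrable. -/
theorem integral_divergence_cylinder [CompleteSpace F] {W Z : ℝ × ℝ → F} (hW : ContDiff ℝ 1 W)
    (hZ : ContDiff ℝ 1 Z) (hper : AnglePeriodic Z) (hW2 : Integrable (fun p => ‖W p‖ ^ 2) strip)
    (hdiv : Integrable (fun p => ∂ₛ W p + ∂ₐ Z p) strip) :
    ∫ p, (∂ₛ W p + ∂ₐ Z p) ∂strip = 0 := by
  have cW : Continuous (∂ₛ W) := (contDiff_pd (m := 0) hW (by norm_num) _).continuous
  have cZ : Continuous (∂ₐ Z) := (contDiff_pd (m := 0) hZ (by norm_num) _).continuous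
  have h : ∀ s, angInt (fun p => ∂ₛ W p + ∂ₐ Z p) s = angInt (∂ₛ W) s := fun s => by
    rw [angInt_add cW cZ, angInt_da hZ hper, add_zero]
  rw [integral_strip hdiv]
  refine integral_deriv_eq_zero_of_sq_integrable (f := angInt W)
    (fun s => by rw [h]; exact hasDerivAt_angInt hW s) (integrable_angInt hdiv) ?_
  refine Integrable.mono' ((integrable_angInt hW2).const_mul (2 * Real.pi)) ?_
    (Filter.Eventually.of_forall fun s => ?_)
  · have : Continuous (angInt W) :=
      continuous_iff_continuousAt.2 fun s => (hasDerivAt_angInt hW s).continuousAt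
    exact (this.norm.pow 2).aestronglyMeasurable
  · rw [Real.norm_of_nonneg (by positivity)]
    exact norm_angInt_sq_le hW.continuous s

end Calculus

/-! ### Corotational fields -/

/-- The horizontal unit vector orthogonal to `rotVec a`. -/
def perpVec (a : ℝ) : E3 := -Real.sin a • stdVec 0 + Real.cos a • stdVec 1

/-- The corotational field with horizontal component `x` and vertical component `z`. -/
def corot (x z : ℝ → ℝ) (p : ℝ × ℝ) : E3 := x p.1 • rotVec p.2 + z p.1 • stdVec 2

theorem hasDerivAt_rotVec (a : ℝ) : HasDerivAt rotVec (perpVec a) a :=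
  ((Real.hasDerivAt_cos a).smul_const _).add ((Real.hasDerivAt_sin a).smul_const _)

theorem hasDerivAt_perpVec (a : ℝ) : HasDerivAt perpVec (-rotVec a) a := by
  refine (((Real.hasDerivAt_sin a).neg.smul_const _).add
    ((Real.hasDerivAt_cos a).smul_const _)).congr_deriv ?_
  rw [rotVec, neg_add, neg_smul, neg_smul]

theorem contDiff_perpVec {n : WithTop ℕ∞} : ContDiff ℝ n perpVec := by
  unfold perpVec
  exact (Real.contDiff_sin.neg.smul contDiff_const).add (Real.contDiff_cos.smul contDiff_const)

theorem contDiff_corot {n : WithTop ℕ∞} {x z : ℝ → ℝ} (hx : ContDiff ℝ n x)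
    (hz : ContDiff ℝ n z) : ContDiff ℝ n (corot x z) := by
  unfold corot
  exact ((hx.comp contDiff_fst).smul (contDiff_rotVec.comp contDiff_snd)).add
    ((hz.comp contDiff_fst).smul contDiff_const)

theorem rotVec_add_two_pi (a : ℝ) : rotVec (a + 2 * Real.pi) = rotVec a := by
  simp [rotVec]

theorem anglePeriodic_corot (x z : ℝ → ℝ) : AnglePeriodic (corot x z) := fun s a => by
  simp [corot, rotVec_add_two_pi]

theorem ds_corot {x z x' z' : ℝ → ℝ} (h : Differentiable ℝ (corot x z))
    (hx : ∀ s, HasDerivAt x (x' s) s) (hz : ∀ s, HasDerivAt z (z' s) s) :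
    ∂ₛ (corot x z) = corot x' z' := by
  funext ⟨s, a⟩
  exact ds_eq h (((hx s).smul_const (rotVec a)).add ((hz s).smul_const (stdVec 2)))

theorem da_corot {x z : ℝ → ℝ} (h : Differentiable ℝ (corot x z)) :
    ∂ₐ (corot x z) = fun p => x p.1 • perpVec p.2 := by
  funext ⟨s, a⟩
  refine da_eq h (((hasDerivAt_rotVec a).const_smul (x s)).add_const (z s • stdVec 2))

theorem ds_smul_perpVec {x x' : ℝ → ℝ}
    (h : Differentiable ℝ fun p : ℝ × ℝ => x p.1 • perpVec p.2)
    (hx : ∀ s, HasDerivAt x (x' s) s) :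
    ∂ₛ (fun p : ℝ × ℝ => x p.1 • perpVec p.2) = fun p => x' p.1 • perpVec p.2 := by
  funext ⟨s, a⟩
  exact ds_eq h ((hx s).smul_const (perpVec a))

theorem da_smul_perpVec {x : ℝ → ℝ} (h : Differentiable ℝ fun p : ℝ × ℝ => x p.1 • perpVec p.2) :
    ∂ₐ (fun p : ℝ × ℝ => x p.1 • perpVec p.2) = fun p => -(x p.1 • rotVec p.2) := by
  funext ⟨s, a⟩
  rw [← smul_neg]
  exact da_eq h ((hasDerivAt_perpVec a).const_smul (x s))

@[simp] theorem corot_zero (x z : ℝ → ℝ) (p : ℝ × ℝ) : corot x z p 0 = x p.1 * Real.cos p.2 := by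
  simp [corot, rotVec]

@[simp] theorem corot_one (x z : ℝ → ℝ) (p : ℝ × ℝ) : corot x z p 1 = x p.1 * Real.sin p.2 := by
  simp [corot, rotVec]

@[simp] theorem corot_two (x z : ℝ → ℝ) (p : ℝ × ℝ) : corot x z p 2 = z p.1 := by
  simp [corot, rotVec]

@[simp] theorem perpVec_zero (a : ℝ) : perpVec a 0 = -Real.sin a := by simp [perpVec]
@[simp] theorem perpVec_one (a : ℝ) : perpVec a 1 = Real.cos a := by simp [perpVec]
@[simp] theorem perpVec_two (a : ℝ) : perpVec a 2 = 0 := by simp [perpVec]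
@[simp] theorem rotVec_zero (a : ℝ) : rotVec a 0 = Real.cos a := by simp [rotVec]
@[simp] theorem rotVec_one (a : ℝ) : rotVec a 1 = Real.sin a := by simp [rotVec]
@[simp] theorem rotVec_two (a : ℝ) : rotVec a 2 = 0 := by simp [rotVec]

theorem norm_perpVec (a : ℝ) : ‖perpVec a‖ = 1 := by
  have h : ‖perpVec a‖ ^ 2 = 1 := by
    rw [norm_sq_eq, perpVec_zero, perpVec_one, perpVec_two]
    linear_combination Real.sin_sq_add_cos_sq a
  nlinarith [norm_nonneg (perpVec a)]

theorem norm_rotVec (a : ℝ) : ‖rotVec a‖ = 1 := by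
  have h : ‖rotVec a‖ ^ 2 = 1 := by
    rw [norm_sq_eq, rotVec_zero, rotVec_one, rotVec_two]
    linear_combination Real.sin_sq_add_cos_sq a
  nlinarith [norm_nonneg (rotVec a)]

theorem norm_corot_sq (x z : ℝ → ℝ) (p : ℝ × ℝ) : ‖corot x z p‖ ^ 2 = x p.1 ^ 2 + z p.1 ^ 2 := by
  rw [norm_sq_eq, corot_zero, corot_one, corot_two]
  linear_combination (x p.1) ^ 2 * Real.sin_sq_add_cos_sq p.2

/-! ### The differential of the parametrization -/

theorem cyl_eq_corot : cyl = corot (fun s => (Real.cosh s)⁻¹) Real.tanh := rfl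

theorem differentiable_cyl : Differentiable ℝ cyl :=
  (contDiff_cyl (n := 1)).differentiable (by norm_num)

theorem ds_cyl : ∂ₛ cyl = corot (fun s => -Real.tanh s * (Real.cosh s)⁻¹)
    (fun s => (Real.cosh s)⁻¹ ^ 2) :=
  ds_corot (x := fun s => (Real.cosh s)⁻¹) (z := Real.tanh) differentiable_cyl hasDerivAt_inv_cosh hasDerivAt_tanh

theorem da_cyl : ∂ₐ cyl = fun p => (Real.cosh p.1)⁻¹ • perpVec p.2 :=
  da_corot (x := fun s => (Real.cosh s)⁻¹) (z := Real.tanh) differentiable_cyl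

theorem contDiff_pd_cyl {n : WithTop ℕ∞} (e : ℝ × ℝ) : ContDiff ℝ n (pd e cyl) :=
  contDiff_pd (contDiff_cyl (n := n + 1)) le_rfl e

theorem differentiable_pd_cyl (e : ℝ × ℝ) : Differentiable ℝ (pd e cyl) :=
  (contDiff_pd_cyl (n := 1) e).differentiable (by norm_num)

theorem ds_ds_cyl (p : ℝ × ℝ) :
    ∂ₛ (∂ₛ cyl) p = -(Real.tanh p.1 • ∂ₛ cyl p) - (Real.cosh p.1)⁻¹ ^ 2 • cyl p := by
  have hd := differentiable_pd_cyl (1, 0)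
  have h1 : ∀ s, HasDerivAt (fun s => -Real.tanh s * (Real.cosh s)⁻¹)
      (-(Real.cosh s)⁻¹ ^ 2 * (Real.cosh s)⁻¹ + -Real.tanh s * (-Real.tanh s * (Real.cosh s)⁻¹))
      s := fun s => (hasDerivAt_tanh s).neg.mul (hasDerivAt_inv_cosh s)
  have h2 : ∀ s, HasDerivAt (fun s => (Real.cosh s)⁻¹ ^ 2)
      (2 * (Real.cosh s)⁻¹ * (-Real.tanh s * (Real.cosh s)⁻¹)) s := fun s => by
    simpa using (hasDerivAt_inv_cosh s).fun_pow 2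
  change Differentiable ℝ (∂ₛ cyl) at hd
  rw [ds_cyl] at hd ⊢
  rw [ds_corot hd h1 h2, cyl_eq_corot]
  apply E3_ext <;> simp <;> ring

theorem ds_da_cyl (p : ℝ × ℝ) : ∂ₛ (∂ₐ cyl) p = -(Real.tanh p.1 • ∂ₐ cyl p) := by
  have hd := differentiable_pd_cyl (0, 1)
  change Differentiable ℝ (∂ₐ cyl) at hd
  rw [da_cyl] at hd ⊢
  rw [ds_smul_perpVec hd hasDerivAt_inv_cosh]
  simp only [smul_smul, ← neg_smul, neg_mul]

theorem da_ds_cyl (p : ℝ × ℝ) : ∂ₐ (∂ₛ cyl) p = -(Real.tanh p.1 • ∂ₐ cyl p) := by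
  rw [← ds_da_cyl]; exact pd_comm contDiff_cyl _ _ _

theorem da_da_cyl (p : ℝ × ℝ) :
    ∂ₐ (∂ₐ cyl) p = Real.tanh p.1 • ∂ₛ cyl p - (Real.cosh p.1)⁻¹ ^ 2 • cyl p := by
  have hd := differentiable_pd_cyl (0, 1)
  change Differentiable ℝ (∂ₐ cyl) at hd
  rw [da_cyl] at hd ⊢
  rw [da_smul_perpVec (x := fun s => (Real.cosh s)⁻¹) hd, ds_cyl, cyl_eq_corot]
  have h := tanh_sq_add_inv_cosh_sq p.1
  apply E3_ext
  · simp; linear_combination ((Real.cosh p.1)⁻¹ * Real.cos p.2) * h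
  · simp; linear_combination ((Real.cosh p.1)⁻¹ * Real.sin p.2) * h
  · simp; ring

/-- The coordinate frame is conformal: up to the factor `1 / cosh² s`, it resolves the projection to
the tangent plane. -/
theorem frame_apply (p : ℝ × ℝ) (i j : Fin 3) :
    ∂ₛ cyl p i * ∂ₛ cyl p j + ∂ₐ cyl p i * ∂ₐ cyl p j
      = (Real.cosh p.1)⁻¹ ^ 2 * ((if i = j then 1 else 0) - cyl p i * cyl p j) := by
  rw [ds_cyl, da_cyl]
  have h1 := tanh_sq_add_inv_cosh_sq p.1
  have h2 := Real.sin_sq_add_cos_sq p.2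
  generalize hc : (Real.cosh p.1)⁻¹ = c at h1
  fin_cases i <;> fin_cases j <;> simp [hc, -inv_pow]
  · linear_combination c ^ 2 * Real.cos p.2 ^ 2 * h1 + c ^ 2 * h2
  · linear_combination c ^ 2 * Real.cos p.2 * Real.sin p.2 * h1
  · ring
  · linear_combination c ^ 2 * Real.cos p.2 * Real.sin p.2 * h1
  · linear_combination c ^ 2 * Real.sin p.2 ^ 2 * h1 + c ^ 2 * h2
  · ring
  · left; ring
  · left; ring
  · left; linear_combination h1

theorem norm_sq_ds_cyl (p : ℝ × ℝ) : ‖∂ₛ cyl p‖ ^ 2 = (Real.cosh p.1)⁻¹ ^ 2 := by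
  rw [ds_cyl, norm_corot_sq]
  linear_combination (Real.cosh p.1)⁻¹ ^ 2 * tanh_sq_add_inv_cosh_sq p.1

theorem norm_ds_cyl (p : ℝ × ℝ) : ‖∂ₛ cyl p‖ = (Real.cosh p.1)⁻¹ :=
  (pow_left_inj₀ (norm_nonneg _) (inv_nonneg.2 (Real.cosh_pos _).le) two_ne_zero).1
    (norm_sq_ds_cyl p)

theorem norm_da_cyl (p : ℝ × ℝ) : ‖∂ₐ cyl p‖ = (Real.cosh p.1)⁻¹ := by
  rw [da_cyl, norm_smul, norm_perpVec, mul_one, Real.norm_of_nonneg (by positivity)]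

theorem norm_sq_da_cyl (p : ℝ × ℝ) : ‖∂ₐ cyl p‖ ^ 2 = (Real.cosh p.1)⁻¹ ^ 2 := by
  rw [norm_da_cyl]

theorem inner_cyl_ds (p : ℝ × ℝ) : ⟪∂ₛ cyl p, cyl p⟫ = 0 := by
  rw [ds_cyl, cyl_eq_corot, inner_eq]
  simp
  linear_combination -(Real.tanh p.1 * (Real.cosh p.1)⁻¹ ^ 2) * Real.sin_sq_add_cos_sq p.2

theorem inner_cyl_da (p : ℝ × ℝ) : ⟪∂ₐ cyl p, cyl p⟫ = 0 := by
  rw [da_cyl, cyl_eq_corot, inner_eq]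
  simp
  ring

theorem inner_ds_da_cyl (p : ℝ × ℝ) : ⟪∂ₛ cyl p, ∂ₐ cyl p⟫ = 0 := by
  rw [da_cyl, ds_cyl, inner_eq]
  simp
  ring

theorem E3_eq_sum (v : E3) : v = ∑ i, v i • stdVec i := by
  rw [Fin.sum_univ_three]
  apply E3_ext <;> simp

theorem inner_clm_apply (T : E3 →L[ℝ] E3) (v : E3) :
    ⟪T v, v⟫ = ∑ i, ∑ j, (v i * v j) * ⟪T (stdVec i), stdVec j⟫ := by
  conv_lhs => rw [E3_eq_sum v]
  simp only [map_sum, map_smul, sum_inner, inner_sum, real_inner_smul_left, real_inner_smul_right]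
  rw [Finset.sum_comm]
  exact Finset.sum_congr rfl fun i _ => Finset.sum_congr rfl fun j _ => by ring

/-- The trace over the tangent plane, computed in the coordinate frame. -/
theorem frame_trace (T : E3 →L[ℝ] E3) (p : ℝ × ℝ) :
    ⟪T (∂ₛ cyl p), ∂ₛ cyl p⟫ + ⟪T (∂ₐ cyl p), ∂ₐ cyl p⟫
      = (Real.cosh p.1)⁻¹ ^ 2 * ((∑ i, ⟪T (stdVec i), stdVec i⟫) - ⟪T (cyl p), cyl p⟫) := by
  simp only [inner_clm_apply T (∂ₛ cyl p), inner_clm_apply T (∂ₐ cyl p), inner_clm_apply T (cyl p)]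
  have h : ∀ i, ⟪T (stdVec i), stdVec i⟫
      = ∑ j, (if i = j then 1 else 0) * ⟪T (stdVec i), stdVec j⟫ := fun i => by simp
  rw [Finset.sum_congr rfl fun i _ => h i]
  simp only [← Finset.sum_add_distrib, ← Finset.sum_sub_distrib, Finset.mul_sum, ← add_mul,
    ← sub_mul, frame_apply]
  exact Finset.sum_congr rfl fun i _ => Finset.sum_congr rfl fun j _ => by ring

/-- The divergence of a tangent field in cylindrical coordinates. -/
theorem divergence_cyl {X : E3 → E3} (hX : IsSmoothTangentField X) (p : ℝ × ℝ) :
    ∂ₛ (fun p => ⟪X (cyl p), ∂ₛ cyl p⟫) p + ∂ₐ (fun p => ⟪X (cyl p), ∂ₐ cyl p⟫) p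
      = (Real.cosh p.1)⁻¹ ^ 2 * sphereDiv X (cylS p) := by
  have hXd : Differentiable ℝ X := hX.1.differentiable (by simp)
  have hXc : Differentiable ℝ fun p => X (cyl p) := hXd.comp differentiable_cyl
  have hn : ⟪X (cyl p), cyl p⟫ = 0 := hX.2 (cylS p)
  rw [pd_inner hXc (differentiable_pd_cyl _), pd_inner hXc (differentiable_pd_cyl _),
    pd_comp (hXd _) differentiable_cyl, pd_comp (hXd _) differentiable_cyl, sphereDiv, coe_cylS,
    ← frame_trace]
  change ⟪X (cyl p), ∂ₛ (∂ₛ cyl) p⟫ + _ + (⟪X (cyl p), ∂ₐ (∂ₐ cyl) p⟫ + _) = _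
  rw [ds_ds_cyl, da_da_cyl]
  simp only [inner_sub_right, inner_neg_right, real_inner_smul_right, hn]
  ring

/-! ### Weak differentials in cylindrical coordinates -/

/-- The differential of a map of the sphere at the point with coordinates `p`, in terms of the
coordinate expression `v` of the map; it vanishes on the normal vector. -/
def cylForm (v : ℝ × ℝ → E3) (p : ℝ × ℝ) : E3 →L[ℝ] E3 :=
  Real.cosh p.1 ^ 2 • ((innerSL ℝ (∂ₛ cyl p)).smulRight (∂ₛ v p)
    + (innerSL ℝ (∂ₐ cyl p)).smulRight (∂ₐ v p))

theorem cylForm_apply (v : ℝ × ℝ → E3) (p : ℝ × ℝ) (w : E3) :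
    cylForm v p w = Real.cosh p.1 ^ 2 • (⟪∂ₛ cyl p, w⟫ • ∂ₛ v p + ⟪∂ₐ cyl p, w⟫ • ∂ₐ v p) := by
  simp [cylForm]

theorem anglePeriodic_cyl : AnglePeriodic cyl :=
  anglePeriodic_corot (fun s => (Real.cosh s)⁻¹) Real.tanh

open Classical in
/-- The differential on the sphere, with the value zero at the poles. -/
def cylDiff (v : ℝ × ℝ → E3) (x : S2) : E3 →L[ℝ] E3 :=
  if cylS (coord x) = x then cylForm v (coord x) else 0

theorem cylDiff_ae_eq (v : ℝ × ℝ → E3) : cylDiff v =ᵐ[area] fun x => cylForm v (coord x) :=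
  ae_cylS_coord.mono fun x hx => by rw [cylDiff, if_pos hx]

/-- The coordinate expressions of the `W^{1,2}` maps of the sphere that are `C¹` off the poles. -/
structure CylW12 (v : ℝ × ℝ → E3) : Prop where
  contDiff : ContDiff ℝ 1 v
  periodic : AnglePeriodic v
  memLp : MemLp (fun p => (Real.cosh p.1)⁻¹ • v p) 2 strip
  memLp_ds : MemLp (∂ₛ v) 2 strip
  memLp_da : MemLp (∂ₐ v) 2 strip

theorem continuous_pd {F : Type*} [NormedAddCommGroup F] [NormedSpace ℝ F] {v : ℝ × ℝ → F}
    (hv : ContDiff ℝ 1 v) (e : ℝ × ℝ) : Continuous (pd e v) :=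
  (contDiff_pd (m := 0) hv (by norm_num) e).continuous

theorem continuous_cosh_fst : Continuous fun p : ℝ × ℝ => Real.cosh p.1 :=
  Real.continuous_cosh.comp continuous_fst

theorem continuous_inv_cosh_fst : Continuous fun p : ℝ × ℝ => (Real.cosh p.1)⁻¹ :=
  continuous_cosh_fst.inv₀ fun _ => (Real.cosh_pos _).ne'

theorem continuous_cylForm {v : ℝ × ℝ → E3} (hv : ContDiff ℝ 1 v) : Continuous (cylForm v) := by
  have h1 := continuous_pd (contDiff_cyl (n := 1)) (1, 0)
  have h2 := continuous_pd (contDiff_cyl (n := 1)) (0, 1)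
  have h3 := continuous_pd hv (1, 0)
  have h4 := continuous_pd hv (0, 1)
  unfold cylForm
  refine (continuous_cosh_fst.pow 2).smul (Continuous.add ?_ ?_)
  · exact ((ContinuousLinearMap.smulRightL ℝ E3 E3).continuous₂).comp
      (((innerSL ℝ).continuous.comp h1).prodMk h3)
  · exact ((ContinuousLinearMap.smulRightL ℝ E3 E3).continuous₂).comp
      (((innerSL ℝ).continuous.comp h2).prodMk h4)

theorem norm_cylForm_le (v : ℝ × ℝ → E3) (p : ℝ × ℝ) :
    (Real.cosh p.1)⁻¹ * ‖cylForm v p‖ ≤ ‖∂ₛ v p‖ + ‖∂ₐ v p‖ := by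
  have h0 := Real.cosh_pos p.1
  have h : ‖cylForm v p‖ ≤ Real.cosh p.1 * (‖∂ₛ v p‖ + ‖∂ₐ v p‖) := by
    unfold cylForm
    rw [norm_smul, Real.norm_of_nonneg (by positivity)]
    calc _ ≤ Real.cosh p.1 ^ 2 * (‖∂ₛ cyl p‖ * ‖∂ₛ v p‖ + ‖∂ₐ cyl p‖ * ‖∂ₐ v p‖) := by
          gcongr
          refine (norm_add_le _ _).trans ?_
          rw [ContinuousLinearMap.norm_smulRight_apply, ContinuousLinearMap.norm_smulRight_apply,
            innerSL_apply_norm, innerSL_apply_norm]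
      _ = _ := by rw [norm_ds_cyl, norm_da_cyl]; field_simp
  rw [inv_mul_le_iff₀ h0]
  exact h

theorem exists_bound_sphere {F : Type*} [NormedAddCommGroup F] {g : S2 → F} (hg : Continuous g) :
    ∃ C, 0 ≤ C ∧ ∀ x, ‖g x‖ ≤ C := by
  obtain ⟨C, hC⟩ := isCompact_univ.exists_bound_of_continuousOn hg.continuousOn
  exact ⟨max C 0, le_max_right _ _, fun x => (hC x (Set.mem_univ x)).trans (le_max_left _ _)⟩

theorem continuous_sphereDiv {X : E3 → E3} (hX : ContDiff ℝ ∞ X) : Continuous (sphereDiv X) := by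
  have h : Continuous (fderiv ℝ X) := hX.continuous_fderiv (by simp)
  have h' : Continuous fun x : S2 => fderiv ℝ X x := h.comp continuous_subtype_val
  unfold sphereDiv
  refine (continuous_finsetSum _ fun i _ => ?_).sub ?_
  · exact (h'.clm_apply continuous_const).inner continuous_const
  · exact (h'.clm_apply continuous_subtype_val).inner continuous_subtype_val

theorem memLp_inv_cosh : MemLp (fun p : ℝ × ℝ => (Real.cosh p.1)⁻¹) 2 strip := by
  rw [memLp_two_iff_integrable_sq continuous_inv_cosh_fst.aestronglyMeasurable]
  have h : Integrable (fun x : S2 => (1 : ℝ)) area := integrable_const _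
  rw [area_eq_map, integrable_map_measure aestronglyMeasurable_const measurable_cylS.aemeasurable,
    integrable_withDensity_iff_integrable_smul continuous_dens.measurable] at h
  refine h.congr (Filter.Eventually.of_forall fun p => ?_)
  simp only [Function.comp]
  exact mul_one _

theorem MemLp.integrable_mul_norm {α F : Type*} [NormedAddCommGroup F] [MeasurableSpace α]
    {μ : Measure α} {f : α → ℝ} {g h : α → F} (hf : MemLp f 2 μ) (hg : MemLp g 2 μ)
    (hh : AEStronglyMeasurable h μ) {C : ℝ} (hle : ∀ᵐ x ∂μ, ‖h x‖ ≤ C * (f x * ‖g x‖)) :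
    Integrable h μ :=
  Integrable.mono' ((hf.integrable_mul hg.norm).const_mul C) hh hle

/-- The pointwise differential is the weak differential. With `ξ` and `ζ` the components of a
tangent field `X` along `∂ₛ cyl` and `∂ₐ cyl`, both integrals are those of `ξ ∂ₛv + ζ ∂ₐv` and of
the divergence of `(ξ, ζ)` times `v`, so they add up to a divergence on the cylinder. No boundary
terms appear at the poles, because `ξ` and `ζ` are bounded by a multiple of `1 / cosh`. -/
theorem hasWeakDifferential_cylDiff {v : ℝ × ℝ → E3} (hv : CylW12 v) {u : S2 → E3}
    (hu : ∀ᵐ x ∂area, u x = v (coord x)) : HasWeakDifferential u (cylDiff v) where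
  memLp_map := (memLp_comp_coord hv.contDiff.continuous hv.memLp).ae_eq
    (hu.mono fun x hx => hx.symm)
  memLp_diff := by
    refine (memLp_comp_coord (continuous_cylForm hv.contDiff) ?_).ae_eq (cylDiff_ae_eq v).symm
    refine (hv.memLp_ds.norm.add hv.memLp_da.norm).mono'
      (continuous_inv_cosh_fst.smul (continuous_cylForm hv.contDiff)).aestronglyMeasurable
      (Filter.Eventually.of_forall fun p => ?_)
    rw [norm_smul, Real.norm_of_nonneg (inv_nonneg.2 (Real.cosh_pos _).le)]
    exact norm_cylForm_le v p
  normal x := by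
    unfold cylDiff
    split_ifs with h
    · conv_lhs => rw [← h]
      rw [coe_cylS, coord_cylS ⟨Complex.neg_pi_lt_arg _, Complex.arg_le_pi _⟩, cylForm_apply,
        inner_cyl_ds, inner_cyl_da]
      simp
    · rfl
  integral_eq X hX := by
    have hXc : Continuous fun x : S2 => X x := hX.1.continuous.comp continuous_subtype_val
    have cv := hv.contDiff.continuous
    have cF := continuous_cylForm hv.contDiff
    have cD := continuous_sphereDiv hX.1
    obtain ⟨C, hC0, hC⟩ := exists_bound_sphere hXc
    obtain ⟨C', hC0', hC'⟩ := exists_bound_sphere cD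
    -- the components of `X` in the coordinate frame
    set ξ : ℝ × ℝ → ℝ := fun p => ⟪X (cyl p), ∂ₛ cyl p⟫ with hξ
    set ζ : ℝ × ℝ → ℝ := fun p => ⟪X (cyl p), ∂ₐ cyl p⟫ with hζ
    have hXcyl : ContDiff ℝ 1 fun p => X (cyl p) := (hX.1.of_le (by simp)).comp contDiff_cyl
    have hξ1 : ContDiff ℝ 1 ξ := hXcyl.inner ℝ (contDiff_pd_cyl _)
    have hζ1 : ContDiff ℝ 1 ζ := hXcyl.inner ℝ (contDiff_pd_cyl _)
    have dξ := hξ1.differentiable one_ne_zero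
    have dζ := hζ1.differentiable one_ne_zero
    have dv := hv.contDiff.differentiable one_ne_zero
    have bξ : ∀ p, |ξ p| ≤ C * (Real.cosh p.1)⁻¹ := fun p => by
      refine (abs_real_inner_le_norm _ _).trans ?_
      rw [norm_ds_cyl]
      exact mul_le_mul_of_nonneg_right (hC (cylS p)) (inv_nonneg.2 (Real.cosh_pos _).le)
    have bζ : ∀ p, |ζ p| ≤ C * (Real.cosh p.1)⁻¹ := fun p => by
      refine (abs_real_inner_le_norm _ _).trans ?_
      rw [norm_da_cyl]
      exact mul_le_mul_of_nonneg_right (hC (cylS p)) (inv_nonneg.2 (Real.cosh_pos _).le)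
    have hdiv := divergence_cyl hX
    have i1 : Integrable (fun p => ξ p • ∂ₛ v p) strip := by
      refine MemLp.integrable_mul_norm (C := C) memLp_inv_cosh hv.memLp_ds
        (hξ1.continuous.smul (continuous_pd hv.contDiff _)).aestronglyMeasurable
        (Filter.Eventually.of_forall fun p => ?_)
      rw [norm_smul, Real.norm_eq_abs, ← mul_assoc]
      exact mul_le_mul_of_nonneg_right (bξ p) (norm_nonneg _)
    have i2 : Integrable (fun p => ζ p • ∂ₐ v p) strip := by
      refine MemLp.integrable_mul_norm (C := C) memLp_inv_cosh hv.memLp_da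
        (hζ1.continuous.smul (continuous_pd hv.contDiff _)).aestronglyMeasurable
        (Filter.Eventually.of_forall fun p => ?_)
      rw [norm_smul, Real.norm_eq_abs, ← mul_assoc]
      exact mul_le_mul_of_nonneg_right (bζ p) (norm_nonneg _)
    have cdiv : Continuous fun p => (Real.cosh p.1)⁻¹ ^ 2 * sphereDiv X (cylS p) :=
      (continuous_inv_cosh_fst.pow 2).mul (cD.comp
        (Continuous.subtype_mk (contDiff_cyl (n := 1)).continuous _))
    have i3 : Integrable (fun p => ((Real.cosh p.1)⁻¹ ^ 2 * sphereDiv X (cylS p)) • v p)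
        strip := by
      refine MemLp.integrable_mul_norm (C := C') memLp_inv_cosh hv.memLp
        (cdiv.smul cv).aestronglyMeasurable (Filter.Eventually.of_forall fun p => ?_)
      have h0 := inv_nonneg.2 (Real.cosh_pos p.1).le
      rw [norm_smul, norm_mul, norm_smul, Real.norm_of_nonneg h0, Real.norm_of_nonneg (by positivity)]
      have := hC' (cylS p)
      calc _ = ‖sphereDiv X (cylS p)‖ * ((Real.cosh p.1)⁻¹ * ((Real.cosh p.1)⁻¹ * ‖v p‖)) := by ring
        _ ≤ _ := by gcongr
    have hpd : ∀ p, ∂ₛ (fun p => ξ p • v p) p + ∂ₐ (fun p => ζ p • v p) p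
        = (ξ p • ∂ₛ v p + ζ p • ∂ₐ v p)
          + ((Real.cosh p.1)⁻¹ ^ 2 * sphereDiv X (cylS p)) • v p := fun p => by
      rw [pd_smul dξ dv, pd_smul dζ dv, ← hdiv p, add_smul]
      abel
    have cylper : AnglePeriodic cyl := anglePeriodic_cyl
    have hper : AnglePeriodic fun p => ζ p • v p := fun s a => by
      simp only [hζ, hv.periodic s a, cylper s a, cylper.pd _ s a]
    have hW2 : Integrable (fun p => ‖ξ p • v p‖ ^ 2) strip := by
      have h2 := hv.memLp
      rw [memLp_two_iff_integrable_sq_norm h2.1] at h2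
      refine (h2.const_mul (C ^ 2)).mono'
        ((hξ1.continuous.smul cv).norm.pow 2).aestronglyMeasurable
        (Filter.Eventually.of_forall fun p => ?_)
      rw [Real.norm_of_nonneg (by positivity), ← mul_pow, norm_smul, norm_smul,
        Real.norm_of_nonneg (inv_nonneg.2 (Real.cosh_pos _).le), ← mul_assoc, Real.norm_eq_abs]
      gcongr
      exact bξ p
    -- only the axial component has to be square integrable, and no boundary term survives
    have key := integral_divergence_cylinder (W := fun p => ξ p • v p) (Z := fun p => ζ p • v p)
      (hξ1.smul hv.contDiff) (hζ1.smul hv.contDiff) hper hW2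
      (((i1.add i2).add i3).congr (Filter.Eventually.of_forall fun p => (hpd p).symm))
    rw [integral_congr_ae (Filter.Eventually.of_forall hpd)] at key
    replace key := (integral_add (i1.add i2) i3).symm.trans key
    have e1 : ∫ x, cylDiff v x (X x) ∂area = ∫ p, (ξ p • ∂ₛ v p + ζ p • ∂ₐ v p) ∂strip := by
      have : ∫ x, cylDiff v x (X x) ∂area = ∫ x, cylForm v (coord x) (X x) ∂area :=
        integral_congr_ae ((cylDiff_ae_eq v).mono fun x hx => by simp only [hx])
      rw [this, integral_area]
      · refine integral_congr_ae (ae_strip fun p hp => ?_)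
        simp only
        rw [coord_cylS (Set.Ioo_subset_Ioc_self hp), cylForm_apply, smul_smul, coe_cylS,
          inv_pow, inv_mul_cancel₀ (by have := Real.cosh_pos p.1; positivity), one_smul,
          real_inner_comm, real_inner_comm (X (cyl p)) (∂ₐ cyl p)]
      · exact (isBoundedBilinearMap_apply.continuous.comp_stronglyMeasurable
          ((stronglyMeasurable_comp_coord cF).prodMk
            hXc.stronglyMeasurable)).aestronglyMeasurable
    have e2 : ∫ x, sphereDiv X x • u x ∂area
        = ∫ p, ((Real.cosh p.1)⁻¹ ^ 2 * sphereDiv X (cylS p)) • v p ∂strip := by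
      have : ∫ x, sphereDiv X x • u x ∂area = ∫ x, sphereDiv X x • v (coord x) ∂area :=
        integral_congr_ae (hu.mono fun x hx => by simp only [hx])
      rw [this, integral_area]
      · refine integral_congr_ae (ae_strip fun p hp => ?_)
        simp only
        rw [coord_cylS (Set.Ioo_subset_Ioc_self hp), smul_smul]
      · exact (cD.stronglyMeasurable.smul (stronglyMeasurable_comp_coord cv)).aestronglyMeasurable
    rw [e1, e2]
    exact eq_neg_of_add_eq_zero_left key

/-- Weak differentials are unique almost everywhere: test with the tangential parts of the
coordinate fields, cut off by bump functions. -/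
theorem HasWeakDifferential.ae_eq {u : S2 → E3} {A B : S2 → E3 →L[ℝ] E3}
    (hA : HasWeakDifferential u A) (hB : HasWeakDifferential u B) : A =ᵐ[area] B := by
  have hemb : MeasurableEmbedding ((↑) : S2 → E3) :=
    MeasurableEmbedding.subtype_coe (measurableSet_eq_fun (by fun_prop) (by fun_prop))
  have key : ∀ j : Fin 3, ∀ᵐ x ∂area, (A x - B x) (stdVec j) = 0 := by
    intro j
    set D : S2 → E3 := fun x => (A x - B x) (stdVec j) with hD
    have hDint : Integrable D area :=
      (ContinuousLinearMap.apply ℝ E3 (stdVec j)).integrable_comp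
        ((hA.memLp_diff.sub hB.memLp_diff).integrable (by norm_num))
    have hext : ∀ x : S2, Function.extend ((↑) : S2 → E3) D 0 x = D x := fun x =>
      Subtype.val_injective.extend_apply _ _ x
    have hFint : Integrable (Function.extend ((↑) : S2 → E3) D 0) (area.map (↑)) := by
      rw [hemb.integrable_map_iff]
      exact hDint.congr (Filter.Eventually.of_forall fun x => (hext x).symm)
    -- the difference of the `j`-th entries, pushed forward to the ambient space, annihilates all
    -- test functions `η`
    have h0 := ae_eq_zero_of_integral_contDiff_smul_eq_zero hFint.locallyIntegrable
      (fun η hη hηc => by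
        rw [hemb.integral_map]
        simp only [hext]
        -- on the normal vector both differentials vanish, so only the `stdVec j` part of `X` is
        -- seen
        set X : E3 → E3 := fun y => η y • (stdVec j - ⟪y, stdVec j⟫ • y) with hX
        have hXs : IsSmoothTangentField X := by
          refine ⟨?_, fun x => ?_⟩
          · exact hη.smul (contDiff_const.sub ((contDiff_id.inner ℝ contDiff_const).smul contDiff_id))
          · simp only [hX]
            rw [real_inner_smul_left, inner_sub_left, real_inner_smul_left,
              real_inner_self_eq_norm_sq, real_inner_comm]
            simp
        have hη' : Continuous fun x : S2 => η x := hη.continuous.comp continuous_subtype_val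
        obtain ⟨C, hC0, hC⟩ := exists_bound_sphere hη'
        have e : ∀ T : S2 → E3 →L[ℝ] E3, (∀ x : S2, T x (x : E3) = 0) →
            ∀ x : S2, T x (X x) = η x • T x (stdVec j) := fun T hT x => by
          simp [hX, hT]
        have i : ∀ T : S2 → E3 →L[ℝ] E3, MemLp T 2 area →
            Integrable (fun x : S2 => η x • T x (stdVec j)) area := fun T hT => by
          exact Integrable.bdd_smul ((ContinuousLinearMap.apply ℝ E3 (stdVec j)).integrable_comp
            (hT.integrable (by norm_num))) C hη'.aestronglyMeasurable (Filter.Eventually.of_forall hC)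
        have h1 := hA.integral_eq X hXs
        rw [← hB.integral_eq X hXs] at h1
        simp only [e A hA.normal, e B hB.normal] at h1
        have : ∀ x : S2, η x • D x = η x • A x (stdVec j) - η x • B x (stdVec j) := fun x => by
          simp [hD, smul_sub]
        simp only [this]
        rw [integral_sub (i A hA.memLp_diff) (i B hB.memLp_diff), h1, sub_self])
    exact (hemb.ae_map_iff.1 h0).mono fun x hx => by rwa [hext] at hx
  filter_upwards [key 0, key 1, key 2] with x h0 h1 h2
  ext1 w
  rw [← sub_eq_zero, ← sub_apply, E3_eq_sum w, map_sum, Fin.sum_univ_three]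
  simp only [map_smul, h0, h1, h2, smul_zero, add_zero]

theorem weakDiff_spec {u : S2 → E3} (h : MemW12 u) : HasWeakDifferential u (weakDiff u) := by
  rw [weakDiff, dif_pos h]
  exact h.choose_spec

/-- The `j`-th tangential derivative in cylindrical coordinates. -/
def cylDeriv (v : ℝ × ℝ → E3) (j : Fin 3) (p : ℝ × ℝ) : E3 :=
  Real.cosh p.1 ^ 2 • (∂ₛ cyl p j • ∂ₛ v p + ∂ₐ cyl p j • ∂ₐ v p)

theorem inner_stdVec (x : E3) (j : Fin 3) : ⟪x, stdVec j⟫ = x j := by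
  simp [stdVec, EuclideanSpace.inner_single_right]

theorem memW12_of_cyl {v : ℝ × ℝ → E3} (hv : CylW12 v) {u : S2 → E3}
    (hu : ∀ᵐ x ∂area, u x = v (coord x)) : MemW12 u :=
  ⟨_, hasWeakDifferential_cylDiff hv hu⟩

/-- The choice in `weakDiff` is immaterial: by uniqueness it agrees with the pointwise differential.
-/
theorem tangDeriv_ae_eq {v : ℝ × ℝ → E3} (hv : CylW12 v) {u : S2 → E3}
    (hu : ∀ᵐ x ∂area, u x = v (coord x)) :
    ∀ᵐ x ∂area, ∀ j, tangDeriv u j x = cylDeriv v j (coord x) := by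
  have h := hasWeakDifferential_cylDiff hv hu
  filter_upwards [(weakDiff_spec ⟨_, h⟩).ae_eq h, cylDiff_ae_eq v] with x h1 h2 j
  rw [tangDeriv, h1, h2, cylForm_apply, inner_stdVec, inner_stdVec, cylDeriv]

/-! ### Second derivatives and the energy in cylindrical coordinates -/

section SobSize

variable {F : Type*} [NormedAddCommGroup F] [NormedSpace ℝ F]

/-- A pointwise quantity that controls, in the area-normalized `L²(strip)` scale, the components of
the differential, of the covariant Hessian (in the conformal frame) and the squared differential. -/
def sobSize (v : ℝ × ℝ → F) (p : ℝ × ℝ) : ℝ :=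
  Real.cosh p.1 * (‖∂ₛ (∂ₛ v) p + Real.tanh p.1 • ∂ₛ v p‖ + ‖∂ₛ (∂ₐ v) p + Real.tanh p.1 • ∂ₐ v p‖
    + ‖∂ₐ (∂ₐ v) p - Real.tanh p.1 • ∂ₛ v p‖ + ‖∂ₛ v p‖ ^ 2 + ‖∂ₐ v p‖ ^ 2)
    + ‖∂ₛ v p‖ + ‖∂ₐ v p‖

/-- The coordinate expressions of the bounded `W^{2,2}` maps of the sphere with gradient in `L⁴`
that are `C²` off the poles. -/
structure CylW22 (v : ℝ × ℝ → F) : Prop where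
  contDiff : ContDiff ℝ 2 v
  periodic : AnglePeriodic v
  bounded : ∃ C, ∀ p, ‖v p‖ ≤ C
  memLp : MemLp (sobSize v) 2 strip

theorem continuous_pd₁ {v : ℝ × ℝ → F} (hv : ContDiff ℝ 2 v) (e : ℝ × ℝ) : Continuous (pd e v) :=
  continuous_pd (hv.of_le (by norm_num)) e

theorem contDiff_pd₁ {v : ℝ × ℝ → F} (hv : ContDiff ℝ 2 v) (e : ℝ × ℝ) : ContDiff ℝ 1 (pd e v) :=
  contDiff_pd hv (by norm_num) e

theorem continuous_pd₂ {v : ℝ × ℝ → F} (hv : ContDiff ℝ 2 v) (e e' : ℝ × ℝ) :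
    Continuous (pd e (pd e' v)) :=
  continuous_pd (contDiff_pd₁ hv e') e

theorem continuous_tanh_fst : Continuous fun p : ℝ × ℝ => Real.tanh p.1 :=
  (contDiff_tanh (n := 0)).continuous.comp continuous_fst

theorem continuous_sobSize {v : ℝ × ℝ → F} (hv : ContDiff ℝ 2 v) : Continuous (sobSize v) := by
  have h1 := continuous_pd₁ hv (1, 0)
  have h2 := continuous_pd₁ hv (0, 1)
  have h3 := continuous_pd₂ hv (1, 0) (1, 0)
  have h4 := continuous_pd₂ hv (1, 0) (0, 1)
  have h5 := continuous_pd₂ hv (0, 1) (0, 1)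
  have h6 := continuous_cosh_fst
  have h7 := continuous_tanh_fst
  unfold sobSize
  fun_prop

theorem sobSize_nonneg (v : ℝ × ℝ → F) (p : ℝ × ℝ) : 0 ≤ sobSize v p := by
  have := Real.cosh_pos p.1
  unfold sobSize
  positivity

theorem sobSize_bounds (v : ℝ × ℝ → F) (p : ℝ × ℝ) :
    ‖∂ₛ v p‖ ≤ sobSize v p ∧ ‖∂ₐ v p‖ ≤ sobSize v p ∧
    Real.cosh p.1 * ‖∂ₛ (∂ₛ v) p + Real.tanh p.1 • ∂ₛ v p‖ ≤ sobSize v p ∧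
    Real.cosh p.1 * ‖∂ₛ (∂ₐ v) p + Real.tanh p.1 • ∂ₐ v p‖ ≤ sobSize v p ∧
    Real.cosh p.1 * ‖∂ₐ (∂ₐ v) p - Real.tanh p.1 • ∂ₛ v p‖ ≤ sobSize v p ∧
    Real.cosh p.1 * ‖∂ₛ v p‖ ^ 2 ≤ sobSize v p ∧ Real.cosh p.1 * ‖∂ₐ v p‖ ^ 2 ≤ sobSize v p := by
  have h0 := Real.cosh_pos p.1
  unfold sobSize
  set a := ‖∂ₛ (∂ₛ v) p + Real.tanh p.1 • ∂ₛ v p‖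
  set b := ‖∂ₛ (∂ₐ v) p + Real.tanh p.1 • ∂ₐ v p‖
  set c := ‖∂ₐ (∂ₐ v) p - Real.tanh p.1 • ∂ₛ v p‖
  have ha : 0 ≤ Real.cosh p.1 * a := by positivity
  have hb : 0 ≤ Real.cosh p.1 * b := by positivity
  have hc : 0 ≤ Real.cosh p.1 * c := by positivity
  have hd : 0 ≤ Real.cosh p.1 * ‖∂ₛ v p‖ ^ 2 := by positivity
  have he : 0 ≤ Real.cosh p.1 * ‖∂ₐ v p‖ ^ 2 := by positivity
  have hf := norm_nonneg (∂ₛ v p)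
  have hg := norm_nonneg (∂ₐ v p)
  refine ⟨?_, ?_, ?_, ?_, ?_, ?_, ?_⟩ <;> nlinarith

theorem cosh_laplacian_le (v : ℝ × ℝ → F) (p : ℝ × ℝ) :
    Real.cosh p.1 * ‖∂ₛ (∂ₛ v) p + ∂ₐ (∂ₐ v) p‖ ≤ 2 * sobSize v p := by
  obtain ⟨-, -, h1, -, h2, -, -⟩ := sobSize_bounds v p
  have h : ∂ₛ (∂ₛ v) p + ∂ₐ (∂ₐ v) p = (∂ₛ (∂ₛ v) p + Real.tanh p.1 • ∂ₛ v p)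
      + (∂ₐ (∂ₐ v) p - Real.tanh p.1 • ∂ₛ v p) := by abel
  rw [h]
  have := mul_le_mul_of_nonneg_left (norm_add_le (∂ₛ (∂ₛ v) p + Real.tanh p.1 • ∂ₛ v p)
    (∂ₐ (∂ₐ v) p - Real.tanh p.1 • ∂ₛ v p)) (Real.cosh_pos p.1).le
  linarith

/-- A continuous function dominated by `sobSize v` is square integrable. -/
theorem CylW22.memLp_of_le {v : ℝ × ℝ → F} (hv : CylW22 v) {G : Type*} [NormedAddCommGroup G]
    {g : ℝ × ℝ → G} (hg : Continuous g) {C : ℝ} (h : ∀ p, ‖g p‖ ≤ C * sobSize v p) :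
    MemLp g 2 strip :=
  (hv.memLp.const_mul C).mono' hg.aestronglyMeasurable (Filter.Eventually.of_forall h)

end SobSize

theorem CylW22.cylW12 {v : ℝ × ℝ → E3} (hv : CylW22 v) : CylW12 v where
  contDiff := hv.contDiff.of_le (by norm_num)
  periodic := hv.periodic
  memLp := by
    obtain ⟨C, hC⟩ := hv.bounded
    refine (memLp_inv_cosh.const_mul C).mono'
      (continuous_inv_cosh_fst.smul hv.contDiff.continuous).aestronglyMeasurable
      (Filter.Eventually.of_forall fun p => ?_)
    have h0 := inv_nonneg.2 (Real.cosh_pos p.1).le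
    rw [norm_smul, Real.norm_of_nonneg h0, mul_comm]
    exact mul_le_mul_of_nonneg_right (hC p) h0
  memLp_ds := hv.memLp_of_le (C := 1) (continuous_pd₁ hv.contDiff _) fun p => by
    rw [one_mul]; exact (sobSize_bounds v p).1
  memLp_da := hv.memLp_of_le (C := 1) (continuous_pd₁ hv.contDiff _) fun p => by
    rw [one_mul]; exact (sobSize_bounds v p).2.1

theorem pd_coord {v : ℝ × ℝ → E3} (hv : Differentiable ℝ v) (e p : ℝ × ℝ) (j : Fin 3) :
    pd e (fun p => v p j) p = pd e v p j :=
  (pd_comp (g := (EuclideanSpace.proj j : E3 →L[ℝ] ℝ)) (by fun_prop) hv e).trans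
    (by rw [ContinuousLinearMap.fderiv]; rfl)

theorem contDiff_coord {v : ℝ × ℝ → E3} {n : WithTop ℕ∞} (hv : ContDiff ℝ n v) (j : Fin 3) :
    ContDiff ℝ n fun p => v p j :=
  (EuclideanSpace.proj j : E3 →L[ℝ] ℝ).contDiff.comp hv

theorem contDiff_cosh_sq {n : WithTop ℕ∞} : ContDiff ℝ n fun p : ℝ × ℝ => Real.cosh p.1 ^ 2 :=
  (Real.contDiff_cosh.comp contDiff_fst).pow 2

theorem ds_cosh_sq (p : ℝ × ℝ) :
    ∂ₛ (fun p : ℝ × ℝ => Real.cosh p.1 ^ 2) p = 2 * Real.tanh p.1 * Real.cosh p.1 ^ 2 := by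
  have h0 := (Real.cosh_pos p.1).ne'
  refine ds_eq ((contDiff_cosh_sq (n := 1)).differentiable one_ne_zero)
    (((Real.hasDerivAt_cosh p.1).fun_pow 2).congr_deriv ?_)
  rw [Real.tanh_eq_sinh_div_cosh]
  field_simp
  simp
  ring

theorem da_cosh_sq (p : ℝ × ℝ) : ∂ₐ (fun p : ℝ × ℝ => Real.cosh p.1 ^ 2) p = 0 :=
  da_eq ((contDiff_cosh_sq (n := 1)).differentiable one_ne_zero) (hasDerivAt_const p.2 (Real.cosh p.1 ^ 2))

theorem cosh_sq_mul_inv (p : ℝ × ℝ) : Real.cosh p.1 ^ 2 * (Real.cosh p.1)⁻¹ ^ 2 = 1 := by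
  rw [← mul_pow, mul_inv_cancel₀ (Real.cosh_pos _).ne', one_pow]

theorem contDiff_cylDeriv {v : ℝ × ℝ → E3} (hv : ContDiff ℝ 2 v) (j : Fin 3) :
    ContDiff ℝ 1 (cylDeriv v j) := by
  unfold cylDeriv
  exact contDiff_cosh_sq.smul (((contDiff_coord (contDiff_pd_cyl _) j).smul (contDiff_pd₁ hv _)).add
    ((contDiff_coord (contDiff_pd_cyl _) j).smul (contDiff_pd₁ hv _)))

theorem pd_cylDeriv {v : ℝ × ℝ → E3} (hv : ContDiff ℝ 2 v) (j : Fin 3) (e p : ℝ × ℝ) :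
    pd e (cylDeriv v j) p = Real.cosh p.1 ^ 2 • ((∂ₛ cyl p j • pd e (∂ₛ v) p
        + pd e (∂ₛ cyl) p j • ∂ₛ v p) + (∂ₐ cyl p j • pd e (∂ₐ v) p + pd e (∂ₐ cyl) p j • ∂ₐ v p))
      + pd e (fun p : ℝ × ℝ => Real.cosh p.1 ^ 2) p • (∂ₛ cyl p j • ∂ₛ v p + ∂ₐ cyl p j • ∂ₐ v p) := by
  have d1 : ∀ e, Differentiable ℝ (pd e v) := fun e => (contDiff_pd₁ hv e).differentiable one_ne_zero
  have d2 : ∀ e, Differentiable ℝ fun p => pd e cyl p j := fun e =>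
    (contDiff_coord (n := 1) (contDiff_pd_cyl e) j).differentiable one_ne_zero
  have d3 : ∀ e, Differentiable ℝ fun p => pd e cyl p j • pd e v p := fun e => (d2 e).smul (d1 e)
  have d4 : Differentiable ℝ fun p => ∂ₛ cyl p j • ∂ₛ v p + ∂ₐ cyl p j • ∂ₐ v p :=
    (d3 _).add (d3 _)
  unfold cylDeriv
  rw [pd_smul ((contDiff_cosh_sq (n := 1)).differentiable one_ne_zero) d4,
    pd_add (d3 _) (d3 _), pd_smul (d2 _) (d1 _),
    pd_smul (d2 _) (d1 _), pd_coord (differentiable_pd_cyl _), pd_coord (differentiable_pd_cyl _)]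

theorem ds_cylDeriv {v : ℝ × ℝ → E3} (hv : ContDiff ℝ 2 v) (j : Fin 3) (p : ℝ × ℝ) :
    ∂ₛ (cylDeriv v j) p = Real.cosh p.1 ^ 2 • (∂ₛ cyl p j • (∂ₛ (∂ₛ v) p + Real.tanh p.1 • ∂ₛ v p)
      + ∂ₐ cyl p j • (∂ₛ (∂ₐ v) p + Real.tanh p.1 • ∂ₐ v p)) - cyl p j • ∂ₛ v p := by
  rw [pd_cylDeriv hv, ds_ds_cyl, ds_da_cyl, ds_cosh_sq]
  have h := cosh_sq_mul_inv p
  simp only [PiLp.sub_apply, PiLp.neg_apply, PiLp.smul_apply, smul_eq_mul]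
  linear_combination (norm := module) (-cyl p j) • congrArg (fun t : ℝ => t • ∂ₛ v p) h

theorem da_cylDeriv {v : ℝ × ℝ → E3} (hv : ContDiff ℝ 2 v) (j : Fin 3) (p : ℝ × ℝ) :
    ∂ₐ (cylDeriv v j) p = Real.cosh p.1 ^ 2 • (∂ₛ cyl p j • (∂ₛ (∂ₐ v) p + Real.tanh p.1 • ∂ₐ v p)
      + ∂ₐ cyl p j • (∂ₐ (∂ₐ v) p - Real.tanh p.1 • ∂ₛ v p)) - cyl p j • ∂ₐ v p := by
  rw [pd_cylDeriv hv, da_ds_cyl, da_da_cyl, da_cosh_sq, pd_comm hv (0, 1) (1, 0)]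
  have h := cosh_sq_mul_inv p
  simp only [PiLp.sub_apply, PiLp.neg_apply, PiLp.smul_apply, smul_eq_mul]
  linear_combination (norm := module) (-cyl p j) • congrArg (fun t : ℝ => t • ∂ₐ v p) h

theorem abs_coord_le (x : E3) (j : Fin 3) : |x j| ≤ ‖x‖ := PiLp.norm_apply_le x j

theorem norm_frame_combination_le (p : ℝ × ℝ) (j : Fin 3) (x y z : E3) :
    ‖Real.cosh p.1 ^ 2 • (∂ₛ cyl p j • x + ∂ₐ cyl p j • y) - cyl p j • z‖
      ≤ Real.cosh p.1 * ‖x‖ + Real.cosh p.1 * ‖y‖ + ‖z‖ := by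
  have h0 := Real.cosh_pos p.1
  have h1 : |∂ₛ cyl p j| ≤ (Real.cosh p.1)⁻¹ := norm_ds_cyl p ▸ abs_coord_le _ j
  have h2 : |∂ₐ cyl p j| ≤ (Real.cosh p.1)⁻¹ := norm_da_cyl p ▸ abs_coord_le _ j
  have h3 : |cyl p j| ≤ 1 := norm_cyl p ▸ abs_coord_le _ j
  refine (norm_sub_le _ _).trans (add_le_add ?_ ?_)
  · rw [norm_smul, Real.norm_of_nonneg (by positivity)]
    calc _ ≤ Real.cosh p.1 ^ 2 * (|∂ₛ cyl p j| * ‖x‖ + |∂ₐ cyl p j| * ‖y‖) := by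
          gcongr
          refine (norm_add_le _ _).trans_eq ?_
          rw [norm_smul, norm_smul, Real.norm_eq_abs, Real.norm_eq_abs]
      _ ≤ Real.cosh p.1 ^ 2 * ((Real.cosh p.1)⁻¹ * ‖x‖ + (Real.cosh p.1)⁻¹ * ‖y‖) := by gcongr
      _ = _ := by field_simp
  · rw [norm_smul, Real.norm_eq_abs]
    exact mul_le_of_le_one_left (norm_nonneg _) h3

/-- The tangential derivatives of a `W^{2,2}` map are `W^{1,2}` maps, so that the first order theory
can be applied to them again. -/
theorem CylW22.cylDeriv {v : ℝ × ℝ → E3} (hv : CylW22 v) (j : Fin 3) :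
    CylW12 (cylDeriv v j) where
  contDiff := contDiff_cylDeriv hv.contDiff j
  periodic s a := by
    simp only [EpsHarmonic.cylDeriv, hv.periodic.pd _ s a, anglePeriodic_cyl.pd _ s a]
  memLp := by
    refine hv.memLp_of_le (C := 2)
      (continuous_inv_cosh_fst.smul (contDiff_cylDeriv hv.contDiff j).continuous) fun p => ?_
    have h0 := Real.cosh_pos p.1
    have h := norm_frame_combination_le p j (∂ₛ v p) (∂ₐ v p) 0
    obtain ⟨h1, h2, -⟩ := sobSize_bounds v p
    rw [smul_zero, sub_zero, norm_zero, add_zero, ← mul_add] at h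
    rw [norm_smul, Real.norm_of_nonneg (inv_nonneg.2 h0.le), inv_mul_le_iff₀ h0]
    refine h.trans ?_
    gcongr
    linarith
  memLp_ds := by
    refine hv.memLp_of_le (C := 3) (continuous_pd (contDiff_cylDeriv hv.contDiff j) _) fun p => ?_
    rw [ds_cylDeriv hv.contDiff]
    obtain ⟨h1, h2, h3, h4, h5, -⟩ := sobSize_bounds v p
    exact (norm_frame_combination_le p j _ _ _).trans (by linarith)
  memLp_da := by
    refine hv.memLp_of_le (C := 3) (continuous_pd (contDiff_cylDeriv hv.contDiff j) _) fun p => ?_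
    rw [da_cylDeriv hv.contDiff]
    obtain ⟨h1, h2, h3, h4, h5, -⟩ := sobSize_bounds v p
    exact (norm_frame_combination_le p j _ _ _).trans (by linarith)

theorem memW22_of_cyl {v : ℝ × ℝ → E3} (hv : CylW22 v) {u : S2 → E3}
    (hu : ∀ᵐ x ∂area, u x = v (coord x)) : MemW22 u :=
  ⟨memW12_of_cyl hv.cylW12 hu, fun j => memW12_of_cyl (hv.cylDeriv j)
    ((tangDeriv_ae_eq hv.cylW12 hu).mono fun _ hx => hx j)⟩

theorem sum_ds_ds (p : ℝ × ℝ) : ∑ j, ∂ₛ cyl p j * ∂ₛ cyl p j = (Real.cosh p.1)⁻¹ ^ 2 := by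
  rw [← norm_sq_ds_cyl, norm_sq_eq, Fin.sum_univ_three]; ring

theorem sum_da_da (p : ℝ × ℝ) : ∑ j, ∂ₐ cyl p j * ∂ₐ cyl p j = (Real.cosh p.1)⁻¹ ^ 2 := by
  rw [← norm_sq_da_cyl, norm_sq_eq, Fin.sum_univ_three]; ring

theorem sum_ds_da (p : ℝ × ℝ) : ∑ j, ∂ₛ cyl p j * ∂ₐ cyl p j = 0 := by
  rw [Fin.sum_univ_three, ← inner_eq, inner_ds_da_cyl]

theorem sum_ds_cyl (p : ℝ × ℝ) : ∑ j, ∂ₛ cyl p j * cyl p j = 0 := by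
  rw [Fin.sum_univ_three, ← inner_eq, inner_cyl_ds]

theorem sum_da_cyl (p : ℝ × ℝ) : ∑ j, ∂ₐ cyl p j * cyl p j = 0 := by
  rw [Fin.sum_univ_three, ← inner_eq, inner_cyl_da]

/-- The squared gradient in conformal coordinates. -/
theorem sum_norm_sq_cylDeriv (v : ℝ × ℝ → E3) (p : ℝ × ℝ) :
    ∑ j, ‖cylDeriv v j p‖ ^ 2 = Real.cosh p.1 ^ 2 * (‖∂ₛ v p‖ ^ 2 + ‖∂ₐ v p‖ ^ 2) := by
  have e1 := sum_ds_ds p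
  have e2 := sum_da_da p
  have e3 := sum_ds_da p
  have h := cosh_sq_mul_inv p
  have e : ∀ j, ‖cylDeriv v j p‖ ^ 2 = Real.cosh p.1 ^ 4 * ((∂ₛ cyl p j * ∂ₛ cyl p j) * ‖∂ₛ v p‖ ^ 2
      + 2 * (∂ₛ cyl p j * ∂ₐ cyl p j) * ⟪∂ₛ v p, ∂ₐ v p⟫
      + (∂ₐ cyl p j * ∂ₐ cyl p j) * ‖∂ₐ v p‖ ^ 2) := fun j => by
    rw [cylDeriv, norm_smul, mul_pow, norm_add_sq_real, norm_smul, norm_smul, real_inner_smul_left,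
      real_inner_smul_right, mul_pow, mul_pow, Real.norm_eq_abs, Real.norm_eq_abs, Real.norm_eq_abs,
      sq_abs, sq_abs, sq_abs]
    ring
  simp only [e, ← Finset.mul_sum, Finset.sum_add_distrib, ← Finset.sum_mul, e1, e2, e3]
  linear_combination (Real.cosh p.1 ^ 2 * (‖∂ₛ v p‖ ^ 2 + ‖∂ₐ v p‖ ^ 2)) * h

/-- The Laplacian in conformal coordinates. -/
theorem sum_cylDeriv_cylDeriv {v : ℝ × ℝ → E3} (hv : ContDiff ℝ 2 v) (p : ℝ × ℝ) :
    ∑ j, cylDeriv (cylDeriv v j) j p = Real.cosh p.1 ^ 2 • (∂ₛ (∂ₛ v) p + ∂ₐ (∂ₐ v) p) := by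
  have e1 := sum_ds_ds p
  have e2 := sum_da_da p
  have e3 := sum_ds_da p
  have e4 := sum_ds_cyl p
  have e5 := sum_da_cyl p
  have h := cosh_sq_mul_inv p
  have e : ∀ j, cylDeriv (cylDeriv v j) j p
      = (Real.cosh p.1 ^ 4 * (∂ₛ cyl p j * ∂ₛ cyl p j)) • (∂ₛ (∂ₛ v) p + Real.tanh p.1 • ∂ₛ v p)
        + (2 * Real.cosh p.1 ^ 4 * (∂ₛ cyl p j * ∂ₐ cyl p j)) •
          (∂ₛ (∂ₐ v) p + Real.tanh p.1 • ∂ₐ v p)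
        + (Real.cosh p.1 ^ 4 * (∂ₐ cyl p j * ∂ₐ cyl p j)) • (∂ₐ (∂ₐ v) p - Real.tanh p.1 • ∂ₛ v p)
        - (Real.cosh p.1 ^ 2 * (∂ₛ cyl p j * cyl p j)) • ∂ₛ v p
        - (Real.cosh p.1 ^ 2 * (∂ₐ cyl p j * cyl p j)) • ∂ₐ v p := fun j => by
    rw [EpsHarmonic.cylDeriv, ds_cylDeriv hv, da_cylDeriv hv]
    module
  simp only [e, Finset.sum_sub_distrib, Finset.sum_add_distrib, ← Finset.sum_smul,
    ← Finset.mul_sum, e1, e2, e3, e4, e5]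
  have h4 : Real.cosh p.1 ^ 4 * (Real.cosh p.1)⁻¹ ^ 2 = Real.cosh p.1 ^ 2 := by
    linear_combination Real.cosh p.1 ^ 2 * h
  rw [h4]
  module

/-- The energy density of the coordinate expression `v`. -/
def cylEnergyDens (ε : ℝ) (v : ℝ × ℝ → E3) (p : ℝ × ℝ) : ℝ :=
  ‖∂ₛ v p‖ ^ 2 + ‖∂ₐ v p‖ ^ 2 + ε * ‖Real.cosh p.1 • (∂ₛ (∂ₛ v) p + ∂ₐ (∂ₐ v) p)‖ ^ 2

/-- The Dirichlet energy is conformally invariant; the area density `1 / cosh²` turns the bending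
term into the square of `cosh` times the flat Laplacian. -/
theorem energy_eq {v : ℝ × ℝ → E3} (hv : CylW22 v) {u : S2 → E3}
    (hu : ∀ᵐ x ∂area, u x = v (coord x)) (ε : ℝ) :
    energy ε u = (1 / 2) * ∫ p, cylEnergyDens ε v p ∂strip := by
  have h1 := tangDeriv_ae_eq hv.cylW12 hu
  have h2 : ∀ᵐ x ∂area, ∀ j k, tangDeriv (tangDeriv u j) k x = cylDeriv (cylDeriv v j) k (coord x) :=
    ae_all_iff.2 fun j => tangDeriv_ae_eq (hv.cylDeriv j) (h1.mono fun _ hx => hx j)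
  set g : ℝ × ℝ → ℝ := fun p => Real.cosh p.1 ^ 2 * (‖∂ₛ v p‖ ^ 2 + ‖∂ₐ v p‖ ^ 2)
    + ε * ‖Real.cosh p.1 ^ 2 • (∂ₛ (∂ₛ v) p + ∂ₐ (∂ₐ v) p)‖ ^ 2 with hg
  have hgc : Continuous g := by
    have c1 := continuous_pd₁ hv.contDiff (1, 0)
    have c2 := continuous_pd₁ hv.contDiff (0, 1)
    have c3 := continuous_pd₂ hv.contDiff (1, 0) (1, 0)
    have c4 := continuous_pd₂ hv.contDiff (0, 1) (0, 1)
    have c5 := continuous_cosh_fst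
    rw [hg]; fun_prop
  have h3 : ∀ᵐ x ∂area, gradSq u x + ε * ‖laplacian u x‖ ^ 2 = g (coord x) := by
    filter_upwards [h1, h2] with x h1 h2
    simp only [gradSq, laplacian, h1, h2, hg]
    rw [sum_norm_sq_cylDeriv, sum_cylDeriv_cylDeriv hv.contDiff]
  rw [energy, integral_congr_ae h3,
    integral_area (stronglyMeasurable_comp_coord hgc).aestronglyMeasurable]
  congr 1
  refine integral_congr_ae (ae_strip fun p hp => ?_)
  have h := cosh_sq_mul_inv p
  simp only [coord_cylS (Set.Ioo_subset_Ioc_self hp), hg, cylEnergyDens, norm_smul, mul_pow,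
    Real.norm_eq_abs, sq_abs, smul_eq_mul]
  have h' : |Real.cosh p.1 ^ 2| = Real.cosh p.1 ^ 2 := abs_of_nonneg (by positivity)
  linear_combination (‖∂ₛ v p‖ ^ 2 + ‖∂ₐ v p‖ ^ 2
    + ε * Real.cosh p.1 ^ 2 * ‖∂ₛ (∂ₛ v) p + ∂ₐ (∂ₐ v) p‖ ^ 2) * h

theorem cross_smul_add (a b c d : ℝ) (x y : E3) :
    cross (a • x + b • y) (c • x + d • y) = (a * d - b * c) • cross x y := by
  apply E3_ext <;> simp [cross] <;> ring

/-- The minus sign is there since the frame `(∂ₛ cyl, ∂ₐ cyl)` is negatively oriented with respect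
to the outward normal. -/
theorem jacobian_ae_eq {v : ℝ × ℝ → E3} (hv : CylW22 v) {u : S2 → E3}
    (hu : ∀ᵐ x ∂area, u x = v (coord x)) :
    ∀ᵐ x ∂area, jacobian u x
      = -(Real.cosh (coord x).1 ^ 2
        * ⟪v (coord x), cross (∂ₛ v (coord x)) (∂ₐ v (coord x))⟫) := by
  filter_upwards [tangDeriv_ae_eq hv.cylW12 hu, hu, ae_cylS_coord] with x h1 h2 h3
  set p := coord x
  have hx : (x : E3) = cyl p := by rw [← h3]; rfl
  have h := cosh_sq_mul_inv p
  have ht := tanh_sq_add_inv_cosh_sq p.1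
  have hs := Real.sin_sq_add_cos_sq p.2
  simp only [jacobian, h1, h2, hx, cylDeriv, smul_add, smul_smul, cross_smul_add]
  rw [← add_smul, ← add_smul, real_inner_smul_right, ← neg_mul]
  congr 1
  rw [ds_cyl, da_cyl]
  simp only [cyl_zero, cyl_one, cyl_two, corot_zero, corot_one, corot_two, PiLp.smul_apply,
    smul_eq_mul, perpVec_zero, perpVec_one, perpVec_two]
  set c := (Real.cosh p.1)⁻¹
  linear_combination (-(Real.cosh p.1 ^ 4 * c ^ 2) * (c ^ 2 + Real.tanh p.1 ^ 2)) * hs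
    - Real.cosh p.1 ^ 4 * c ^ 2 * ht - Real.cosh p.1 ^ 2 * h

/-! ### Composition with smooth maps -/

section Composition

variable {F G : Type*} [NormedAddCommGroup F] [NormedSpace ℝ F] [NormedAddCommGroup G]
  [NormedSpace ℝ G]

/-- The second order chain rule. -/
theorem pd_pd_comp {g : F → G} {O : Set F} (hO : IsOpen O) (hg : ContDiffOn ℝ 2 g O)
    {v : ℝ × ℝ → F} (hv : ContDiff ℝ 2 v) (hvO : ∀ p, v p ∈ O) (e e' p : ℝ × ℝ) :
    pd e' (pd e fun p => g (v p)) p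
      = fderiv ℝ (fderiv ℝ g) (v p) (pd e' v p) (pd e v p) + fderiv ℝ g (v p) (pd e' (pd e v) p) := by
  have hg' : ∀ p, ContDiffAt ℝ 2 g (v p) := fun p => hg.contDiffAt (hO.mem_nhds (hvO p))
  have dv := hv.differentiable two_ne_zero
  have h1 : pd e (fun p => g (v p)) = fun p => fderiv ℝ g (v p) (pd e v p) := by
    funext p
    exact pd_comp ((hg' p).differentiableAt two_ne_zero) dv e
  have d2 : DifferentiableAt ℝ (fderiv ℝ g) (v p) :=
    ((hg' p).fderiv_right (m := 1) (by norm_num)).differentiableAt one_ne_zero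
  have h2 : HasFDerivAt (fun p => fderiv ℝ g (v p))
      ((fderiv ℝ (fderiv ℝ g) (v p)).comp (fderiv ℝ v p)) p :=
    d2.hasFDerivAt.comp p (dv p).hasFDerivAt
  have h3 := h2.clm_apply ((contDiff_pd₁ hv e).differentiable one_ne_zero p).hasFDerivAt
  rw [h1, pd, h3.fderiv]
  simp [pd, add_comm]

/-- The quantity `sobSize` is stable under composition with smooth maps: the quadratic terms that
the second order chain rule produces are part of it. -/
theorem sobSize_comp_le {g : F → G} {O : Set F} (hO : IsOpen O) (hg : ContDiffOn ℝ 2 g O)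
    {v : ℝ × ℝ → F} (hv : ContDiff ℝ 2 v) (hvO : ∀ p, v p ∈ O) {C : ℝ} {p : ℝ × ℝ}
    (h1 : ‖fderiv ℝ g (v p)‖ ≤ C) (h2 : ‖fderiv ℝ (fderiv ℝ g) (v p)‖ ≤ C) :
    sobSize (fun p => g (v p)) p ≤ (2 * C + C ^ 2) * sobSize v p := by
  have hC : 0 ≤ C := (norm_nonneg _).trans h1
  have dg : DifferentiableAt ℝ g (v p) :=
    (hg.contDiffAt (hO.mem_nhds (hvO p))).differentiableAt two_ne_zero
  have dv := hv.differentiable two_ne_zero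
  have b1 : ∀ x, ‖fderiv ℝ g (v p) x‖ ≤ C * ‖x‖ := fun x =>
    ContinuousLinearMap.le_of_opNorm_le _ h1 x
  have b2 : ∀ x y, ‖fderiv ℝ (fderiv ℝ g) (v p) x y‖ ≤ C * ‖x‖ * ‖y‖ := fun x y =>
    (ContinuousLinearMap.le_opNorm₂ _ x y).trans (by gcongr)
  have h0 := Real.cosh_pos p.1
  unfold sobSize
  simp only [pd_pd_comp hO hg hv hvO, pd_comp dg dv]
  set D := fderiv ℝ g (v p)
  set D2 := fderiv ℝ (fderiv ℝ g) (v p)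
  set t := Real.tanh p.1
  set x := ∂ₛ v p
  set y := ∂ₐ v p
  have c1 : ‖D2 x x + D (∂ₛ (∂ₛ v) p) + t • D x‖ ≤ C * ‖x‖ * ‖x‖ + C * ‖∂ₛ (∂ₛ v) p + t • x‖ := by
    rw [add_assoc, ← map_smul, ← map_add]
    exact (norm_add_le _ _).trans (add_le_add (b2 _ _) (b1 _))
  have c2 : ‖D2 x y + D (∂ₛ (∂ₐ v) p) + t • D y‖ ≤ C * ‖x‖ * ‖y‖ + C * ‖∂ₛ (∂ₐ v) p + t • y‖ := by
    rw [add_assoc, ← map_smul, ← map_add]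
    exact (norm_add_le _ _).trans (add_le_add (b2 _ _) (b1 _))
  have c3 : ‖D2 y y + D (∂ₐ (∂ₐ v) p) - t • D x‖ ≤ C * ‖y‖ * ‖y‖ + C * ‖∂ₐ (∂ₐ v) p - t • x‖ := by
    rw [add_sub_assoc, ← map_smul, ← map_sub]
    exact (norm_add_le _ _).trans (add_le_add (b2 _ _) (b1 _))
  have c4 := b1 x
  have c5 := b1 y
  have c6 : ‖D x‖ ^ 2 ≤ C ^ 2 * ‖x‖ ^ 2 := by rw [← mul_pow]; gcongr
  have c7 : ‖D y‖ ^ 2 ≤ C ^ 2 * ‖y‖ ^ 2 := by rw [← mul_pow]; gcongr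
  set α := ‖∂ₛ (∂ₛ v) p + t • x‖
  set β := ‖∂ₛ (∂ₐ v) p + t • y‖
  set γ := ‖∂ₐ (∂ₐ v) p - t • x‖
  have nx := norm_nonneg x
  have ny := norm_nonneg y
  have c8 : C * ‖x‖ * ‖y‖ ≤ C * (‖x‖ ^ 2 + ‖y‖ ^ 2) := by
    rw [mul_assoc]
    exact mul_le_mul_of_nonneg_left (by nlinarith [sq_nonneg (‖x‖ - ‖y‖)]) hC
  have nα : 0 ≤ α := norm_nonneg _
  have nβ : 0 ≤ β := norm_nonneg _
  have nγ : 0 ≤ γ := norm_nonneg _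
  calc _ ≤ Real.cosh p.1 * ((C * ‖x‖ * ‖x‖ + C * α) + (C * (‖x‖ ^ 2 + ‖y‖ ^ 2) + C * β)
          + (C * ‖y‖ * ‖y‖ + C * γ) + C ^ 2 * ‖x‖ ^ 2 + C ^ 2 * ‖y‖ ^ 2) + C * ‖x‖ + C * ‖y‖ := by
        gcongr
        exact c2.trans (by linarith)
    _ = (2 * C + C ^ 2) * (Real.cosh p.1 * (α + β + γ + ‖x‖ ^ 2 + ‖y‖ ^ 2) + ‖x‖ + ‖y‖)
        - (C + C ^ 2) * (Real.cosh p.1 * (α + β + γ) + ‖x‖ + ‖y‖) := by ring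
    _ ≤ _ := by
        have : 0 ≤ (C + C ^ 2) * (Real.cosh p.1 * (α + β + γ) + ‖x‖ + ‖y‖) := by positivity
        linarith

/-- Composition with a `C²` map is bounded for `sobSize`, uniformly among the functions with values
in a fixed compact set. -/
theorem exists_sobSize_comp_le {g : F → G} {O K : Set F} (hO : IsOpen O) (hg : ContDiffOn ℝ 2 g O)
    (hK : IsCompact K) (hKO : K ⊆ O) :
    ∃ C, 0 ≤ C ∧ ∀ v : ℝ × ℝ → F, ContDiff ℝ 2 v → (∀ p, v p ∈ K) →
      ContDiff ℝ 2 (fun p => g (v p)) ∧ (∀ p, ‖g (v p)‖ ≤ C) ∧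
      ∀ p, sobSize (fun p => g (v p)) p ≤ C * sobSize v p := by
  have g1 : ContDiffOn ℝ 1 (fderiv ℝ g) O := hg.fderiv_of_isOpen hO (by norm_num)
  have g2 : ContinuousOn (fderiv ℝ (fderiv ℝ g)) O :=
    (g1.fderiv_of_isOpen (m := 0) hO (by norm_num)).continuousOn
  obtain ⟨C0, h0⟩ := hK.exists_bound_of_continuousOn (hg.continuousOn.mono hKO)
  obtain ⟨C1, h1⟩ := hK.exists_bound_of_continuousOn (g1.continuousOn.mono hKO)
  obtain ⟨C2, h2⟩ : ∃ C, ∀ x ∈ K, ‖fderiv ℝ (fderiv ℝ g) x‖ ≤ C :=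
    hK.exists_bound_of_continuousOn (f := fderiv ℝ (fderiv ℝ g)) (g2.mono hKO :)
  set D := max (max C1 C2) 0 with hD
  have hD0 : 0 ≤ D := le_max_right _ _
  have hD1 : C1 ≤ D := (le_max_left _ _).trans (le_max_left _ _)
  have hD2 : C2 ≤ D := (le_max_right _ _).trans (le_max_left _ _)
  refine ⟨max (2 * D + D ^ 2) C0, (by positivity : 0 ≤ 2 * D + D ^ 2).trans (le_max_left _ _),
    fun v hv hvK => ⟨?_, fun p => (h0 _ (hvK p)).trans (le_max_right _ _), fun p => ?_⟩⟩
  · exact contDiff_iff_contDiffAt.2 fun p =>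
      (hg.contDiffAt (hO.mem_nhds (hKO (hvK p)))).comp p hv.contDiffAt
  · refine (sobSize_comp_le hO hg hv (fun p => hKO (hvK p)) ((h1 _ (hvK p)).trans hD1)
      ((h2 _ (hvK p)).trans hD2)).trans ?_
    exact mul_le_mul_of_nonneg_right (le_max_left _ _) (sobSize_nonneg v p)

theorem pd_prodMk {v : ℝ × ℝ → F} {w : ℝ × ℝ → G} (hv : Differentiable ℝ v)
    (hw : Differentiable ℝ w) (e : ℝ × ℝ) :
    pd e (fun p => (v p, w p)) = fun p => (pd e v p, pd e w p) := by
  funext p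
  unfold pd
  rw [(hv p).fderiv_prodMk (hw p)]
  rfl

theorem sobSize_prodMk_le {v : ℝ × ℝ → F} {w : ℝ × ℝ → G} (hv : ContDiff ℝ 2 v)
    (hw : ContDiff ℝ 2 w) (p : ℝ × ℝ) :
    sobSize (fun p => (v p, w p)) p ≤ sobSize v p + sobSize w p := by
  have dv := hv.differentiable two_ne_zero
  have dw := hw.differentiable two_ne_zero
  have dv1 := fun e => (contDiff_pd₁ hv e).differentiable one_ne_zero
  have dw1 := fun e => (contDiff_pd₁ hw e).differentiable one_ne_zero
  have hm : ∀ (x : F) (y : G), ‖(x, y)‖ ≤ ‖x‖ + ‖y‖ := fun x y =>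
    max_le (by simp) (by simp)
  have hm2 : ∀ (x : F) (y : G), ‖(x, y)‖ ^ 2 ≤ ‖x‖ ^ 2 + ‖y‖ ^ 2 := fun x y => by
    rcases max_choice ‖x‖ ‖y‖ with h | h <;> rw [Prod.norm_def, h]
    · exact le_add_of_nonneg_right (sq_nonneg _)
    · exact le_add_of_nonneg_left (sq_nonneg _)
  have h0 := Real.cosh_pos p.1
  unfold sobSize
  simp only [pd_prodMk dv dw, pd_prodMk (dv1 _) (dw1 _), Prod.smul_mk, Prod.mk_add_mk,
    Prod.mk_sub_mk]
  refine (add_le_add (add_le_add (mul_le_mul_of_nonneg_left (add_le_add (add_le_add (add_le_add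
    (add_le_add (hm _ _) (hm _ _)) (hm _ _)) (hm2 _ _)) (hm2 _ _)) h0.le) (hm _ _))
    (hm _ _)).trans_eq ?_
  ring

theorem sobSize_const (c : F) (p : ℝ × ℝ) : sobSize (fun _ => c) p = 0 := by
  have h : ∀ (c : F) e, pd e (fun _ => c) = fun _ => 0 := fun c e => by
    funext p; simp [pd]
  simp [sobSize, h]

end Composition

theorem CylW22.of_le {F G : Type*} [NormedAddCommGroup F] [NormedSpace ℝ F] [NormedAddCommGroup G]
    [NormedSpace ℝ G] {v : ℝ × ℝ → F} {w : ℝ × ℝ → G} (hv : CylW22 v) (hw : ContDiff ℝ 2 w)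
    (hper : AnglePeriodic w) {C : ℝ} (hb : ∀ p, ‖w p‖ ≤ C)
    (h : ∀ p, sobSize w p ≤ C * sobSize v p) : CylW22 w :=
  ⟨hw, hper, ⟨C, hb⟩, hv.memLp_of_le (continuous_sobSize hw) fun p => by
    rw [Real.norm_of_nonneg (sobSize_nonneg w p)]; exact h p⟩

theorem sobSize_cyl_le (p : ℝ × ℝ) : sobSize cyl p ≤ 6 * (Real.cosh p.1)⁻¹ := by
  have h0 := Real.cosh_pos p.1
  have e1 : ∂ₛ (∂ₛ cyl) p + Real.tanh p.1 • ∂ₛ cyl p = -((Real.cosh p.1)⁻¹ ^ 2 • cyl p) := by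
    rw [ds_ds_cyl]; abel
  have e2 : ∂ₛ (∂ₐ cyl) p + Real.tanh p.1 • ∂ₐ cyl p = 0 := by rw [ds_da_cyl]; abel
  have e3 : ∂ₐ (∂ₐ cyl) p - Real.tanh p.1 • ∂ₛ cyl p = -((Real.cosh p.1)⁻¹ ^ 2 • cyl p) := by
    rw [da_da_cyl]; abel
  rw [sobSize, e1, e2, e3, norm_neg, norm_smul, norm_cyl, norm_ds_cyl, norm_da_cyl, norm_zero,
    Real.norm_of_nonneg (by positivity)]
  refine le_of_eq ?_
  field_simp
  norm_num

theorem cylW22_cyl : CylW22 cyl :=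
  ⟨contDiff_cyl, anglePeriodic_cyl, ⟨1, fun p => (norm_cyl p).le⟩,
    (memLp_inv_cosh.const_mul 6).mono' (continuous_sobSize contDiff_cyl).aestronglyMeasurable
      (Filter.Eventually.of_forall fun p => by
        rw [Real.norm_of_nonneg (sobSize_nonneg _ p)]; exact sobSize_cyl_le p)⟩

/-- Restrictions of smooth maps of Euclidean space to the sphere. -/
theorem exists_sobSize_smooth_le {φ : E3 → E3} (hφ : ContDiff ℝ ∞ φ) :
    CylW22 (fun p => φ (cyl p)) ∧
      ∃ C, 0 ≤ C ∧ ∀ p, sobSize (fun p => φ (cyl p)) p ≤ C * (Real.cosh p.1)⁻¹ := by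
  obtain ⟨C, hC0, hC⟩ := exists_sobSize_comp_le isOpen_univ
    (by exact_mod_cast contDiff_infty.1 hφ 2 : ContDiff ℝ 2 φ).contDiffOn (isCompact_sphere (0 : E3) 1)
    (Set.subset_univ _)
  obtain ⟨h1, h2, h3⟩ := hC cyl contDiff_cyl fun p => by simp [norm_cyl]
  refine ⟨cylW22_cyl.of_le h1 (fun s a => by rw [anglePeriodic_cyl s a]) h2 h3, C * 6, by positivity,
    fun p => (h3 p).trans ?_⟩
  rw [mul_assoc]
  exact mul_le_mul_of_nonneg_left (sobSize_cyl_le p) hC0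

/-! ### First variation -/

theorem integrable_inner_of_memLp {α F : Type*} [MeasurableSpace α] {μ : Measure α}
    [NormedAddCommGroup F] [InnerProductSpace ℝ F] {a b : α → F} (ha : MemLp a 2 μ)
    (hb : MemLp b 2 μ) : Integrable (fun x => ⟪a x, b x⟫) μ :=
  (ha.norm.integrable_mul hb.norm).mono' (ha.1.inner hb.1)
    (Filter.Eventually.of_forall fun x => norm_inner_le_norm (𝕜 := ℝ) (a x) (b x))

/-- A family of squared `L²` norms of second order Taylor expansions is differentiable. -/
theorem hasDerivAt_integral_norm_sq {α F : Type*} [MeasurableSpace α] {μ : Measure α}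
    [NormedAddCommGroup F] [InnerProductSpace ℝ F] {a b : α → F} {c : ℝ → α → F} {M : α → ℝ}
    {t₀ : ℝ} (ht₀ : 0 < t₀) (ha : MemLp a 2 μ) (hb : MemLp b 2 μ) (hM : MemLp M 2 μ)
    (hc : ∀ t, |t| < t₀ → AEStronglyMeasurable (c t) μ)
    (hcM : ∀ t, |t| < t₀ → ∀ x, ‖c t x‖ ≤ M x) :
    HasDerivAt (fun t => ∫ x, ‖a x + t • b x + t ^ 2 • c t x‖ ^ 2 ∂μ)
      (2 * ∫ x, ⟪a x, b x⟫ ∂μ) 0 := by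
  have hiab : Integrable (fun x => ⟪a x, b x⟫) μ := integrable_inner_of_memLp ha hb
  have hia := ha.integrable_norm_pow two_ne_zero
  have hib := hb.integrable_norm_pow two_ne_zero
  have hiM := hM.integrable_norm_pow two_ne_zero
  -- the expansion holds up to `S t²`
  set S : ℝ := ∫ x, (3 * ‖b x‖ ^ 2 + ‖a x‖ ^ 2 + 4 * ‖M x‖ ^ 2) ∂μ with hS
  have hSi : Integrable (fun x => 3 * ‖b x‖ ^ 2 + ‖a x‖ ^ 2 + 4 * ‖M x‖ ^ 2) μ :=
    ((hib.const_mul 3).add hia).add (hiM.const_mul 4)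
  have key : ∀ t, |t| < min t₀ 1 → ‖(∫ x, ‖a x + t • b x + t ^ 2 • c t x‖ ^ 2 ∂μ)
      - (∫ x, ‖a x‖ ^ 2 ∂μ) - t * (2 * ∫ x, ⟪a x, b x⟫ ∂μ)‖ ≤ S * t ^ 2 := by
    intro t ht
    have ht1 : |t| ≤ 1 := (ht.trans_le (min_le_right _ _)).le
    have ht2 := ht.trans_le (min_le_left _ _)
    have hct : MemLp (c t) 2 μ := hM.mono' (hc t ht2) (Filter.Eventually.of_forall (hcM t ht2))
    have hi : Integrable (fun x => ‖a x + t • b x + t ^ 2 • c t x‖ ^ 2) μ :=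
      ((ha.add (hb.const_smul t)).add (hct.const_smul (t ^ 2))).integrable_norm_pow two_ne_zero
    have e : (∫ x, ‖a x + t • b x + t ^ 2 • c t x‖ ^ 2 ∂μ) - (∫ x, ‖a x‖ ^ 2 ∂μ)
        - t * (2 * ∫ x, ⟪a x, b x⟫ ∂μ)
        = ∫ x, (‖a x + t • b x + t ^ 2 • c t x‖ ^ 2 - ‖a x‖ ^ 2 - t * 2 * ⟪a x, b x⟫) ∂μ := by
      rw [← mul_assoc, ← integral_const_mul, ← integral_sub hi hia]
      exact (integral_sub (hi.sub hia) (hiab.const_mul (t * 2))).symm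
    rw [e, mul_comm S, hS, ← integral_const_mul]
    refine norm_integral_le_of_norm_le (hSi.const_mul _) (Filter.Eventually.of_forall fun x => ?_)
    have n1 : ‖a x + t • b x + t ^ 2 • c t x‖ ^ 2 - ‖a x‖ ^ 2 - t * 2 * ⟪a x, b x⟫
        = t ^ 2 * (‖b x‖ ^ 2 + 2 * ⟪a x, c t x⟫ + 2 * t * ⟪b x, c t x⟫ + t ^ 2 * ‖c t x‖ ^ 2) := by
      rw [norm_add_sq_real, norm_add_sq_real, norm_smul, norm_smul, inner_add_left,
        real_inner_smul_right, real_inner_smul_right, real_inner_smul_left, real_inner_smul_right,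
        mul_pow, mul_pow, Real.norm_eq_abs, Real.norm_eq_abs, sq_abs, sq_abs]
      ring
    rw [n1, norm_mul, Real.norm_of_nonneg (sq_nonneg t)]
    refine mul_le_mul_of_nonneg_left ?_ (sq_nonneg t)
    have i1 := abs_le.1 (abs_real_inner_le_norm (a x) (c t x))
    have i2 := abs_real_inner_le_norm (b x) (c t x)
    have cM := hcM t ht2 x
    have c0 := norm_nonneg (c t x)
    have cM2 : ‖c t x‖ ^ 2 ≤ ‖M x‖ ^ 2 := by
      gcongr; exact cM.trans (Real.le_norm_self _)
    have i3 : |2 * t * ⟪b x, c t x⟫| ≤ 2 * (‖b x‖ * ‖c t x‖) := by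
      rw [abs_mul, abs_mul, abs_two]
      have := mul_le_mul ht1 i2 (abs_nonneg _) zero_le_one
      nlinarith
    have i4 : t ^ 2 * ‖c t x‖ ^ 2 ≤ ‖c t x‖ ^ 2 := by
      have : t ^ 2 ≤ 1 := by rw [← sq_abs]; nlinarith [abs_nonneg t]
      nlinarith [sq_nonneg ‖c t x‖]
    have i5 : 0 ≤ t ^ 2 * ‖c t x‖ ^ 2 := by positivity
    have i3' := abs_le.1 i3
    rw [Real.norm_eq_abs, abs_le]
    constructor <;> nlinarith [sq_nonneg (‖a x‖ - ‖c t x‖), sq_nonneg (‖b x‖ - ‖c t x‖)]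
  rw [hasDerivAt_iff_isLittleO_nhds_zero]
  have hO : (fun t => (∫ x, ‖a x + (0 + t) • b x + (0 + t) ^ 2 • c (0 + t) x‖ ^ 2 ∂μ)
      - (∫ x, ‖a x + (0 : ℝ) • b x + (0 : ℝ) ^ 2 • c 0 x‖ ^ 2 ∂μ)
      - t • (2 * ∫ x, ⟪a x, b x⟫ ∂μ)) =O[nhds 0] fun t : ℝ => t ^ 2 := by
    refine Asymptotics.IsBigO.of_bound S ?_
    filter_upwards [Metric.ball_mem_nhds (0 : ℝ) (lt_min ht₀ one_pos)] with t ht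
    rw [Metric.mem_ball, Real.dist_0_eq_abs] at ht
    simpa using key t ht
  exact hO.trans_isLittleO (by simpa using Asymptotics.isLittleO_pow_id (𝕜 := ℝ) one_lt_two)

/-- `‖u + t φ‖² - 1` for a unit vector `u`, as a function of `(t, u, φ)`. -/
def normDefect (q : ℝ × E3 × E3) : ℝ :=
  q.1 * (2 * ⟪q.2.1, q.2.2⟫ + q.1 * ‖q.2.2‖ ^ 2)

/-- The projection of `u + t φ` to the sphere for a unit vector `u`. -/
def projMap (q : ℝ × E3 × E3) : E3 := (√(1 + normDefect q))⁻¹ • (q.2.1 + q.1 • q.2.2)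

/-- The part of `φ` orthogonal to the unit vector `u`. -/
def tangPart (q : ℝ × E3 × E3) : E3 := q.2.2 - ⟪q.2.1, q.2.2⟫ • q.2.1

/-- The second order Taylor remainder, divided by `t²`, of the projection of `u + t φ`. It uses
`1 / σ = 1 - z / 2 + z² (σ + 2) / (2 σ (σ + 1)²)` with `σ = √(1 + z)`. -/
def projRem (q : ℝ × E3 × E3) : E3 :=
  (-⟪q.2.1, q.2.2⟫) • q.2.2 + (-(‖q.2.2‖ ^ 2 / 2) + (2 * ⟪q.2.1, q.2.2⟫ + q.1 * ‖q.2.2‖ ^ 2) ^ 2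
    * ((√(1 + normDefect q) + 2) / (2 * √(1 + normDefect q) * (√(1 + normDefect q) + 1) ^ 2))) •
      (q.2.1 + q.1 • q.2.2)

theorem contDiff_normDefect {n : WithTop ℕ∞} : ContDiff ℝ n normDefect := by
  unfold normDefect
  have h1 : ContDiff ℝ n fun q : ℝ × E3 × E3 => ⟪q.2.1, q.2.2⟫ :=
    (contDiff_fst.comp contDiff_snd).inner ℝ (contDiff_snd.comp contDiff_snd)
  have h2 : ContDiff ℝ n fun q : ℝ × E3 × E3 => ‖q.2.2‖ ^ 2 :=
    (contDiff_snd.comp contDiff_snd).norm_sq ℝ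
  fun_prop

/-- The domain on which the projection is smooth. -/
def projDomain : Set (ℝ × E3 × E3) := {q | 0 < 1 + normDefect q}

theorem isOpen_projDomain : IsOpen projDomain :=
  isOpen_lt continuous_const (continuous_const.add (contDiff_normDefect (n := 0)).continuous)

theorem contDiffOn_sqrt {n : WithTop ℕ∞} :
    ContDiffOn ℝ n (fun q => √(1 + normDefect q)) projDomain :=
  (contDiff_const.add contDiff_normDefect).contDiffOn.sqrt fun _ hq => ne_of_gt hq

theorem contDiffOn_projMap {n : WithTop ℕ∞} : ContDiffOn ℝ n projMap projDomain := by
  unfold projMap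
  refine (contDiffOn_sqrt.inv fun q hq => (Real.sqrt_pos.2 hq).ne').smul ?_
  exact ContDiff.contDiffOn (by fun_prop)

theorem contDiff_tangPart {n : WithTop ℕ∞} : ContDiff ℝ n tangPart := by
  unfold tangPart
  exact (contDiff_snd.comp contDiff_snd).sub
    (((contDiff_fst.comp contDiff_snd).inner ℝ (contDiff_snd.comp contDiff_snd)).smul
      (contDiff_fst.comp contDiff_snd))

theorem contDiffOn_projRem {n : WithTop ℕ∞} : ContDiffOn ℝ n projRem projDomain := by
  unfold projRem
  have h1 : ContDiff ℝ n fun q : ℝ × E3 × E3 => ⟪q.2.1, q.2.2⟫ :=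
    (contDiff_fst.comp contDiff_snd).inner ℝ (contDiff_snd.comp contDiff_snd)
  have h2 : ContDiff ℝ n fun q : ℝ × E3 × E3 => ‖q.2.2‖ ^ 2 :=
    (contDiff_snd.comp contDiff_snd).norm_sq ℝ
  have hs := contDiffOn_sqrt (n := n)
  refine ContDiffOn.add (ContDiff.contDiffOn (by fun_prop)) (ContDiffOn.smul
    (ContDiffOn.add (ContDiff.contDiffOn (by fun_prop))
      (ContDiffOn.mul (ContDiff.contDiffOn (by fun_prop)) (ContDiffOn.div
        (hs.add contDiffOn_const) ((contDiffOn_const.mul hs).mul ((hs.add contDiffOn_const).pow 2))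
        fun q hq => ?_))) (ContDiff.contDiffOn (by fun_prop)))
  have := Real.sqrt_pos.2 hq
  positivity

theorem one_add_normDefect {t : ℝ} {u φ : E3} (hu : ‖u‖ = 1) :
    1 + normDefect (t, u, φ) = ‖u + t • φ‖ ^ 2 := by
  rw [norm_add_sq_real, norm_smul, real_inner_smul_right, hu, mul_pow, Real.norm_eq_abs, sq_abs,
    normDefect]
  ring

theorem nearestPoint_eq_projMap {t : ℝ} {u φ : E3} (hu : ‖u‖ = 1) :
    nearestPoint (u + t • φ) = projMap (t, u, φ) := by
  rw [nearestPoint, projMap, one_add_normDefect hu, Real.sqrt_sq (norm_nonneg _)]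

/-- The second order expansion of the projection of `u + t φ`, with an explicit smooth remainder. -/
theorem projMap_eq {t : ℝ} {u φ : E3} (h : (t, u, φ) ∈ projDomain) :
    projMap (t, u, φ) = u + t • tangPart (t, u, φ) + t ^ 2 • projRem (t, u, φ) := by
  have hσ := Real.sqrt_pos.2 h
  have hz : normDefect (t, u, φ) = √(1 + normDefect (t, u, φ)) ^ 2 - 1 := by
    rw [Real.sq_sqrt h.le]; ring
  unfold projMap tangPart projRem
  set σ := √(1 + normDefect (t, u, φ))
  have hn : normDefect (t, u, φ) = t * (2 * ⟪u, φ⟫ + t * ‖φ‖ ^ 2) := rfl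
  have key : σ⁻¹ = 1 - t * ⟪u, φ⟫ + t ^ 2 * (-(‖φ‖ ^ 2 / 2) + (2 * ⟪u, φ⟫ + t * ‖φ‖ ^ 2) ^ 2
      * ((σ + 2) / (2 * σ * (σ + 1) ^ 2))) := by
    have e : t ^ 2 * (-(‖φ‖ ^ 2 / 2) + (2 * ⟪u, φ⟫ + t * ‖φ‖ ^ 2) ^ 2
        * ((σ + 2) / (2 * σ * (σ + 1) ^ 2)))
        = -(t ^ 2 * ‖φ‖ ^ 2 / 2) + (t * (2 * ⟪u, φ⟫ + t * ‖φ‖ ^ 2)) ^ 2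
        * ((σ + 2) / (2 * σ * (σ + 1) ^ 2)) := by ring
    have e' : 1 - t * ⟪u, φ⟫ - t ^ 2 * ‖φ‖ ^ 2 / 2 = 1 - (σ ^ 2 - 1) / 2 := by
      rw [← hz, hn]; ring
    rw [e, ← hn, hz, ← add_assoc, ← sub_eq_add_neg, e']
    field_simp
    ring
  simp only
  rw [key]
  module

/-- The first variation of the energy. -/
theorem hasDerivAt_energy_nearestPoint {U : S2 → E3} {v : ℝ × ℝ → E3} (hv : CylW22 v)
    (hv1 : ∀ p, ‖v p‖ = 1) (hU : ∀ᵐ x ∂area, U x = v (coord x)) {φ : E3 → E3}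
    (hφ : ContDiff ℝ ∞ φ) (ε : ℝ) {ψ : ℝ × ℝ → E3}
    (hψ : ψ = fun p => φ (cyl p) - ⟪v p, φ (cyl p)⟫ • v p) :
    CylW22 ψ ∧ HasDerivAt (fun t : ℝ => energy ε (fun x : S2 => nearestPoint (U x + t • φ x)))
      ((∫ p, ⟪∂ₛ v p, ∂ₛ ψ p⟫ ∂strip) + (∫ p, ⟪∂ₐ v p, ∂ₐ ψ p⟫ ∂strip)
        + ε * ∫ p, ⟪Real.cosh p.1 • (∂ₛ (∂ₛ v) p + ∂ₐ (∂ₐ v) p),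
          Real.cosh p.1 • (∂ₛ (∂ₛ ψ) p + ∂ₐ (∂ₐ ψ) p)⟫ ∂strip) 0 := by
  obtain ⟨hφc, -⟩ := exists_sobSize_smooth_le hφ
  set φc : ℝ × ℝ → E3 := fun p => φ (cyl p) with hφcdef
  obtain ⟨M, hM⟩ := hφc.bounded
  have hM0 : 0 ≤ M := (norm_nonneg _).trans (hM 0)
  -- for `|t| ≤ t₀` the vector `v + t φ` stays away from the origin
  set t₀ : ℝ := 1 / (4 * (M + 1)) with ht₀
  have ht₀pos : 0 < t₀ := by positivity
  -- the compact set in which `(t, v, φ)` takes its values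
  set K : Set (ℝ × E3 × E3) := Metric.closedBall 0 t₀ ×ˢ Metric.closedBall 0 1 ×ˢ
    Metric.closedBall 0 M with hK
  have hKc : IsCompact K := (isCompact_closedBall _ _).prod
    ((isCompact_closedBall _ _).prod (isCompact_closedBall _ _))
  have hKO : K ⊆ projDomain := by
    rintro ⟨t, u, w⟩ ⟨ht, hu, hw⟩
    simp only [mem_closedBall_zero_iff, Real.norm_eq_abs] at ht hu hw
    have h1 : |⟪u, w⟫| ≤ M := (abs_real_inner_le_norm u w).trans (by
      calc ‖u‖ * ‖w‖ ≤ 1 * M := mul_le_mul hu hw (norm_nonneg _) zero_le_one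
        _ = M := one_mul M)
    have h2 : |t * (2 * ⟪u, w⟫)| ≤ t₀ * (2 * M) := by
      rw [abs_mul, abs_mul, abs_two]
      gcongr
    have h3 : t₀ * (2 * M) ≤ 1 / 2 := by
      rw [ht₀, div_mul_eq_mul_div, div_le_div_iff₀ (by positivity) (by norm_num)]
      linarith
    have h4 := (abs_le.1 h2).1
    change 0 < 1 + t * (2 * ⟪u, w⟫ + t * ‖w‖ ^ 2)
    nlinarith [sq_nonneg (t * ‖w‖)]
  obtain ⟨C1, -, hC1⟩ := exists_sobSize_comp_le isOpen_projDomain contDiffOn_projMap hKc hKO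
  obtain ⟨C2, hC20, hC2⟩ := exists_sobSize_comp_le isOpen_projDomain contDiffOn_projRem hKc hKO
  obtain ⟨C3, -, hC3⟩ := exists_sobSize_comp_le isOpen_univ contDiff_tangPart.contDiffOn hKc
    (Set.subset_univ K)
  set T : ℝ → ℝ × ℝ → ℝ × E3 × E3 := fun t p => (t, v p, φc p) with hT
  have hvφ : ContDiff ℝ 2 fun p => (v p, φc p) := hv.contDiff.prodMk hφc.contDiff
  have hTc : ∀ t, ContDiff ℝ 2 (T t) := fun t => contDiff_const.prodMk hvφ
  have hTK : ∀ t, |t| < t₀ → ∀ p, T t p ∈ K := fun t ht p =>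
    ⟨by simpa using ht.le, by simpa using (hv1 p).le, by simpa using hM p⟩
  have hTs : ∀ t p, sobSize (T t) p ≤ sobSize v p + sobSize φc p := fun t p => by
    refine (sobSize_prodMk_le contDiff_const hvφ p).trans ?_
    rw [sobSize_const, zero_add]
    exact sobSize_prodMk_le hv.contDiff hφc.contDiff p
  have hTper : ∀ t, AnglePeriodic (T t) := fun t s a => by
    simp only [hT, hv.periodic s a, hφc.periodic s a]
  have hTW : ∀ t, |t| < t₀ → CylW22 (T t) := fun t ht => by
    refine ⟨hTc t, hTper t, ?_, ?_⟩
    · exact (hKc.isBounded.exists_norm_le).imp fun C hC p => hC _ (hTK t ht p)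
    · exact (hv.memLp.add hφc.memLp).mono' (continuous_sobSize (hTc t)).aestronglyMeasurable
        (Filter.Eventually.of_forall fun p => by
          rw [Real.norm_of_nonneg (sobSize_nonneg _ p)]; exact hTs t p)
  have hW : ∀ t, |t| < t₀ → CylW22 fun p => projMap (T t p) := fun t ht => by
    obtain ⟨h1, h2, h3⟩ := hC1 (T t) (hTc t) (hTK t ht)
    exact (hTW t ht).of_le h1 (fun s a => by rw [hTper t s a]) h2 h3
  have hψ' : ∀ t, ψ = fun p => tangPart (T t p) := fun t => hψ
  have hψW : CylW22 ψ := by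
    have h0 : |(0 : ℝ)| < t₀ := by simpa using ht₀pos
    obtain ⟨h1, h2, h3⟩ := hC3 (T 0) (hTc 0) (hTK 0 h0)
    rw [hψ' 0]
    exact (hTW 0 h0).of_le h1 (fun s a => by rw [hTper 0 s a]) h2 h3
  refine ⟨hψW, ?_⟩
  set R : ℝ → ℝ × ℝ → E3 := fun t p => projRem (T t p) with hR
  set m : ℝ × ℝ → ℝ := fun p => C2 * (sobSize v p + sobSize φc p) with hm
  have hmL : MemLp m 2 strip := (hv.memLp.add hφc.memLp).const_mul C2
  have hRc : ∀ t, |t| < t₀ → ContDiff ℝ 2 (R t) := fun t ht => (hC2 (T t) (hTc t) (hTK t ht)).1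
  have hRs : ∀ t, |t| < t₀ → ∀ p, sobSize (R t) p ≤ m p := fun t ht p =>
    ((hC2 (T t) (hTc t) (hTK t ht)).2.2 p).trans (mul_le_mul_of_nonneg_left (hTs t p) hC20)
  have hexp : ∀ t, |t| < t₀ → (fun p => projMap (T t p)) = fun p => v p + t • ψ p + t ^ 2 • R t p := by
    intro t ht
    funext p
    rw [hψ' t]
    exact projMap_eq (hKO (hTK t ht p))
  have hpd : ∀ {v w r : ℝ × ℝ → E3}, ContDiff ℝ 1 v → ContDiff ℝ 1 w → ContDiff ℝ 1 r →
      ∀ (t : ℝ) e, pd e (fun p => v p + t • w p + t ^ 2 • r p)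
        = fun p => pd e v p + t • pd e w p + t ^ 2 • pd e r p := by
    intro v w r h1 h2 h3 t e
    funext p
    have d1 := h1.differentiable one_ne_zero
    have d2 : Differentiable ℝ fun p => t • w p := (h2.differentiable one_ne_zero).const_smul t
    have d3 : Differentiable ℝ fun p => t ^ 2 • r p :=
      (h3.differentiable one_ne_zero).const_smul (t ^ 2)
    have d4 : Differentiable ℝ fun p => v p + t • w p := d1.add d2
    rw [pd_add d4 d3, pd_add d1 d2, pd_const_smul (h2.differentiable one_ne_zero),
      pd_const_smul (h3.differentiable one_ne_zero)]
  have le21 : (1 : WithTop ℕ∞) ≤ 2 := by norm_num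
  have cd1 := hv.contDiff.of_le le21
  have cd2 := hψW.contDiff.of_le le21
  have pd1 : ∀ t, |t| < t₀ → ∀ e, pd e (fun p => projMap (T t p))
      = fun p => pd e v p + t • pd e ψ p + t ^ 2 • pd e (R t) p := fun t ht e => by
    rw [hexp t ht]; exact hpd cd1 cd2 ((hRc t ht).of_le le21) t e
  have pd2 : ∀ t, |t| < t₀ → ∀ e e', pd e (pd e' (fun p => projMap (T t p)))
      = fun p => pd e (pd e' v) p + t • pd e (pd e' ψ) p + t ^ 2 • pd e (pd e' (R t)) p :=
    fun t ht e e' => by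
      rw [pd1 t ht]
      exact hpd (contDiff_pd₁ hv.contDiff e') (contDiff_pd₁ hψW.contDiff e')
        (contDiff_pd₁ (hRc t ht) e') t e
  -- the scaled Laplacian
  set Λ : (ℝ × ℝ → E3) → ℝ × ℝ → E3 :=
    fun w p => Real.cosh p.1 • (∂ₛ (∂ₛ w) p + ∂ₐ (∂ₐ w) p) with hΛ
  have cΛ : ∀ w, ContDiff ℝ 2 w → Continuous (Λ w) := fun w hw =>
    continuous_cosh_fst.smul ((continuous_pd₂ hw _ _).add (continuous_pd₂ hw _ _))
  have nΛ : ∀ w p, ‖Λ w p‖ ≤ 2 * sobSize w p := fun w p => by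
    simp only [hΛ]
    rw [norm_smul, Real.norm_of_nonneg (Real.cosh_pos _).le]
    exact cosh_laplacian_le w p
  have pdΛ : ∀ t, |t| < t₀ → Λ (fun p => projMap (T t p))
      = fun p => Λ v p + t • Λ ψ p + t ^ 2 • Λ (R t) p := fun t ht => by
    funext p
    simp only [hΛ, pd2 t ht]
    module
  have mΛ : ∀ {w : ℝ × ℝ → E3}, CylW22 w → MemLp (Λ w) 2 strip := fun {w} hw =>
    hw.memLp_of_le (cΛ w hw.contDiff) (nΛ w)
  -- the remainders are dominated by the square integrable function `m`, uniformly in `t`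
  have D1 := hasDerivAt_integral_norm_sq (c := fun t => ∂ₛ (R t)) ht₀pos hv.cylW12.memLp_ds
    hψW.cylW12.memLp_ds hmL (fun t ht => (continuous_pd₁ (hRc t ht) _).aestronglyMeasurable)
    (fun t ht p => (sobSize_bounds (R t) p).1.trans (hRs t ht p))
  have D2 := hasDerivAt_integral_norm_sq (c := fun t => ∂ₐ (R t)) ht₀pos hv.cylW12.memLp_da
    hψW.cylW12.memLp_da hmL (fun t ht => (continuous_pd₁ (hRc t ht) _).aestronglyMeasurable)
    (fun t ht p => (sobSize_bounds (R t) p).2.1.trans (hRs t ht p))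
  have D3 := hasDerivAt_integral_norm_sq (c := fun t => Λ (R t)) ht₀pos (mΛ hv) (mΛ hψW)
    (hmL.const_mul 2) (fun t ht => (cΛ _ (hRc t ht)).aestronglyMeasurable)
    (fun t ht p => (nΛ _ p).trans (mul_le_mul_of_nonneg_left (hRs t ht p) zero_le_two))
  have D := ((D1.add D2).add (D3.const_mul ε)).const_mul (1 / 2)
  refine (D.congr_deriv ?_).congr_of_eventuallyEq ?_
  · ring
  · filter_upwards [Metric.ball_mem_nhds (0 : ℝ) ht₀pos] with t ht
    rw [Metric.mem_ball, Real.dist_0_eq_abs] at ht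
    have hu : ∀ᵐ x ∂area, nearestPoint (U x + t • φ x) = (fun p => projMap (T t p)) (coord x) := by
      filter_upwards [hU, ae_cylS_coord] with x h1 h2
      have hx : (x : E3) = cyl (coord x) := by
        conv_lhs => rw [← h2]
        rfl
      rw [h1, nearestPoint_eq_projMap (hv1 _)]
      simp only [hT, hφcdef, ← hx]
    rw [energy_eq (hW t ht) hu]
    have i1 := (hW t ht).cylW12.memLp_ds.integrable_norm_pow two_ne_zero
    have i2 := (hW t ht).cylW12.memLp_da.integrable_norm_pow two_ne_zero
    have i3 := (mΛ (hW t ht)).integrable_norm_pow two_ne_zero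
    have e1 := integral_add (i1.add i2) (i3.const_mul ε)
    have e2 := integral_add i1 i2
    have e3 := integral_const_mul (μ := strip) ε
      (fun p => ‖Λ (fun p => projMap (T t p)) p‖ ^ 2)
    have e4 : ∫ p, cylEnergyDens ε (fun p => projMap (T t p)) p ∂strip
        = (∫ p, ‖∂ₛ (fun p => projMap (T t p)) p‖ ^ 2 ∂strip)
          + (∫ p, ‖∂ₐ (fun p => projMap (T t p)) p‖ ^ 2 ∂strip)
          + ε * ∫ p, ‖Λ (fun p => projMap (T t p)) p‖ ^ 2 ∂strip := by
      rw [← e3, ← e2]; exact e1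
    rw [e4, pd1 t ht, pd1 t ht, pdΛ t ht]
    rfl

/-! ### Compactness tools on the line -/

open Filter Topology in
/-- Bounded sequences in `L²(ℝ)` have weakly convergent subsequences. -/
theorem exists_weak_subseq {h : ℕ → ℝ → ℝ} {C : ℝ} (hh : ∀ n, MemLp (h n) 2 volume)
    (hC : ∀ n, ∫ x, h n x ^ 2 ≤ C) :
    ∃ (H : ℝ → ℝ) (φ : ℕ → ℕ), StrictMono φ ∧ MemLp H 2 volume ∧
      ∀ k : ℝ → ℝ, MemLp k 2 volume →
        Tendsto (fun n => ∫ x, h (φ n) x * k x) atTop (𝓝 (∫ x, H x * k x)) := by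
  have : Fact ((2 : ENNReal) ≠ ⊤) := ⟨by norm_num⟩
  let L := Lp ℝ 2 (volume : Measure ℝ)
  let D := InnerProductSpace.toDual ℝ L
  have hn : ∀ n, ‖(hh n).toLp (h n)‖ ^ 2 ≤ C := fun n => by
    rw [← real_inner_self_eq_norm_sq, L2.inner_def]
    refine le_trans (le_of_eq (integral_congr_ae ?_)) (hC n)
    filter_upwards [(hh n).coeFn_toLp] with x hx
    simp [hx, sq]
  have hC0 : ∀ n, ‖(hh n).toLp (h n)‖ ≤ √C := fun n => Real.le_sqrt_of_sq_le (hn n)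
  -- sequential Banach-Alaoglu in the dual of the separable space `L²`, identified with `L²` by
  -- Riesz
  obtain ⟨ℓ, -, φ, hφ, hlim⟩ := WeakDual.isSeqCompact_closedBall ℝ L 0 (√C)
    (x := fun n => StrongDual.toWeakDual (D ((hh n).toLp (h n)))) (fun n => by
      rw [Set.mem_preimage, mem_closedBall_zero_iff]
      exact (D.norm_map _).trans_le (hC0 n))
  obtain ⟨H, hH⟩ := D.surjective (WeakDual.toStrongDual ℓ)
  refine ⟨H, φ, hφ, Lp.memLp H, fun k hk => ?_⟩
  have h1 := tendsto_iff_forall_eval_tendsto_topDualPairing.1 hlim (hk.toLp k)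
  have e : ∀ G : L, D G (hk.toLp k) = ∫ x, G x * k x := fun G => by
    rw [InnerProductSpace.toDual_apply_apply, L2.inner_def]
    refine integral_congr_ae ?_
    filter_upwards [hk.coeFn_toLp] with x hx
    simp [hx, mul_comm]
  have h2 : ℓ (hk.toLp k) = ∫ x, H x * k x := by rw [← e, hH]; rfl
  rw [← h2]
  refine h1.congr fun n => ?_
  refine (e _).trans (integral_congr_ae ?_)
  filter_upwards [(hh (φ n)).coeFn_toLp] with x hx
  simp [hx]

open Filter Topology in
/-- The `L²` norm is weakly lower semicontinuous. -/
theorem integral_sq_le_of_weak {h : ℕ → ℝ → ℝ} {H : ℝ → ℝ} {b : ℝ}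
    (hh : ∀ n, MemLp (h n) 2 volume) (hH : MemLp H 2 volume)
    (hw : Tendsto (fun n => ∫ x, h n x * H x) atTop (𝓝 (∫ x, H x * H x)))
    (hb : Tendsto (fun n => ∫ x, h n x ^ 2) atTop (𝓝 b)) : ∫ x, H x ^ 2 ≤ b := by
  have e : ∫ x, H x * H x = ∫ x, H x ^ 2 := by simp only [sq]
  have h1 : ∀ n, 2 * (∫ x, h n x * H x) ≤ (∫ x, h n x ^ 2) + ∫ x, H x ^ 2 := fun n => by
    rw [← integral_const_mul, ← integral_add (hh n).integrable_sq hH.integrable_sq]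
    refine integral_mono (((hh n).integrable_mul hH).const_mul 2)
      ((hh n).integrable_sq.add hH.integrable_sq) fun x => ?_
    simp only
    nlinarith [sq_nonneg (h n x - H x)]
  have h2 := le_of_tendsto_of_tendsto' (hw.const_mul 2) (hb.add_const _) h1
  rw [e] at h2
  linarith

open Filter Topology in
/-- Fatou's lemma for Bochner integrals. -/
theorem integrable_and_integral_le_of_tendsto {F : ℕ → ℝ → ℝ} {G : ℝ → ℝ} {a : ℝ}
    (hF : ∀ n, Integrable (F n)) (h0 : ∀ n x, 0 ≤ F n x)
    (hG : ∀ x, Tendsto (fun n => F n x) atTop (𝓝 (G x)))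
    (ha : Tendsto (fun n => ∫ x, F n x) atTop (𝓝 a)) :
    Integrable G ∧ ∫ x, G x ≤ a := by
  have e : ∀ n, ∫⁻ x, ‖F n x‖ₑ = ENNReal.ofReal (∫ x, F n x) := fun n => by
    rw [ofReal_integral_eq_lintegral_ofReal (hF n) (Eventually.of_forall (h0 n))]
    exact lintegral_congr fun x => Real.enorm_of_nonneg (h0 n x)
  have hl : liminf (fun n => ∫⁻ x, ‖F n x‖ₑ) atTop = ENNReal.ofReal a := by
    simp only [e]
    exact ((ENNReal.continuous_ofReal.tendsto a).comp ha).liminf_eq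
  have hi : Integrable G := integrable_of_tendsto (Eventually.of_forall hG) (fun n => (hF n).1)
    (by rw [hl]; exact ENNReal.ofReal_ne_top)
  have hG0 : ∀ x, 0 ≤ G x := fun x => ge_of_tendsto' (hG x) fun n => h0 n x
  refine ⟨hi, ?_⟩
  have h1 := lintegral_enorm_le_liminf_of_tendsto (Eventually.of_forall hG)
    (fun n => (hF n).1.aemeasurable.enorm)
  rw [hl] at h1
  have h2 : ENNReal.ofReal (∫ x, G x) ≤ ENNReal.ofReal a := by
    rw [ofReal_integral_eq_lintegral_ofReal hi (Eventually.of_forall hG0)]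
    refine le_trans (le_of_eq ?_) h1
    exact lintegral_congr fun x => (Real.enorm_of_nonneg (hG0 x)).symm
  have ha0 : 0 ≤ a := ge_of_tendsto' ha fun n => integral_nonneg (h0 n)
  exact (ENNReal.ofReal_le_ofReal_iff ha0).1 h2

open Filter Topology in
/-- A weighted `L⁴` bound on the derivative controls the tail: where `|g| ≤ M e^{s/2}` the
exponential is integrated, elsewhere `|g| ≤ 4 M⁻³ cosh² g⁴`. -/
theorem abs_le_of_quartic_bound {f g : ℝ → ℝ} (hf : ∀ s, HasDerivAt f (g s) s) (hg : Continuous g)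
    (hlim : Tendsto f atBot (𝓝 0)) {K : ℝ}
    (hi : Integrable fun s => Real.cosh s ^ 2 * g s ^ 4)
    (hK : ∫ s, Real.cosh s ^ 2 * g s ^ 4 ≤ K) {M : ℝ} (hM : 0 < M) {s : ℝ} (hs : s ≤ 0) :
    |f s| ≤ 2 * M * Real.exp (s / 2) + 4 * K / M ^ 3 := by
  have key : ∀ t ≤ 0, |g t| ≤ M * Real.exp (t / 2) + 4 / M ^ 3 * (Real.cosh t ^ 2 * g t ^ 4) := by
    intro t ht
    have hc : 0 ≤ 4 / M ^ 3 * (Real.cosh t ^ 2 * g t ^ 4) := by positivity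
    rcases le_or_gt |g t| (M * Real.exp (t / 2)) with h | h
    · linarith
    · have hE := Real.exp_pos (t / 2)
      have h3 : (M * Real.exp (t / 2)) ^ 3 ≤ |g t| ^ 3 := by gcongr
      have e1 : g t ^ 4 = |g t| ^ 3 * |g t| := by
        rw [← pow_succ]; exact (Even.pow_abs (by decide) _).symm
      have hco : Real.exp (-t) ≤ 2 * Real.cosh t := by
        rw [Real.cosh_eq]; linarith [Real.exp_pos t]
      have e2 : Real.exp (t / 2) * Real.exp (t / 2) * Real.exp (-t) = 1 := by
        rw [← Real.exp_add, ← Real.exp_add]; simp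
      have e3 : Real.exp (t / 2) ≤ 1 := Real.exp_le_one_iff.2 (by linarith)
      have e4 : 1 ≤ Real.exp (t / 2) ^ 3 * (4 * Real.cosh t ^ 2) := by
        have : 1 ≤ Real.exp (-t) := Real.one_le_exp (by linarith)
        have e5 : Real.exp (-t) ^ 2 ≤ 4 * Real.cosh t ^ 2 := by
          nlinarith [Real.cosh_pos t]
        calc (1 : ℝ) = (Real.exp (t / 2) * Real.exp (t / 2) * Real.exp (-t)) ^ 2 := by rw [e2]; simp
          _ = Real.exp (t / 2) ^ 3 * Real.exp (-t) ^ 2 * Real.exp (t / 2) := by ring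
          _ ≤ Real.exp (t / 2) ^ 3 * Real.exp (-t) ^ 2 * 1 := by gcongr
          _ ≤ Real.exp (t / 2) ^ 3 * (4 * Real.cosh t ^ 2) := by rw [mul_one]; gcongr
      have e6 : |g t| ≤ 4 / M ^ 3 * (Real.cosh t ^ 2 * g t ^ 4) := by
        rw [e1, div_mul_eq_mul_div, le_div_iff₀ (by positivity)]
        calc |g t| * M ^ 3 = (|g t| * M ^ 3) * 1 := by ring
          _ ≤ (|g t| * M ^ 3) * (Real.exp (t / 2) ^ 3 * (4 * Real.cosh t ^ 2)) := by gcongr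
          _ = (M * Real.exp (t / 2)) ^ 3 * (4 * (Real.cosh t ^ 2 * |g t|)) := by ring
          _ ≤ |g t| ^ 3 * (4 * (Real.cosh t ^ 2 * |g t|)) := by gcongr
          _ = _ := by ring
      have : 0 ≤ M * Real.exp (t / 2) := by positivity
      linarith
  have hd : ∀ t, HasDerivAt (fun t => 2 * M * Real.exp (t / 2)) (M * Real.exp (t / 2)) t := by
    intro t
    exact (((hasDerivAt_id t).div_const 2).exp.const_mul (2 * M)).congr_deriv (by simp only [id]; ring)
  have hcexp : Continuous fun t => M * Real.exp (t / 2) := by fun_prop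
  have hdiff : ∀ a ≤ s, |f s - f a| ≤ 2 * M * Real.exp (s / 2) + 4 * K / M ^ 3 := by
    intro a ha
    have c1 : Continuous fun t => 4 / M ^ 3 * (Real.cosh t ^ 2 * g t ^ 4) := by
      have := Real.continuous_cosh; fun_prop
    rw [← intervalIntegral.integral_eq_sub_of_hasDerivAt (fun x _ => hf x)
      (hg.intervalIntegrable _ _), ← Real.norm_eq_abs]
    calc ‖∫ t in a..s, g t‖ ≤ ∫ t in a..s, ‖g t‖ :=
          intervalIntegral.norm_integral_le_integral_norm ha
      _ ≤ ∫ t in a..s, (M * Real.exp (t / 2) + 4 / M ^ 3 * (Real.cosh t ^ 2 * g t ^ 4)) :=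
          intervalIntegral.integral_mono_on ha (hg.norm.intervalIntegrable _ _)
            ((hcexp.add c1).intervalIntegrable _ _) fun x hx => key x (hx.2.trans hs)
      _ = (2 * M * Real.exp (s / 2) - 2 * M * Real.exp (a / 2))
          + 4 / M ^ 3 * ∫ t in a..s, (Real.cosh t ^ 2 * g t ^ 4) := by
          rw [intervalIntegral.integral_add (hcexp.intervalIntegrable _ _)
            (c1.intervalIntegrable _ _), intervalIntegral.integral_eq_sub_of_hasDerivAt
            (fun x _ => hd x) (hcexp.intervalIntegrable _ _), intervalIntegral.integral_const_mul]
      _ ≤ 2 * M * Real.exp (s / 2) + 4 / M ^ 3 * K := by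
          have h1 : ∫ t in a..s, (Real.cosh t ^ 2 * g t ^ 4) ≤ K := by
            rw [intervalIntegral.integral_of_le ha]
            exact (setIntegral_le_integral hi (Eventually.of_forall fun x => by positivity)).trans hK
          have h2 : 4 / M ^ 3 * ∫ t in a..s, (Real.cosh t ^ 2 * g t ^ 4) ≤ 4 / M ^ 3 * K :=
            mul_le_mul_of_nonneg_left h1 (by positivity)
          have : 0 < 2 * M * Real.exp (a / 2) := by positivity
          linarith
      _ = _ := by ring
  -- let the lower end point `a` go to `-∞`, where `f` vanishes
  have hl : Tendsto (fun a => |f s - f a|) atBot (𝓝 |f s - 0|) := (tendsto_const_nhds.sub hlim).abs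
  rw [sub_zero] at hl
  exact le_of_tendsto hl ((eventually_le_atBot s).mono hdiff)

/-! ### Profiles of corotational maps -/

open Filter Topology in
/-- An angle function `f` with derivative `g` along the axis of the cylinder, running from `0` to
`2π`, of finite energy. The second derivative is encoded by the weighted quantity
`T = cosh (g' - sin f cos f)`, square integrable, where `g'` is a weak derivative. -/
structure Profile (f g T : ℝ → ℝ) : Prop where
  hasDerivAt : ∀ s, HasDerivAt f (g s) s
  memLp_T : MemLp T 2 volume
  sub_eq : ∀ a b, g b - g a
    = ∫ s in a..b, (T s * (Real.cosh s)⁻¹ + Real.sin (f s) * Real.cos (f s))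
  tendsto_atBot : Tendsto f atBot (𝓝 0)
  tendsto_atTop : Tendsto f atTop (𝓝 (2 * Real.pi))
  memLp_deriv : MemLp g 2 volume
  memLp_sin : MemLp (fun s => Real.sin (f s)) 2 volume
  memLp_quad : MemLp (fun s => Real.cosh s * (g s ^ 2 + Real.sin (f s) ^ 2)) 2 volume

/-- The energy of the corotational map with a given profile, divided by `π`. -/
def profileEnergy (ε : ℝ) (f g T : ℝ → ℝ) : ℝ :=
  (∫ s, g s ^ 2) + (∫ s, Real.sin (f s) ^ 2) + ε * (∫ s, T s ^ 2)
    + ε * ∫ s, (Real.cosh s * (g s ^ 2 + Real.sin (f s) ^ 2)) ^ 2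

theorem _root_.MeasureTheory.MemLp.intervalIntegrable_of_two {h : ℝ → ℝ} (hh : MemLp h 2 volume)
    (a b : ℝ) : IntervalIntegrable h volume a b :=
  (hh.locallyIntegrable one_le_two).integrableOn_isCompact isCompact_uIcc |>.intervalIntegrable

theorem abs_intervalIntegral_le {W : ℝ → ℝ} (hW : MemLp W 2 volume) {C : ℝ}
    (hC : ∫ s, W s ^ 2 ≤ C) (a b : ℝ) : |∫ s in a..b, W s| ≤ |b - a| + C := by
  have hfin : volume (Set.uIoc a b) ≠ ⊤ := by simp [Set.uIoc]
  rw [← Real.norm_eq_abs]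
  calc ‖∫ s in a..b, W s‖ ≤ ∫ s in Set.uIoc a b, ‖W s‖ :=
        intervalIntegral.norm_integral_le_integral_norm_uIoc
    _ ≤ ∫ s in Set.uIoc a b, (1 + W s ^ 2) := by
        refine integral_mono (hW.intervalIntegrable_of_two a b).def'.norm
          ((integrableOn_const hfin).add hW.integrable_sq.integrableOn) fun s => ?_
        simp only [Real.norm_eq_abs]
        nlinarith [sq_abs (W s), sq_nonneg (|W s| - 1)]
    _ = (∫ s in Set.uIoc a b, (1 : ℝ)) + ∫ s in Set.uIoc a b, W s ^ 2 :=
        integral_add (integrableOn_const hfin) hW.integrable_sq.integrableOn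
    _ ≤ |b - a| + C := by
        refine add_le_add (le_of_eq ?_) ((setIntegral_le_integral hW.integrable_sq
          (Filter.Eventually.of_forall fun s => sq_nonneg _)).trans hC)
        simp [Measure.real, Set.uIoc, Real.volume_Ioc, max_sub_min_eq_abs]

theorem integral_sq_add_sq_add_sq {a b c : ℝ → ℝ} (ha : MemLp a 2 volume) (hb : MemLp b 2 volume)
    (hc : MemLp c 2 volume) (ε : ℝ) : ∫ s, (a s ^ 2 + b s ^ 2 + ε * c s ^ 2)
      = (∫ s, a s ^ 2) + (∫ s, b s ^ 2) + ε * ∫ s, c s ^ 2 := by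
  rw [← integral_const_mul, ← integral_add ha.integrable_sq hb.integrable_sq]
  exact integral_add (ha.integrable_sq.add hb.integrable_sq) (hc.integrable_sq.const_mul ε)

open Filter Topology in
/-- Weak convergence passes to integrals over bounded intervals against bounded continuous
functions. -/
theorem tendsto_intervalIntegral_of_weak {h : ℕ → ℝ → ℝ} {H q : ℝ → ℝ}
    (hw : ∀ k : ℝ → ℝ, MemLp k 2 volume →
      Tendsto (fun n => ∫ x, h n x * k x) atTop (𝓝 (∫ x, H x * k x)))
    (hq : Continuous q) (hq1 : ∀ x, ‖q x‖ ≤ 1) (a b : ℝ) :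
    Tendsto (fun n => ∫ x in a..b, h n x * q x) atTop (𝓝 (∫ x in a..b, H x * q x)) := by
  have key : ∀ a b : ℝ, Tendsto (fun n => ∫ x in Set.Ioc a b, h n x * q x) atTop
      (𝓝 (∫ x in Set.Ioc a b, H x * q x)) := fun a b => by
    have hk : MemLp ((Set.Ioc a b).indicator q) 2 volume := by
      rw [memLp_indicator_iff_restrict measurableSet_Ioc]
      exact MemLp.of_bound hq.aestronglyMeasurable 1 (Eventually.of_forall hq1)
    have e : ∀ G : ℝ → ℝ, ∫ x, G x * (Set.Ioc a b).indicator q x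
        = ∫ x in Set.Ioc a b, G x * q x := fun G => by
      rw [← integral_indicator measurableSet_Ioc]
      simp only [Set.indicator_mul_right]
    simpa only [e] using hw _ hk
  exact (key a b).sub (key b a)

namespace Profile

variable {f g T : ℝ → ℝ}

theorem continuous (h : Profile f g T) : Continuous f :=
  continuous_iff_continuousAt.2 fun s => (h.hasDerivAt s).continuousAt

theorem memLp_rhs_left (h : Profile f g T) :
    MemLp (fun s => T s * (Real.cosh s)⁻¹) 2 volume :=
  h.memLp_T.mono (h.memLp_T.1.mul (by
    have := Real.continuous_cosh.inv₀ fun s => (Real.cosh_pos s).ne'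
    exact this.aestronglyMeasurable)) (Filter.Eventually.of_forall fun s => by
      rw [norm_mul]
      refine mul_le_of_le_one_right (norm_nonneg _) ?_
      rw [Real.norm_of_nonneg (by positivity)]
      exact inv_le_one_of_one_le₀ (Real.one_le_cosh s))

theorem memLp_sin_mul_cos (h : Profile f g T) :
    MemLp (fun s => Real.sin (f s) * Real.cos (f s)) 2 volume :=
  h.memLp_sin.mono (by
    have := h.continuous
    exact (by fun_prop : Continuous _).aestronglyMeasurable) (Filter.Eventually.of_forall fun s => by
      rw [norm_mul]
      exact mul_le_of_le_one_right (norm_nonneg _) (Real.abs_cos_le_one _))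

theorem memLp_rhs (h : Profile f g T) :
    MemLp (fun s => T s * (Real.cosh s)⁻¹ + Real.sin (f s) * Real.cos (f s)) 2 volume :=
  h.memLp_rhs_left.add h.memLp_sin_mul_cos

theorem eq_add (h : Profile f g T) (s : ℝ) : g s = g 0
    + ∫ s in (0 : ℝ)..s, (T s * (Real.cosh s)⁻¹ + Real.sin (f s) * Real.cos (f s)) := by
  rw [← h.sub_eq]; ring

theorem continuous_deriv (h : Profile f g T) : Continuous g := by
  have : g = fun s => g 0
    + ∫ s in (0 : ℝ)..s, (T s * (Real.cosh s)⁻¹ + Real.sin (f s) * Real.cos (f s)) :=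
    funext h.eq_add
  rw [this]
  exact continuous_const.add
    (intervalIntegral.continuous_primitive h.memLp_rhs.intervalIntegrable_of_two 0)

theorem integral_rhs_sq_le (h : Profile f g T) :
    ∫ s, (T s * (Real.cosh s)⁻¹ + Real.sin (f s) * Real.cos (f s)) ^ 2
      ≤ 2 * (∫ s, T s ^ 2) + 2 * ∫ s, Real.sin (f s) ^ 2 := by
  rw [← integral_const_mul, ← integral_const_mul, ← integral_add
    (h.memLp_T.integrable_sq.const_mul 2) (h.memLp_sin.integrable_sq.const_mul 2)]
  refine integral_mono h.memLp_rhs.integrable_sq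
    ((h.memLp_T.integrable_sq.const_mul 2).add (h.memLp_sin.integrable_sq.const_mul 2)) fun s => ?_
  simp only
  have h1 : (Real.cosh s)⁻¹ ^ 2 ≤ 1 := by
    have := inv_le_one_of_one_le₀ (Real.one_le_cosh s)
    have h0 : 0 ≤ (Real.cosh s)⁻¹ := by positivity
    nlinarith
  have h2 := Real.cos_sq_le_one (f s)
  nlinarith [sq_nonneg (T s * (Real.cosh s)⁻¹ - Real.sin (f s) * Real.cos (f s)),
    mul_le_mul_of_nonneg_left h1 (sq_nonneg (T s)),
    mul_le_mul_of_nonneg_left h2 (sq_nonneg (Real.sin (f s)))]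

/-- The bending energy bounds `cosh² g⁴` in `L¹`, which is what `abs_le_of_quartic_bound` asks for.
-/
theorem quartic (h : Profile f g T) : Integrable (fun s => Real.cosh s ^ 2 * g s ^ 4) ∧
    ∫ s, Real.cosh s ^ 2 * g s ^ 4
      ≤ ∫ s, (Real.cosh s * (g s ^ 2 + Real.sin (f s) ^ 2)) ^ 2 := by
  have hle : ∀ s, Real.cosh s ^ 2 * g s ^ 4
      ≤ (Real.cosh s * (g s ^ 2 + Real.sin (f s) ^ 2)) ^ 2 := fun s => by
    have : (Real.cosh s * (g s ^ 2 + Real.sin (f s) ^ 2)) ^ 2 = Real.cosh s ^ 2 * g s ^ 4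
      + Real.cosh s ^ 2 * (2 * g s ^ 2 * Real.sin (f s) ^ 2 + (Real.sin (f s) ^ 2) ^ 2) := by ring
    rw [this]
    exact le_add_of_nonneg_right (by positivity)
  have hc := h.continuous_deriv
  have hco := Real.continuous_cosh
  have hi : Integrable (fun s => Real.cosh s ^ 2 * g s ^ 4) :=
    h.memLp_quad.integrable_sq.mono' (by fun_prop : Continuous _).aestronglyMeasurable
      (Filter.Eventually.of_forall fun s => by
        rw [Real.norm_of_nonneg (by positivity)]; exact hle s)
  exact ⟨hi, integral_mono hi h.memLp_quad.integrable_sq hle⟩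

/-- A bound on the tail at `-∞` that is uniform over profiles of bounded energy, so that no part of
the angle `2π` is lost at the pole in a limit. -/
theorem abs_angle_le (h : Profile f g T) {K : ℝ}
    (hK : ∫ s, (Real.cosh s * (g s ^ 2 + Real.sin (f s) ^ 2)) ^ 2 ≤ K) {M : ℝ} (hM : 0 < M) {s : ℝ}
    (hs : s ≤ 0) : |f s| ≤ 2 * M * Real.exp (s / 2) + 4 * K / M ^ 3 :=
  abs_le_of_quartic_bound h.hasDerivAt h.continuous_deriv h.tendsto_atBot h.quartic.1
    (h.quartic.2.trans hK) hM hs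

open Filter in
/-- The uniform bound on the tail at `+∞`, by reflection of the axis. -/
theorem abs_two_pi_sub_le (h : Profile f g T) {K : ℝ}
    (hK : ∫ s, (Real.cosh s * (g s ^ 2 + Real.sin (f s) ^ 2)) ^ 2 ≤ K) {M : ℝ} (hM : 0 < M) {s : ℝ}
    (hs : s ≤ 0) : |2 * Real.pi - f (-s)| ≤ 2 * M * Real.exp (s / 2) + 4 * K / M ^ 3 := by
  refine abs_le_of_quartic_bound (f := fun s => 2 * Real.pi - f (-s)) (g := fun s => g (-s))
    (fun s => ?_) (h.continuous_deriv.comp continuous_neg) ?_ ?_ ?_ hM hs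
  · exact (((h.hasDerivAt (-s)).comp s (hasDerivAt_neg s)).const_sub _).congr_deriv (by ring)
  · simpa using (h.tendsto_atTop.comp tendsto_neg_atBot_atTop).const_sub (2 * Real.pi)
  · simpa using h.quartic.1.comp_neg
  · have := integral_neg_eq_self (fun s => Real.cosh s ^ 2 * g s ^ 4) volume
    simp only [Real.cosh_neg] at this
    rw [this]
    exact h.quartic.2.trans hK

end Profile

open Filter Topology in
/-- The tail bounds hold for all `M`: `M` is chosen large, then `s` close to `-∞`. -/
theorem tendsto_zero_of_tail {f : ℝ → ℝ} {K : ℝ}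
    (h : ∀ M > 0, ∀ s ≤ 0, |f s| ≤ 2 * M * Real.exp (s / 2) + 4 * K / M ^ 3) :
    Tendsto f atBot (𝓝 0) := by
  have h1 : Tendsto (fun M : ℝ => 4 * K / M ^ 3) atTop (𝓝 0) :=
    tendsto_const_nhds.div_atTop (tendsto_pow_atTop (by norm_num))
  rw [Metric.tendsto_nhds]
  intro η hη
  obtain ⟨M, hM, hM0⟩ := ((h1.eventually_lt_const (half_pos hη)).and (eventually_gt_atTop 0)).exists
  have h2 : Tendsto (fun s : ℝ => 2 * M * Real.exp (s / 2)) atBot (𝓝 (2 * M * 0)) :=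
    (Real.tendsto_exp_atBot.comp (tendsto_id.atBot_div_const (by norm_num))).const_mul _
  rw [mul_zero] at h2
  filter_upwards [h2.eventually_lt_const (half_pos hη), eventually_le_atBot 0] with s hs hs0
  rw [Real.dist_0_eq_abs]
  linarith [h M hM0 s hs0]

open Filter Topology in
/-- Limits of profiles of bounded energy are profiles, and the energy is lower semicontinuous. -/
theorem Profile.of_tendsto {f g T : ℕ → ℝ → ℝ} (h : ∀ n, Profile (f n) (g n) (T n)) {ε K C : ℝ}
    (hε : 0 < ε)
    (hK : ∀ n, ∫ s, (Real.cosh s * (g n s ^ 2 + Real.sin (f n s) ^ 2)) ^ 2 ≤ K)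
    (hC : ∀ n, ∫ s, (T n s * (Real.cosh s)⁻¹ + Real.sin (f n s) * Real.cos (f n s)) ^ 2 ≤ C)
    {W V : ℝ → ℝ} (hW : MemLp W 2 volume) (hV : MemLp V 2 volume)
    (hwW : ∀ k : ℝ → ℝ, MemLp k 2 volume → Tendsto (fun n => ∫ s, (T n s * (Real.cosh s)⁻¹
      + Real.sin (f n s) * Real.cos (f n s)) * k s) atTop (𝓝 (∫ s, W s * k s)))
    (hwV : ∀ k : ℝ → ℝ, MemLp k 2 volume →
      Tendsto (fun n => ∫ s, T n s * k s) atTop (𝓝 (∫ s, V s * k s)))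
    {f₀ g₀ a b : ℝ} (hf₀ : Tendsto (fun n => f n 0) atTop (𝓝 f₀))
    (hg₀ : Tendsto (fun n => g n 0) atTop (𝓝 g₀))
    (ha : Tendsto (fun n => (∫ s, g n s ^ 2) + (∫ s, Real.sin (f n s) ^ 2)
      + ε * ∫ s, (Real.cosh s * (g n s ^ 2 + Real.sin (f n s) ^ 2)) ^ 2) atTop (𝓝 a))
    (hb : Tendsto (fun n => ∫ s, T n s ^ 2) atTop (𝓝 b)) :
    ∃ F G, Profile F G V ∧ profileEnergy ε F G V ≤ a + ε * b := by
  -- the limit is rebuilt from the weak limit `W` of the second derivatives by integrating twice;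
  -- then `g n` and `f n` converge pointwise to `G` and `F`
  set G : ℝ → ℝ := fun s => g₀ + ∫ t in (0 : ℝ)..s, W t with hG
  set F : ℝ → ℝ := fun s => f₀ + ∫ t in (0 : ℝ)..s, G t with hF
  have hGc : Continuous G := continuous_const.add
    (intervalIntegral.continuous_primitive hW.intervalIntegrable_of_two 0)
  have hFd : ∀ s, HasDerivAt F (G s) s := fun s =>
    (intervalIntegral.integral_hasDerivAt_right (hGc.intervalIntegrable _ _)
      (hGc.stronglyMeasurableAtFilter _ _) hGc.continuousAt).const_add f₀
  have hFc : Continuous F := continuous_iff_continuousAt.2 fun s => (hFd s).continuousAt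
  have hWi : ∀ x y, Tendsto (fun n => ∫ s in x..y, (T n s * (Real.cosh s)⁻¹
      + Real.sin (f n s) * Real.cos (f n s))) atTop (𝓝 (∫ s in x..y, W s)) := fun x y => by
    simpa using tendsto_intervalIntegral_of_weak hwW (q := fun _ => 1) continuous_const (by simp) x y
  have hgG : ∀ s, Tendsto (fun n => g n s) atTop (𝓝 (G s)) := fun s =>
    (hg₀.add (hWi 0 s)).congr fun n => ((h n).eq_add s).symm
  obtain ⟨B, hB⟩ := hg₀.abs.bddAbove_range
  have hgB : ∀ n s, |g n s| ≤ B + (|s| + C) := fun n s => by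
    rw [(h n).eq_add s]
    refine (abs_add_le _ _).trans (add_le_add (hB ⟨n, rfl⟩) ?_)
    simpa using abs_intervalIntegral_le (h n).memLp_rhs (hC n) 0 s
  have hfF : ∀ s, Tendsto (fun n => f n s) atTop (𝓝 (F s)) := fun s => by
    have h1 : Tendsto (fun n => ∫ t in (0 : ℝ)..s, g n t) atTop (𝓝 (∫ t in (0 : ℝ)..s, G t)) := by
      refine intervalIntegral.tendsto_integral_filter_of_dominated_convergence
        (fun t => B + (|t| + C))
        (Eventually.of_forall fun n => (h n).continuous_deriv.aestronglyMeasurable)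
        (Eventually.of_forall fun n => ae_of_all _ fun t _ => hgB n t)
        ((by fun_prop : Continuous fun t : ℝ => B + (|t| + C)).intervalIntegrable _ _)
        (ae_of_all _ fun t _ => hgG t)
    refine (hf₀.add h1).congr fun n => ?_
    rw [intervalIntegral.integral_eq_sub_of_hasDerivAt (fun t _ => (h n).hasDerivAt t)
      ((h n).continuous_deriv.intervalIntegrable _ _)]
    ring
  have hinv : Continuous fun s => (Real.cosh s)⁻¹ :=
    Real.continuous_cosh.inv₀ fun s => (Real.cosh_pos s).ne'
  have hsub : ∀ x y, G y - G x
      = ∫ s in x..y, (V s * (Real.cosh s)⁻¹ + Real.sin (F s) * Real.cos (F s)) := by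
    intro x y
    have e : G y - G x = ∫ s in x..y, W s := by
      rw [hG]
      simp only [add_sub_add_left_eq_sub]
      exact intervalIntegral.integral_interval_sub_left (hW.intervalIntegrable_of_two _ _)
        (hW.intervalIntegrable_of_two _ _)
    rw [e]
    refine tendsto_nhds_unique (hWi x y) ?_
    have h1 := tendsto_intervalIntegral_of_weak hwV hinv (fun s => by
      rw [Real.norm_of_nonneg (by positivity)]
      exact inv_le_one_of_one_le₀ (Real.one_le_cosh s)) x y
    have h2 : Tendsto (fun n => ∫ s in x..y, Real.sin (f n s) * Real.cos (f n s)) atTop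
        (𝓝 (∫ s in x..y, Real.sin (F s) * Real.cos (F s))) := by
      refine intervalIntegral.tendsto_integral_filter_of_dominated_convergence (fun _ => 1)
        (Eventually.of_forall fun n => by
          have := (h n).continuous
          exact (by fun_prop : Continuous _).aestronglyMeasurable)
        (Eventually.of_forall fun n => ae_of_all _ fun t _ => by
          rw [norm_mul]
          exact mul_le_one₀ (Real.abs_sin_le_one _) (norm_nonneg _) (Real.abs_cos_le_one _))
        intervalIntegrable_const (ae_of_all _ fun t _ => ?_)
      exact ((Real.continuous_sin.tendsto _).comp (hfF t)).mul
        ((Real.continuous_cos.tendsto _).comp (hfF t))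
    have hVi : IntervalIntegrable (fun s => V s * (Real.cosh s)⁻¹) volume x y :=
      (hV.intervalIntegrable_of_two x y).mul_continuousOn hinv.continuousOn
    rw [intervalIntegral.integral_add hVi
      ((by fun_prop : Continuous fun s => Real.sin (F s) * Real.cos (F s)).intervalIntegrable _ _)]
    refine (h1.add h2).congr fun n => ?_
    rw [intervalIntegral.integral_add ((h n).memLp_rhs_left.intervalIntegrable_of_two x y)
      ((h n).memLp_sin_mul_cos.intervalIntegrable_of_two x y)]
  -- the boundary values survive since the tail bounds are uniform in `n`
  have hbot : Tendsto F atBot (𝓝 0) := tendsto_zero_of_tail (K := K) fun M hM s hs =>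
    le_of_tendsto' (hfF s).abs fun n => (h n).abs_angle_le (hK n) hM hs
  have htop : Tendsto F atTop (𝓝 (2 * Real.pi)) := by
    have h1 : Tendsto (fun s => 2 * Real.pi - F (-s)) atBot (𝓝 0) :=
      tendsto_zero_of_tail (K := K) fun M hM s hs =>
        le_of_tendsto' ((hfF (-s)).const_sub _).abs fun n => (h n).abs_two_pi_sub_le (hK n) hM hs
    simpa using (h1.comp tendsto_neg_atTop_atBot).const_sub (2 * Real.pi)
  have hint : ∀ n, Integrable (fun s => g n s ^ 2 + Real.sin (f n s) ^ 2
      + ε * (Real.cosh s * (g n s ^ 2 + Real.sin (f n s) ^ 2)) ^ 2) := fun n =>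
    ((h n).memLp_deriv.integrable_sq.add (h n).memLp_sin.integrable_sq).add
      ((h n).memLp_quad.integrable_sq.const_mul ε)
  obtain ⟨hi, hle⟩ := integrable_and_integral_le_of_tendsto hint (fun n s => by positivity)
    (G := fun s => G s ^ 2 + Real.sin (F s) ^ 2
      + ε * (Real.cosh s * (G s ^ 2 + Real.sin (F s) ^ 2)) ^ 2)
    (fun s => by
      have e1 := (hgG s).pow 2
      have e2 := ((Real.continuous_sin.tendsto _).comp (hfF s)).pow 2
      exact (e1.add e2).add ((((e1.add e2).const_mul _).pow 2).const_mul _))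
    (ha.congr fun n => (integral_sq_add_sq_add_sq (h n).memLp_deriv (h n).memLp_sin
      (h n).memLp_quad ε).symm)
  have hco := Real.continuous_cosh
  have mono : ∀ {k : ℝ → ℝ} {c : ℝ}, Continuous k → 0 < c → (∀ s, c * k s ^ 2 ≤ G s ^ 2
      + Real.sin (F s) ^ 2 + ε * (Real.cosh s * (G s ^ 2 + Real.sin (F s) ^ 2)) ^ 2) →
      MemLp k 2 volume := fun {k c} hk hc hle => by
    rw [memLp_two_iff_integrable_sq hk.aestronglyMeasurable]
    refine (hi.const_mul c⁻¹).mono' (by fun_prop : Continuous _).aestronglyMeasurable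
      (Eventually.of_forall fun s => ?_)
    rw [Real.norm_of_nonneg (sq_nonneg _), inv_mul_eq_div, le_div_iff₀ hc, mul_comm]
    exact hle s
  have m1 : MemLp G 2 volume := mono hGc one_pos fun s => by
    rw [one_mul, add_assoc]; exact le_add_of_nonneg_right (by positivity)
  have m2 : MemLp (fun s => Real.sin (F s)) 2 volume := mono (by fun_prop) one_pos fun s => by
    have : 0 ≤ G s ^ 2 + ε * (Real.cosh s * (G s ^ 2 + Real.sin (F s) ^ 2)) ^ 2 := by positivity
    linarith
  have m3 : MemLp (fun s => Real.cosh s * (G s ^ 2 + Real.sin (F s) ^ 2)) 2 volume :=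
    mono (by fun_prop) hε fun s => le_add_of_nonneg_left (by positivity)
  refine ⟨F, G, ⟨hFd, hV, hsub, hbot, htop, m1, m2, m3⟩, ?_⟩
  -- weak lower semicontinuity for `T`, Fatou's lemma for the other terms
  have hVb := integral_sq_le_of_weak (fun n => (h n).memLp_T) hV (hwV V hV) hb
  rw [integral_sq_add_sq_add_sq m1 m2 m3] at hle
  rw [profileEnergy]
  linarith [mul_le_mul_of_nonneg_left hVb hε.le]

open Filter Topology in
/-- The direct method: if there are profiles at all, one of them has least energy. -/
theorem Profile.exists_minimizer {ε : ℝ} (hε : 0 < ε) (hne : ∃ f g T, Profile f g T) :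
    ∃ f g T, Profile f g T ∧
      ∀ f' g' T', Profile f' g' T' → profileEnergy ε f g T ≤ profileEnergy ε f' g' T' := by
  set S : Set ℝ := {e | ∃ f g T, Profile f g T ∧ profileEnergy ε f g T = e} with hS
  have hS0 : S.Nonempty := let ⟨f, g, T, h⟩ := hne; ⟨_, f, g, T, h, rfl⟩
  have nn : ∀ k : ℝ → ℝ, 0 ≤ ∫ s, k s ^ 2 := fun k => integral_nonneg fun s => sq_nonneg _
  have hSb : BddBelow S := ⟨0, by
    rintro _ ⟨f, g, T, h, rfl⟩
    have := mul_nonneg hε.le (nn T)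
    have := mul_nonneg hε.le (nn fun s => Real.cosh s * (g s ^ 2 + Real.sin (f s) ^ 2))
    have := nn g
    have := nn fun s => Real.sin (f s)
    rw [profileEnergy]
    linarith⟩
  obtain ⟨u, hu, hlim, hmem⟩ := exists_seq_tendsto_sInf hS0 hSb
  choose f g T h he using hmem
  set K := u 0
  have huK : ∀ n, profileEnergy ε (f n) (g n) (T n) ≤ K := fun n => by
    rw [he]; exact hu (Nat.zero_le n)
  have bounds : ∀ n, (∫ s, T n s ^ 2) ≤ K / ε ∧ (∫ s, Real.sin (f n s) ^ 2) ≤ K ∧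
      (∫ s, (Real.cosh s * (g n s ^ 2 + Real.sin (f n s) ^ 2)) ^ 2) ≤ K / ε ∧
      (∫ s, g n s ^ 2) + (∫ s, Real.sin (f n s) ^ 2)
      + ε * (∫ s, (Real.cosh s * (g n s ^ 2 + Real.sin (f n s) ^ 2)) ^ 2) ≤ K := fun n => by
    have h0 := huK n
    rw [profileEnergy] at h0
    have h1 := mul_nonneg hε.le (nn (T n))
    have h2 := mul_nonneg hε.le (nn fun s => Real.cosh s * (g n s ^ 2 + Real.sin (f n s) ^ 2))
    have h3 := nn (g n)
    have h4 := nn fun s => Real.sin (f n s)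
    refine ⟨?_, ?_, ?_, ?_⟩
    · rw [le_div_iff₀ hε]; linarith
    · linarith
    · rw [le_div_iff₀ hε]; linarith
    · linarith
  set C := 2 * (K / ε) + 2 * K
  have hC : ∀ n, ∫ s, (T n s * (Real.cosh s)⁻¹ + Real.sin (f n s) * Real.cos (f n s)) ^ 2 ≤ C :=
    fun n => (h n).integral_rhs_sq_le.trans (by
      have := bounds n
      simp only [C]
      linarith [this.1, this.2.1])
  -- the tail bounds, with `M = 1`, control `f n` at `0` and `1`; by the mean value theorem `g n` is
  -- controlled somewhere in between, hence at `0`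
  have bf0 : ∀ n, |f n 0| ≤ 2 + 4 * (K / ε) := fun n => by
    simpa using (h n).abs_angle_le (bounds n).2.2.1 one_pos le_rfl
  have bf1 : ∀ n, |2 * Real.pi - f n 1| ≤ 2 + 4 * (K / ε) := fun n => by
    have h1 := (h n).abs_two_pi_sub_le (bounds n).2.2.1 one_pos (s := -1) (by norm_num)
    have h2 : Real.exp (-1 / 2) ≤ 1 := Real.exp_le_one_iff.2 (by norm_num)
    simp only [neg_neg] at h1
    linarith
  have bg0 : ∀ n, |g n 0| ≤ 2 * (2 + 4 * (K / ε)) + 2 * Real.pi + (1 + C) := fun n => by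
    obtain ⟨c, hc, hgc⟩ := exists_hasDerivAt_eq_slope (f n) (g n) (zero_lt_one' ℝ)
      (h n).continuous.continuousOn fun x _ => (h n).hasDerivAt x
    have h1 := abs_intervalIntegral_le (h n).memLp_rhs (hC n) 0 c
    rw [← (h n).sub_eq, sub_zero, abs_of_pos hc.1, hgc] at h1
    have h0 := abs_le.1 h1
    have h2 := abs_le.1 (bf0 n)
    have h3 := abs_le.1 (bf1 n)
    have hpi := Real.pi_pos
    have := hc.2
    rw [sub_zero, div_one] at h0
    rw [abs_le]
    constructor <;> linarith [h0.1, h0.2, h2.1, h2.2, h3.1, h3.2]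
  obtain ⟨W, φ₁, hφ₁, hW, hwW⟩ := exists_weak_subseq (fun n => (h n).memLp_rhs) hC
  obtain ⟨V, φ₂, hφ₂, hV, hwV⟩ := exists_weak_subseq (fun n => (h (φ₁ n)).memLp_T)
    fun n => (bounds (φ₁ n)).1
  set D := 2 * (2 + 4 * (K / ε)) + 2 * Real.pi + (1 + C) + K + K / ε
  -- the four numbers whose convergence is still needed, collected to extract one subsequence
  set z : ℕ → ℝ × ℝ × ℝ × ℝ := fun n => (f n 0, g n 0, (∫ s, g n s ^ 2)
      + (∫ s, Real.sin (f n s) ^ 2)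
      + ε * (∫ s, (Real.cosh s * (g n s ^ 2 + Real.sin (f n s) ^ 2)) ^ 2), ∫ s, T n s ^ 2) with hz
  have hK0 : 0 ≤ K := (nn fun s => Real.sin (f 0 s)).trans (bounds 0).2.1
  have hKε : 0 ≤ K / ε := by positivity
  have hzb : ∀ n, z n ∈ Metric.closedBall (0 : ℝ × ℝ × ℝ × ℝ) D := fun n => by
    have b := bounds n
    have hpi := Real.pi_pos
    have hC0 : 0 ≤ C := by positivity
    rw [mem_closedBall_zero_iff]
    simp only [hz, Prod.norm_def, sup_le_iff, Real.norm_eq_abs]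
    refine ⟨(bf0 n).trans ?_, (bg0 n).trans ?_, ?_, ?_⟩
    · simp only [D]; linarith
    · simp only [D]; linarith
    · rw [abs_of_nonneg]
      · simp only [D]; linarith [b.2.2.2]
      · have := mul_nonneg hε.le (nn fun s => Real.cosh s * (g n s ^ 2 + Real.sin (f n s) ^ 2))
        have := nn (g n)
        have := nn fun s => Real.sin (f n s)
        linarith
    · rw [abs_of_nonneg (nn (T n))]
      simp only [D]; linarith [b.1]
  obtain ⟨l, -, φ₃, hφ₃, hz3⟩ := tendsto_subseq_of_bounded Metric.isBounded_closedBall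
    fun n => hzb (φ₁ (φ₂ n))
  set θ : ℕ → ℕ := fun n => φ₁ (φ₂ (φ₃ n))
  have hθ : StrictMono θ := hφ₁.comp (hφ₂.comp hφ₃)
  have l1 := hz3.fst_nhds
  have l2 := hz3.snd_nhds.fst_nhds
  have l3 := hz3.snd_nhds.snd_nhds.fst_nhds
  have l4 := hz3.snd_nhds.snd_nhds.snd_nhds
  obtain ⟨F, G, hP, hPE⟩ := Profile.of_tendsto (fun n => h (θ n)) hε
    (fun n => (bounds (θ n)).2.2.1) (fun n => hC (θ n)) hW hV
    (fun k hk => (hwW k hk).comp (hφ₂.comp hφ₃).tendsto_atTop)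
    (fun k hk => (hwV k hk).comp hφ₃.tendsto_atTop) l1 l2 l3 l4
  refine ⟨F, G, V, hP, fun f' g' T' h' => ?_⟩
  have hsum : l.2.2.1 + ε * l.2.2.2 = sInf S := by
    refine tendsto_nhds_unique (l3.add (l4.const_mul ε)) ((hlim.comp hθ.tendsto_atTop).congr ?_)
    intro n
    simp only [Function.comp_apply, hz]
    rw [← he, profileEnergy]
    ring
  rw [hsum] at hPE
  exact hPE.trans (csInf_le hSb ⟨f', g', T', h', rfl⟩)

/-! ### The Euler-Lagrange equation of a minimal profile -/

theorem abs_sin_sub_self_le (x : ℝ) : |Real.sin x - x| ≤ 2 * x ^ 2 := by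
  rcases le_or_gt |x| 1 with h | h
  · have h1 := abs_le.1 (Real.sin_bound h)
    have h2 : |x| ^ 5 ≤ x ^ 2 := by
      rw [← sq_abs x]; exact pow_le_pow_of_le_one (abs_nonneg x) h (by norm_num)
    have h3 : |x ^ 3| ≤ x ^ 2 := by
      rw [abs_pow, ← sq_abs x]; exact pow_le_pow_of_le_one (abs_nonneg x) h (by norm_num)
    have h4 := abs_le.1 h3
    rw [abs_le]
    constructor <;> nlinarith [sq_nonneg x]
  · have h1 := abs_le.1 (Real.abs_sin_le_one x)
    have h2 : |x| ≤ x ^ 2 := by rw [← sq_abs]; nlinarith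
    have h3 := abs_le.1 h2
    have h4 : 1 ≤ x ^ 2 := by rw [← sq_abs]; nlinarith
    rw [abs_le]
    constructor <;> linarith [h1.1, h1.2, h3.1, h3.2]

theorem abs_one_sub_cos_le (x : ℝ) : |1 - Real.cos x| ≤ x ^ 2 := by
  have h1 := Real.one_sub_sq_div_two_le_cos (x := x)
  rw [abs_of_nonneg (by linarith [Real.cos_le_one x])]
  nlinarith [sq_nonneg x]

theorem abs_sin_taylor_le (y x : ℝ) :
    |Real.sin (y + x) - Real.sin y - x * Real.cos y| ≤ 3 * x ^ 2 := by
  have e : Real.sin (y + x) - Real.sin y - x * Real.cos y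
      = Real.cos y * (Real.sin x - x) - Real.sin y * (1 - Real.cos x) := by
    rw [Real.sin_add]; ring
  rw [e]
  calc _ ≤ |Real.cos y * (Real.sin x - x)| + |Real.sin y * (1 - Real.cos x)| := abs_sub _ _
    _ ≤ 1 * (2 * x ^ 2) + 1 * x ^ 2 := by
        rw [abs_mul, abs_mul]
        exact add_le_add (mul_le_mul (Real.abs_cos_le_one y) (abs_sin_sub_self_le x) (abs_nonneg _)
          zero_le_one) (mul_le_mul (Real.abs_sin_le_one y) (abs_one_sub_cos_le x) (abs_nonneg _)
          zero_le_one)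
    _ = _ := by ring

theorem abs_cos_taylor_le (y x : ℝ) :
    |Real.cos (y + x) - Real.cos y + x * Real.sin y| ≤ 3 * x ^ 2 := by
  have e := abs_sin_taylor_le (y + Real.pi / 2) x
  rw [add_right_comm, Real.sin_add_pi_div_two, Real.sin_add_pi_div_two, Real.cos_add_pi_div_two] at e
  simpa using e

open Filter Topology in
/-- Directions `a`, with first and second derivatives `b` and `c`, in which a profile with angle `f` may
be varied within the class of profiles. The last condition is the square integrability of the
linearization of `cosh (f'' - sin f cos f)`. -/
structure Variation (f a b c : ℝ → ℝ) : Prop where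
  hasDerivAt : ∀ s, HasDerivAt a (b s) s
  hasDerivAt_deriv : ∀ s, HasDerivAt b (c s) s
  continuous : Continuous c
  tendsto_atBot : Tendsto a atBot (𝓝 0)
  tendsto_atTop : Tendsto a atTop (𝓝 0)
  memLp : MemLp a 2 volume
  memLp_deriv : MemLp b 2 volume
  memLp_sq : MemLp (fun s => Real.cosh s * a s ^ 2) 2 volume
  memLp_deriv_sq : MemLp (fun s => Real.cosh s * b s ^ 2) 2 volume
  memLp_second : MemLp (fun s => Real.cosh s * (c s - Real.cos (2 * f s) * a s)) 2 volume

/-- The weighted second derivative of the profile `f + t a`, with `c` the second derivative of `a`: as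
`sin x cos x = sin (2 x) / 2`, the difference of the two nonlinear terms is written with double
angles. -/
def variedT (f a c T : ℝ → ℝ) (t s : ℝ) : ℝ :=
  T s + Real.cosh s * (t * c s - (Real.sin (2 * f s + 2 * (t * a s)) - Real.sin (2 * f s)) / 2)

theorem _root_.MeasureTheory.MemLp.of_cosh_mul {k : ℝ → ℝ} (hk : Continuous k)
    (h : MemLp (fun s => Real.cosh s * k s) 2 volume) : MemLp k 2 volume :=
  h.mono hk.aestronglyMeasurable (Filter.Eventually.of_forall fun s => by
    rw [norm_mul, Real.norm_of_nonneg (Real.cosh_pos s).le]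
    exact le_mul_of_one_le_left (norm_nonneg _) (Real.one_le_cosh s))

section

variable {f g T a b c : ℝ → ℝ}

theorem Variation.continuous_fst (hv : Variation f a b c) : Continuous a :=
  continuous_iff_continuousAt.2 fun s => (hv.hasDerivAt s).continuousAt

theorem Variation.continuous_snd (hv : Variation f a b c) : Continuous b :=
  continuous_iff_continuousAt.2 fun s => (hv.hasDerivAt_deriv s).continuousAt

/-- The first order change of the term `cosh (g² + sin² f)` of the bending energy is square
integrable. -/
theorem Variation.memLp_cross (hp : Profile f g T) (hv : Variation f a b c) :
    MemLp (fun s => Real.cosh s * (2 * g s * b s + Real.sin (2 * f s) * a s)) 2 volume := by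
  have h1 := hp.continuous
  have h2 := hp.continuous_deriv
  have h3 := hv.continuous_fst
  have h4 := hv.continuous_snd
  have h5 := Real.continuous_cosh
  refine ((hp.memLp_quad.add hv.memLp_sq).add hv.memLp_deriv_sq).mono'
    (by fun_prop : Continuous _).aestronglyMeasurable (Filter.Eventually.of_forall fun s => ?_)
  simp only [Pi.add_apply]
  rw [norm_mul, Real.norm_of_nonneg (Real.cosh_pos s).le, ← mul_add, ← mul_add]
  refine mul_le_mul_of_nonneg_left ?_ (Real.cosh_pos s).le
  have hc := Real.cos_sq_le_one (f s)
  rw [Real.sin_two_mul, Real.norm_eq_abs, abs_le]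
  constructor <;> nlinarith [sq_nonneg (g s - b s), sq_nonneg (g s + b s),
    sq_nonneg (Real.sin (f s) - Real.cos (f s) * a s),
    sq_nonneg (Real.sin (f s) + Real.cos (f s) * a s),
    mul_le_mul_of_nonneg_right hc (sq_nonneg (a s))]

/-- The Taylor remainder of the first order expansion of `x` at `t`; it is `0` for `t = 0`, where
the division has the junk value that the expansion needs. -/
theorem taylor_remainder_eq {x p q t : ℝ} (h : t = 0 → x = p) :
    p + t • q + t ^ 2 • ((x - p - t * q) / t ^ 2) = x := by
  rcases eq_or_ne t 0 with rfl | ht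
  · simp [h rfl]
  · simp only [smul_eq_mul]
    field_simp
    ring

theorem norm_taylor_remainder_le {y t M : ℝ} (hM : 0 ≤ M) (h : |y| ≤ M * t ^ 2) :
    ‖y / t ^ 2‖ ≤ M := by
  rw [norm_div, Real.norm_of_nonneg (sq_nonneg t)]
  exact div_le_of_le_mul₀ (sq_nonneg t) hM h

/-- The weighted second derivative depends on `t` with a quadratic remainder, square integrable by
`Variation.memLp_sq`. -/
theorem variedT_remainder (t s : ℝ) :
    |variedT f a c T t s - T s - t * (Real.cosh s * (c s - Real.cos (2 * f s) * a s))|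
      ≤ 6 * (Real.cosh s * a s ^ 2) * t ^ 2 := by
  have e : variedT f a c T t s - T s - t * (Real.cosh s * (c s - Real.cos (2 * f s) * a s))
      = -(Real.cosh s / 2 * (Real.sin (2 * f s + 2 * (t * a s)) - Real.sin (2 * f s)
        - 2 * (t * a s) * Real.cos (2 * f s))) := by
    rw [variedT]; ring
  have hc := Real.cosh_pos s
  rw [e, abs_neg, abs_mul, abs_of_nonneg (by positivity)]
  calc _ ≤ Real.cosh s / 2 * (3 * (2 * (t * a s)) ^ 2) :=
        mul_le_mul_of_nonneg_left (abs_sin_taylor_le _ _) (by positivity)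
    _ = _ := by ring

theorem sin_sq_taylor (y x : ℝ) :
    |Real.sin (y + x) ^ 2 - Real.sin y ^ 2 - x * Real.sin (2 * y)| ≤ 6 * x ^ 2 := by
  have e : Real.sin (y + x) ^ 2 - Real.sin y ^ 2 - x * Real.sin (2 * y)
      = -((Real.cos (2 * y + 2 * x) - Real.cos (2 * y) + 2 * x * Real.sin (2 * y)) / 2) := by
    rw [Real.sin_sq_eq_half_sub, Real.sin_sq_eq_half_sub, mul_add]; ring
  have h := abs_cos_taylor_le (2 * y) (2 * x)
  rw [e, abs_neg, abs_div, abs_two]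
  linarith

/-- The second term of the bending energy depends on `t` with a quadratic remainder, square
integrable by `Variation.memLp_sq` and `Variation.memLp_deriv_sq`. -/
theorem cosh_mul_quad_remainder (t s : ℝ) :
    |Real.cosh s * ((g s + t * b s) ^ 2 + Real.sin (f s + t * a s) ^ 2)
      - Real.cosh s * (g s ^ 2 + Real.sin (f s) ^ 2)
      - t * (Real.cosh s * (2 * g s * b s + Real.sin (2 * f s) * a s))|
      ≤ (Real.cosh s * b s ^ 2 + 6 * (Real.cosh s * a s ^ 2)) * t ^ 2 := by
  have e : Real.cosh s * ((g s + t * b s) ^ 2 + Real.sin (f s + t * a s) ^ 2)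
      - Real.cosh s * (g s ^ 2 + Real.sin (f s) ^ 2)
      - t * (Real.cosh s * (2 * g s * b s + Real.sin (2 * f s) * a s))
      = Real.cosh s * (t ^ 2 * b s ^ 2 + (Real.sin (f s + t * a s) ^ 2 - Real.sin (f s) ^ 2
        - (t * a s) * Real.sin (2 * f s))) := by ring
  have hc := Real.cosh_pos s
  rw [e, abs_mul, abs_of_pos hc]
  calc _ ≤ Real.cosh s * (t ^ 2 * b s ^ 2 + 6 * (t * a s) ^ 2) := by
        refine mul_le_mul_of_nonneg_left ((abs_add_le _ _).trans (add_le_add ?_ (sin_sq_taylor _ _)))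
          hc.le
        rw [abs_of_nonneg (by positivity)]
    _ = _ := by ring

theorem Variation.continuous_variedT_sub (hp : Profile f g T) (hv : Variation f a b c) (t : ℝ) :
    Continuous fun s => variedT f a c T t s - T s := by
  have h1 := hp.continuous
  have h3 := hv.continuous_fst
  have h4 := hv.continuous
  have h5 := Real.continuous_cosh
  simp only [variedT, add_sub_cancel_left]
  fun_prop

/-- Varying a profile gives profiles. -/
theorem Profile.vary (hp : Profile f g T) (hv : Variation f a b c) (t : ℝ) :
    Profile (fun s => f s + t * a s) (fun s => g s + t * b s) (variedT f a c T t) := by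
  have h1 := hp.continuous
  have h2 := hp.continuous_deriv
  have h3 := hv.continuous_fst
  have h4 := hv.continuous_snd
  have h5 := Real.continuous_cosh
  have hcont := hv.continuous
  have hT : AEStronglyMeasurable (variedT f a c T t) volume := by
    have := (hv.continuous_variedT_sub hp t).aestronglyMeasurable.add hp.memLp_T.1 (μ := volume)
    refine this.congr (Filter.Eventually.of_forall fun s => by simp)
  have hsq : MemLp (fun s => a s ^ 2) 2 volume := hv.memLp_sq.of_cosh_mul (by fun_prop)
  refine ⟨fun s => (hp.hasDerivAt s).add ((hv.hasDerivAt s).const_mul t), ?_, ?_, ?_, ?_, ?_, ?_, ?_⟩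
  · refine ((hp.memLp_T.norm.add (hv.memLp_second.norm.const_mul |t|)).add
      (hv.memLp_sq.const_mul (6 * t ^ 2))).mono' hT (Filter.Eventually.of_forall fun s => ?_)
    have h := abs_le.1 (variedT_remainder (f := f) (T := T) (a := a) (c := c) t s)
    have l1 := neg_abs_le (T s)
    have l2 := le_abs_self (T s)
    have l3 := neg_abs_le (t * (Real.cosh s * (c s - Real.cos (2 * f s) * a s)))
    have l4 := le_abs_self (t * (Real.cosh s * (c s - Real.cos (2 * f s) * a s)))
    rw [abs_mul t] at l3 l4
    simp only [Pi.add_apply, Real.norm_eq_abs]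
    rw [_root_.abs_le]
    constructor <;> nlinarith
  · intro x y
    have e : ∀ s, variedT f a c T t s * (Real.cosh s)⁻¹
        + Real.sin (f s + t * a s) * Real.cos (f s + t * a s)
        = (T s * (Real.cosh s)⁻¹ + Real.sin (f s) * Real.cos (f s)) + t * c s := fun s => by
      have e1 : Real.sin (2 * f s + 2 * (t * a s))
          = 2 * Real.sin (f s + t * a s) * Real.cos (f s + t * a s) := by
        rw [← Real.sin_two_mul]; ring_nf
      rw [variedT, e1, Real.sin_two_mul]
      have := (Real.cosh_pos s).ne'
      field_simp
      ring
    simp only [e]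
    rw [intervalIntegral.integral_add (hp.memLp_rhs.intervalIntegrable_of_two x y)
      ((hcont.const_mul t).intervalIntegrable _ _), ← hp.sub_eq, intervalIntegral.integral_const_mul,
      intervalIntegral.integral_eq_sub_of_hasDerivAt (fun s _ => hv.hasDerivAt_deriv s)
        (hcont.intervalIntegrable _ _)]
    ring
  · simpa using hp.tendsto_atBot.add (hv.tendsto_atBot.const_mul t)
  · simpa using hp.tendsto_atTop.add (hv.tendsto_atTop.const_mul t)
  · exact hp.memLp_deriv.add (hv.memLp_deriv.const_mul t)
  · refine (hp.memLp_sin.norm.add (hv.memLp.norm.const_mul |t|)).mono'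
      (by fun_prop : Continuous _).aestronglyMeasurable (Filter.Eventually.of_forall fun s => ?_)
    simp only [Pi.add_apply]
    rw [Real.sin_add]
    refine (norm_add_le _ _).trans (add_le_add ?_ ?_)
    · rw [norm_mul]; exact mul_le_of_le_one_right (norm_nonneg _) (Real.abs_cos_le_one _)
    · rw [Real.norm_eq_abs, Real.norm_eq_abs]
      rw [abs_mul (Real.cos _), ← abs_mul t]
      exact (mul_le_of_le_one_left (abs_nonneg _) (Real.abs_cos_le_one _)).trans
        Real.abs_sin_le_abs
  · refine ((hp.memLp_quad.norm.add ((hv.memLp_cross hp).norm.const_mul |t|)).add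
      ((hv.memLp_deriv_sq.add (hv.memLp_sq.const_mul 6)).const_mul (t ^ 2))).mono'
      (by fun_prop : Continuous _).aestronglyMeasurable (Filter.Eventually.of_forall fun s => ?_)
    have h := abs_le.1 (cosh_mul_quad_remainder (f := f) (g := g) (a := a) (b := b) t s)
    have l1 := neg_abs_le (Real.cosh s * (g s ^ 2 + Real.sin (f s) ^ 2))
    have l2 := le_abs_self (Real.cosh s * (g s ^ 2 + Real.sin (f s) ^ 2))
    have l3 := neg_abs_le (t * (Real.cosh s * (2 * g s * b s + Real.sin (2 * f s) * a s)))
    have l4 := le_abs_self (t * (Real.cosh s * (2 * g s * b s + Real.sin (2 * f s) * a s)))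
    rw [abs_mul t] at l3 l4
    simp only [Pi.add_apply, Real.norm_eq_abs]
    rw [_root_.abs_le]
    constructor <;> nlinarith

/-- The first variation of the profile energy. -/
theorem Profile.hasDerivAt_energy (hp : Profile f g T) (hv : Variation f a b c) (ε : ℝ) :
    HasDerivAt (fun t => profileEnergy ε (fun s => f s + t * a s) (fun s => g s + t * b s)
        (variedT f a c T t))
      (2 * ((∫ s, b s * g s) + (∫ s, (a s * Real.cos (f s)) * Real.sin (f s))
        + ε * (∫ s, (Real.cosh s * (c s - Real.cos (2 * f s) * a s)) * T s)
        + ε * ∫ s, (Real.cosh s * (2 * g s * b s + Real.sin (2 * f s) * a s))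
            * (Real.cosh s * (g s ^ 2 + Real.sin (f s) ^ 2)))) 0 := by
  have h1 := hp.continuous
  have h2 := hp.continuous_deriv
  have h3 := hv.continuous_fst
  have h4 := hv.continuous_snd
  have h5 := Real.continuous_cosh
  have hcont := hv.continuous
  have hsq : MemLp (fun s => a s ^ 2) 2 volume := hv.memLp_sq.of_cosh_mul (by fun_prop)
  have hac : MemLp (fun s => a s * Real.cos (f s)) 2 volume :=
    hv.memLp.mono (by fun_prop : Continuous _).aestronglyMeasurable
      (Filter.Eventually.of_forall fun s => by
        rw [norm_mul]; exact mul_le_of_le_one_right (norm_nonneg _) (Real.abs_cos_le_one _))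
  have d1 := hasDerivAt_integral_norm_sq (c := fun _ _ => (0 : ℝ)) (M := fun _ => 0) one_pos
    hp.memLp_deriv hv.memLp_deriv MemLp.zero' (fun t _ => aestronglyMeasurable_const)
    (fun t _ x => by simp)
  have d2 := hasDerivAt_integral_norm_sq (c := fun t s => (Real.sin (f s + t * a s) - Real.sin (f s)
      - t * (a s * Real.cos (f s))) / t ^ 2) one_pos
    hp.memLp_sin hac (hsq.const_mul 3) (fun t _ => by
      simp only [div_eq_mul_inv]
      exact (by fun_prop : Continuous _).aestronglyMeasurable) (fun t _ s =>
      norm_taylor_remainder_le (by positivity) (by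
        have := abs_sin_taylor_le (f s) (t * a s)
        rw [← mul_assoc t]
        exact this.trans_eq (by ring)))
  have d3 := hasDerivAt_integral_norm_sq (c := fun t s => (variedT f a c T t s - T s
      - t * (Real.cosh s * (c s - Real.cos (2 * f s) * a s))) / t ^ 2) one_pos
    hp.memLp_T hv.memLp_second (hv.memLp_sq.const_mul 6) (fun t _ => by
      have := hv.continuous_variedT_sub hp t
      simp only [div_eq_mul_inv]
      exact (by fun_prop : Continuous _).aestronglyMeasurable) (fun t _ s =>
      norm_taylor_remainder_le (by positivity) (variedT_remainder t s))
  have d4 := hasDerivAt_integral_norm_sq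
    (c := fun t s => (Real.cosh s * ((g s + t * b s) ^ 2 + Real.sin (f s + t * a s) ^ 2)
      - Real.cosh s * (g s ^ 2 + Real.sin (f s) ^ 2)
      - t * (Real.cosh s * (2 * g s * b s + Real.sin (2 * f s) * a s))) / t ^ 2) one_pos
    hp.memLp_quad (hv.memLp_cross hp) (hv.memLp_deriv_sq.add (hv.memLp_sq.const_mul 6))
    (fun t _ => by
      simp only [div_eq_mul_inv]
      exact (by fun_prop : Continuous _).aestronglyMeasurable) (fun t _ s =>
      norm_taylor_remainder_le (by
        have := Real.cosh_pos s
        simp only [Pi.add_apply]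
        positivity) (cosh_mul_quad_remainder t s))
  have d := ((d1.add d2).add (d3.const_mul ε)).add (d4.const_mul ε)
  refine (d.congr_of_eventuallyEq (Filter.Eventually.of_forall fun t => ?_)).congr_deriv ?_
  · simp only [profileEnergy, Pi.add_apply]
    congr 1
    · congr 1
      · congr 1
        · exact integral_congr_ae (Filter.Eventually.of_forall fun s => by simp)
        · refine integral_congr_ae (Filter.Eventually.of_forall fun s => ?_)
          simp only
          rw [taylor_remainder_eq (by rintro rfl; simp), Real.norm_eq_abs, sq_abs]
      · congr 1
        refine integral_congr_ae (Filter.Eventually.of_forall fun s => ?_)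
        simp only
        rw [taylor_remainder_eq (by rintro rfl; simp [variedT]), Real.norm_eq_abs, sq_abs]
    · congr 1
      refine integral_congr_ae (Filter.Eventually.of_forall fun s => ?_)
      simp only
      rw [taylor_remainder_eq (by rintro rfl; simp), Real.norm_eq_abs, sq_abs]
  · simp only [RCLike.inner_apply, conj_trivial]
    ring

/-- The weak Euler-Lagrange equation of a profile of least energy. -/
theorem Profile.euler_lagrange {ε : ℝ} (hp : Profile f g T)
    (hmin : ∀ f' g' T', Profile f' g' T' → profileEnergy ε f g T ≤ profileEnergy ε f' g' T')
    (hv : Variation f a b c) :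
    (∫ s, b s * g s) + (∫ s, (a s * Real.cos (f s)) * Real.sin (f s))
        + ε * (∫ s, (Real.cosh s * (c s - Real.cos (2 * f s) * a s)) * T s)
        + ε * (∫ s, (Real.cosh s * (2 * g s * b s + Real.sin (2 * f s) * a s))
            * (Real.cosh s * (g s ^ 2 + Real.sin (f s) ^ 2))) = 0 := by
  have hloc : IsLocalMin (fun t => profileEnergy ε (fun s => f s + t * a s)
      (fun s => g s + t * b s) (variedT f a c T t)) 0 := by
    refine Filter.Eventually.of_forall fun t => ?_
    have e : variedT f a c T 0 = T := by funext s; simp [variedT]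
    simp only [zero_mul, add_zero, e]
    exact hmin _ _ _ (hp.vary hv t)
  have := hloc.hasDerivAt_eq_zero (hp.hasDerivAt_energy hv ε)
  linarith

end

/-! ### Regularity of minimal profiles -/

section

variable {α : Type*} [MeasurableSpace α] {μ : Measure α} {f₁ f₂ f₃ f₄ : α → ℝ}

theorem integral_add_three (h₁ : Integrable f₁ μ) (h₂ : Integrable f₂ μ) (h₃ : Integrable f₃ μ) :
    ∫ s, (f₁ s + f₂ s + f₃ s) ∂μ = (∫ s, f₁ s ∂μ) + (∫ s, f₂ s ∂μ) + ∫ s, f₃ s ∂μ := by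
  rw [← integral_add h₁ h₂]
  exact integral_add (h₁.add h₂) h₃

theorem integral_add_four (h₁ : Integrable f₁ μ) (h₂ : Integrable f₂ μ) (h₃ : Integrable f₃ μ)
    (h₄ : Integrable f₄ μ) : ∫ s, (f₁ s + f₂ s + f₃ s + f₄ s) ∂μ
      = (∫ s, f₁ s ∂μ) + (∫ s, f₂ s ∂μ) + (∫ s, f₃ s ∂μ) + ∫ s, f₄ s ∂μ := by
  rw [← integral_add_three h₁ h₂ h₃]
  exact integral_add ((h₁.add h₂).add h₃) h₄

end

theorem HasCompactSupport.exists_support_subset_Ioo {χ : ℝ → ℝ} (h : HasCompactSupport χ) :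
    ∃ R : ℝ, 0 < R ∧ ∀ s, s ∉ Set.Ioo (-R) R → χ s = 0 := by
  obtain ⟨R, hR0, hR⟩ := h.isCompact.isBounded.subset_ball_lt 0 (0 : ℝ)
  refine ⟨R, hR0, fun s hs => image_eq_zero_of_notMem_tsupport fun h' => hs ?_⟩
  have := hR h'
  rwa [Real.ball_eq_Ioo, zero_sub, zero_add] at this

theorem integral_eq_intervalIntegral_of_Ioo {χ : ℝ → ℝ} {R : ℝ}
    (h : ∀ s, s ∉ Set.Ioo (-R) R → χ s = 0) : ∫ s, χ s = ∫ s in (-R)..R, χ s := by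
  rw [intervalIntegral.integral_eq_integral_of_support_subset]
  intro s hs
  by_contra h'
  exact hs (h s fun h'' => h' ⟨h''.1, h''.2.le⟩)

/-- A test function of mean zero is the derivative of a test function. -/
theorem exists_testFunction_primitive {χ : ℝ → ℝ} (h : ContDiff ℝ ∞ χ) (hs : HasCompactSupport χ)
    (h0 : ∫ s, χ s = 0) :
    ∃ Φ : ℝ → ℝ, ContDiff ℝ ∞ Φ ∧ HasCompactSupport Φ ∧ ∀ s, HasDerivAt Φ (χ s) s := by
  obtain ⟨R, hR0, hR⟩ := HasCompactSupport.exists_support_subset_Ioo hs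
  have hd : ∀ s, HasDerivAt (fun s => ∫ t in (-R)..s, χ t) (χ s) s := fun s =>
    intervalIntegral.integral_hasDerivAt_right (h.continuous.intervalIntegrable _ _)
      (h.continuous.stronglyMeasurableAtFilter _ _) h.continuous.continuousAt
  have hzero : ∀ x y, (∀ s ∈ Set.uIcc x y, χ s = 0) → ∫ t in x..y, χ t = 0 := fun x y hxy => by
    rw [intervalIntegral.integral_congr (g := fun _ => 0) hxy]; simp
  refine ⟨fun s => ∫ t in (-R)..s, χ t, ?_, ?_, hd⟩
  · rw [contDiff_infty_iff_deriv]
    refine ⟨fun s => (hd s).differentiableAt, ?_⟩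
    have : deriv (fun s => ∫ t in (-R)..s, χ t) = χ := funext fun s => (hd s).deriv
    rwa [this]
  · refine HasCompactSupport.intro (isCompact_Icc (a := -R) (b := R)) fun s hs => ?_
    rcases lt_or_ge s (-R) with h1 | h1
    · refine hzero _ _ fun t ht => hR t fun h' => ?_
      rw [Set.uIcc_of_ge h1.le] at ht
      linarith [ht.2, h'.1]
    · have h2 : R < s := not_le.1 fun h2 => hs ⟨h1, h2⟩
      have e := intervalIntegral.integral_add_adjacent_intervals
        (h.continuous.intervalIntegrable (μ := volume) (-R) R)
        (h.continuous.intervalIntegrable (μ := volume) R s)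
      rw [← integral_eq_intervalIntegral_of_Ioo hR, h0, zero_add] at e
      change ∫ t in (-R)..s, χ t = 0
      rw [← e]
      refine hzero _ _ fun t ht => hR t fun h' => ?_
      rw [Set.uIcc_of_le h2.le] at ht
      linarith [ht.1, h'.2]

theorem exists_testFunction_integral_one :
    ∃ χ : ℝ → ℝ, ContDiff ℝ ∞ χ ∧ HasCompactSupport χ ∧ ∫ s, χ s = 1 := by
  let φ : ContDiffBump (0 : ℝ) := default
  exact ⟨φ.normed volume, φ.contDiff_normed, φ.hasCompactSupport_normed, φ.integral_normed⟩

theorem integrable_mul_of_hasCompactSupport {χ H : ℝ → ℝ} (h : Continuous χ)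
    (hs : HasCompactSupport χ) (hH : LocallyIntegrable H volume) :
    Integrable fun s => χ s * H s :=
  hH.integrable_smul_left_of_hasCompactSupport h hs

theorem _root_.HasCompactSupport.of_hasDerivAt {χ χ' : ℝ → ℝ} (hs : HasCompactSupport χ)
    (h : ∀ s, HasDerivAt χ (χ' s) s) : HasCompactSupport χ' := by
  have : χ' = deriv χ := funext fun s => (h s).deriv.symm
  rw [this]
  exact hs.deriv

theorem _root_.ContDiff.of_hasDerivAt {χ χ' : ℝ → ℝ} (hs : ContDiff ℝ ∞ χ)
    (h : ∀ s, HasDerivAt χ (χ' s) s) : ContDiff ℝ ∞ χ' := by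
  have : χ' = deriv χ := funext fun s => (h s).deriv.symm
  rw [this]
  exact (contDiff_infty_iff_deriv.1 hs).2

/-- The lemma of du Bois-Reymond. -/
theorem ae_eq_const_of_integral_deriv_mul_eq_zero {H : ℝ → ℝ} (hH : LocallyIntegrable H volume)
    (h : ∀ ζ ζ' : ℝ → ℝ, ContDiff ℝ ∞ ζ → HasCompactSupport ζ → (∀ s, HasDerivAt ζ (ζ' s) s) →
      ∫ s, ζ' s * H s = 0) : ∃ k : ℝ, ∀ᵐ s, H s = k := by
  obtain ⟨χ, hχ, hχs, hχ1⟩ := exists_testFunction_integral_one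
  refine ⟨∫ s, χ s * H s, ?_⟩
  set k := ∫ s, χ s * H s with hk
  have key := ae_eq_zero_of_integral_contDiff_smul_eq_zero (μ := volume) (f := fun s => H s - k)
    (hH.sub (locallyIntegrable_const k)) fun η hη hηs => ?_
  · filter_upwards [key] with s hs
    linarith
  · set m := ∫ s, η s with hm
    have hηi := hη.continuous.integrable_of_hasCompactSupport (μ := volume) hηs
    have hχi := hχ.continuous.integrable_of_hasCompactSupport (μ := volume) hχs
    obtain ⟨Φ, hΦ, hΦs, hΦd⟩ := exists_testFunction_primitive (χ := fun s => η s - m * χ s)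
      (hη.sub (contDiff_const.mul hχ)) (hηs.sub (hχs.mul_left (f := fun _ => m))) (by
        rw [integral_sub hηi (hχi.const_mul m), integral_const_mul, hχ1, ← hm]; ring)
    have h1 := h Φ _ hΦ hΦs hΦd
    have i1 := integrable_mul_of_hasCompactSupport hη.continuous hηs hH
    have i2 := integrable_mul_of_hasCompactSupport hχ.continuous hχs hH
    have e : ∀ s, (η s - m * χ s) * H s = η s * H s - m * (χ s * H s) := fun s => by ring
    simp only [e] at h1
    rw [integral_sub i1 (i2.const_mul m), integral_const_mul, ← hk] at h1
    simp only [smul_eq_mul, mul_sub]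
    rw [integral_sub i1 (hηi.mul_const k), integral_mul_const, ← hm]
    exact h1

/-- The second order version of the lemma of du Bois-Reymond. -/
theorem ae_eq_affine_of_integral_deriv_deriv_mul_eq_zero {H : ℝ → ℝ}
    (hH : LocallyIntegrable H volume)
    (h : ∀ ζ ζ' ζ'' : ℝ → ℝ, ContDiff ℝ ∞ ζ → HasCompactSupport ζ → (∀ s, HasDerivAt ζ (ζ' s) s) →
      (∀ s, HasDerivAt ζ' (ζ'' s) s) → ∫ s, ζ'' s * H s = 0) :
    ∃ k l : ℝ, ∀ᵐ s, H s = k * s + l := by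
  obtain ⟨χ, hχ, hχs, hχ1⟩ := exists_testFunction_integral_one
  have hχd : ∀ s, HasDerivAt χ (deriv χ s) s := fun s =>
    ((contDiff_infty_iff_deriv.1 hχ).1 s).hasDerivAt
  set k := ∫ s, deriv χ s * H s with hk
  have hlin : LocallyIntegrable (fun s : ℝ => k * s) volume :=
    (by fun_prop : Continuous fun s : ℝ => k * s).locallyIntegrable
  have key := ae_eq_const_of_integral_deriv_mul_eq_zero (hH.add hlin) fun η η' hη hηs hηd => ?_
  · obtain ⟨l, hl⟩ := key
    refine ⟨-k, l, ?_⟩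
    filter_upwards [hl] with s hs
    simp only [Pi.add_apply] at hs
    linarith
  · set m := ∫ s, η s with hm
    have hη' := hη.of_hasDerivAt hηd
    have hηs' := hηs.of_hasDerivAt hηd
    have hχ' := hχ.of_hasDerivAt hχd
    have hχs' := hχs.of_hasDerivAt hχd
    have hηi := hη.continuous.integrable_of_hasCompactSupport (μ := volume) hηs
    have hχi := hχ.continuous.integrable_of_hasCompactSupport (μ := volume) hχs
    obtain ⟨Φ, hΦ, hΦs, hΦd⟩ := exists_testFunction_primitive (χ := fun s => η s - m * χ s)
      (hη.sub (contDiff_const.mul hχ)) (hηs.sub (hχs.mul_left (f := fun _ => m))) (by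
        rw [integral_sub hηi (hχi.const_mul m), integral_const_mul, hχ1, ← hm]; ring)
    have h1 := h Φ _ _ hΦ hΦs hΦd fun s => (hηd s).sub ((hχd s).const_mul m)
    have i1 := integrable_mul_of_hasCompactSupport hη'.continuous hηs' hH
    have i2 := integrable_mul_of_hasCompactSupport hχ'.continuous hχs' hH
    have i3 := integrable_mul_of_hasCompactSupport hη'.continuous hηs' hlin
    have e : ∀ s, (η' s - m * deriv χ s) * H s = η' s * H s - m * (deriv χ s * H s) :=
      fun s => by ring
    simp only [e] at h1
    rw [integral_sub i1 (i2.const_mul m), integral_const_mul, ← hk] at h1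
    simp only [Pi.add_apply, mul_add]
    rw [integral_add i1 i3]
    have i4 : Integrable fun s => η' s * s := integrable_mul_of_hasCompactSupport hη'.continuous
      hηs' continuous_id.locallyIntegrable
    have i5 : Integrable fun s => η s * s := integrable_mul_of_hasCompactSupport hη.continuous
      hηs continuous_id.locallyIntegrable
    have h2 : ∫ s, (η' s * s + η s * 1) = 0 :=
      integral_eq_zero_of_hasDerivAt_of_integrable (fun s => (hηd s).mul (hasDerivAt_id s))
        (i4.add (by simpa using hηi)) i5
    simp only [mul_one] at h2
    rw [integral_add i4 hηi, ← hm] at h2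
    have e3 : ∫ s, η' s * (k * s) = k * ∫ s, η' s * s := by
      rw [← integral_const_mul]; congr 1; funext s; ring
    rw [e3]
    linear_combination h1 + k * h2

/-- Integration by parts against the primitive of a locally integrable function. -/
theorem integral_mul_eq_neg_integral_deriv_mul_primitive {a b Q : ℝ → ℝ}
    (ha : ∀ s, HasDerivAt a (b s) s) (hb : Continuous b) (hs : HasCompactSupport a)
    (hQ : LocallyIntegrable Q volume) :
    ∫ s, a s * Q s = -∫ s, b s * ∫ t in (0 : ℝ)..s, Q t := by
  obtain ⟨R, hR0, hR⟩ := HasCompactSupport.exists_support_subset_Ioo hs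
  obtain ⟨R', hR0', hR'⟩ := HasCompactSupport.exists_support_subset_Ioo (hs.of_hasDerivAt ha)
  set r := max R R' with hr
  have e1 : ∀ s, s ∉ Set.Ioo (-r) r → a s = 0 := fun s hs' => hR s fun h' =>
    hs' ⟨by linarith [h'.1, le_max_left R R'], h'.2.trans_le (le_max_left _ _)⟩
  have e2 : ∀ s, s ∉ Set.Ioo (-r) r → b s = 0 := fun s hs' => hR' s fun h' =>
    hs' ⟨by linarith [h'.1, le_max_right R R'], h'.2.trans_le (le_max_right _ _)⟩
  have hr0 : 0 ≤ r := hR0.le.trans (le_max_left _ _)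
  rw [integral_eq_intervalIntegral_of_Ioo (R := r) fun s hs' => by rw [e1 s hs', zero_mul],
    integral_eq_intervalIntegral_of_Ioo (R := r) fun s hs' => by rw [e2 s hs', zero_mul]]
  have hi : IntervalIntegrable Q volume (-r) r :=
    (hQ.integrableOn_isCompact isCompact_uIcc).intervalIntegrable
  have ac1 := hi.absolutelyContinuousOnInterval_intervalIntegral (c := 0)
    (by rw [Set.uIcc_of_le (by linarith)]; exact ⟨by linarith, hr0⟩)
  have hda : deriv a = b := funext fun s => (ha s).deriv
  have ac2 : AbsolutelyContinuousOnInterval a (-r) r :=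
    ((contDiff_one_iff_deriv.2 ⟨fun s => (ha s).differentiableAt, hda ▸ hb⟩).contDiffOn
      ).absolutelyContinuousOnInterval
  have key := ac2.integral_mul_deriv_eq_deriv_mul ac1
  rw [e1 r (by simp), e1 (-r) (by simp), hda] at key
  have e3 : ∫ s in (-r)..r, a s * deriv (fun x => ∫ v in (0 : ℝ)..x, Q v) s
      = ∫ s in (-r)..r, a s * Q s := by
    refine intervalIntegral.integral_congr_ae ?_
    filter_upwards [LocallyIntegrable.ae_hasDerivAt_integral hQ] with s hs' _
    rw [(hs' 0).deriv]
  rw [e3] at key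
  rw [key]
  ring

theorem tendsto_of_hasCompactSupport {a : ℝ → ℝ} (hs : HasCompactSupport a) {l : Filter ℝ}
    (hl : l ≤ Filter.cocompact ℝ) : Filter.Tendsto a l (nhds 0) :=
  tendsto_const_nhds.congr' <| hl <| Filter.mem_of_superset hs.isCompact.compl_mem_cocompact
    fun _ hx => (image_eq_zero_of_notMem_tsupport hx).symm

/-- Test functions are admissible directions for every profile. -/
theorem Variation.of_hasCompactSupport {f a b c : ℝ → ℝ} (hf : Continuous f) (h : ContDiff ℝ ∞ a)
    (hs : HasCompactSupport a) (ha : ∀ s, HasDerivAt a (b s) s) (hb : ∀ s, HasDerivAt b (c s) s) :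
    Variation f a b c := by
  have hbs := hs.of_hasDerivAt ha
  have hcs := hbs.of_hasDerivAt hb
  have hbc := h.of_hasDerivAt ha
  have hcc := hbc.of_hasDerivAt hb
  have h1 := h.continuous
  have h2 := hbc.continuous
  have h3 := hcc.continuous
  have h4 := Real.continuous_cosh
  refine ⟨ha, hb, h3, tendsto_of_hasCompactSupport hs atBot_le_cocompact,
    tendsto_of_hasCompactSupport hs atTop_le_cocompact, h1.memLp_of_hasCompactSupport hs,
    h2.memLp_of_hasCompactSupport hbs, ?_, ?_, ?_⟩
  · exact (by fun_prop : Continuous _).memLp_of_hasCompactSupport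
      (HasCompactSupport.mul_left (by simp only [sq]; exact hs.mul_left))
  · exact (by fun_prop : Continuous _).memLp_of_hasCompactSupport
      (HasCompactSupport.mul_left (by simp only [sq]; exact hbs.mul_left))
  · exact (by fun_prop : Continuous _).memLp_of_hasCompactSupport
      (HasCompactSupport.mul_left (hcs.sub hs.mul_left))

theorem Profile.congr_T {f g T T' : ℝ → ℝ} (hp : Profile f g T) (h : T =ᵐ[volume] T') :
    Profile f g T' := by
  refine ⟨hp.hasDerivAt, hp.memLp_T.ae_eq h, fun x y => ?_, hp.tendsto_atBot, hp.tendsto_atTop,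
    hp.memLp_deriv, hp.memLp_sin, hp.memLp_quad⟩
  rw [hp.sub_eq]
  refine intervalIntegral.integral_congr_ae ?_
  filter_upwards [h] with s hs _
  rw [hs]

/-- The Euler-Lagrange equation determines `ε cosh T` up to an affine function as a continuous
function, so minimal profiles are twice continuously differentiable. -/
theorem Profile.exists_continuous {f g T : ℝ → ℝ} {ε : ℝ} (hε : 0 < ε) (hp : Profile f g T)
    (hmin : ∀ f' g' T', Profile f' g' T' → profileEnergy ε f g T ≤ profileEnergy ε f' g' T') :
    ∃ T', Continuous T' ∧ Profile f g T' ∧ profileEnergy ε f g T' = profileEnergy ε f g T := by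
  have hf := hp.continuous
  have hg := hp.continuous_deriv
  have hco := Real.continuous_cosh
  have hT : LocallyIntegrable T volume := hp.memLp_T.locallyIntegrable one_le_two
  -- in terms of `F`, `P` and `Q` the Euler-Lagrange equation is `F'' - P' + Q = 0` in the sense of
  -- distributions, that is, `(F - P₁)'' = 0` with `P₁' = P - ∫ Q`
  set F : ℝ → ℝ := fun s => ε * Real.cosh s * T s with hF
  have hFl : LocallyIntegrable F volume := hT.continuous_mul (by fun_prop)
  set P : ℝ → ℝ := fun s => g s
    + ε * (2 * Real.cosh s ^ 2 * (g s ^ 2 + Real.sin (f s) ^ 2) * g s) with hP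
  set q : ℝ → ℝ := fun s => Real.cos (f s) * Real.sin (f s)
    + ε * (Real.cosh s ^ 2 * (g s ^ 2 + Real.sin (f s) ^ 2) * Real.sin (2 * f s)) with hq
  have hPc : Continuous P := by fun_prop
  have hqc : Continuous q := by fun_prop
  set Q : ℝ → ℝ := fun s => q s - Real.cos (2 * f s) * F s with hQ
  have hQl : LocallyIntegrable Q volume :=
    hqc.locallyIntegrable.sub (hFl.continuous_mul (by fun_prop))
  have prim : ∀ {k : ℝ → ℝ}, LocallyIntegrable k volume →
      Continuous fun s => ∫ t in (0 : ℝ)..s, k t := fun hk =>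
    intervalIntegral.continuous_primitive
      (fun x y => (hk.integrableOn_isCompact isCompact_uIcc).intervalIntegrable) 0
  set Q₁ : ℝ → ℝ := fun s => ∫ t in (0 : ℝ)..s, Q t with hQ₁
  have hQ₁c : Continuous Q₁ := prim hQl
  have hPQ : Continuous fun s => P s - Q₁ s := hPc.sub hQ₁c
  set P₁ : ℝ → ℝ := fun s => ∫ t in (0 : ℝ)..s, (P t - Q₁ t) with hP₁
  have hP₁c : Continuous P₁ := prim hPQ.locallyIntegrable
  have key := ae_eq_affine_of_integral_deriv_deriv_mul_eq_zero
    (hFl.sub hP₁c.locallyIntegrable) fun a b c ha hs hab hbc => ?_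
  · obtain ⟨k, l, hkl⟩ := key
    set T' : ℝ → ℝ := fun s => (P₁ s + (k * s + l)) * (ε * Real.cosh s)⁻¹ with hT'
    have hc : Continuous T' := (hP₁c.add (by fun_prop)).mul
      ((by fun_prop : Continuous fun s => ε * Real.cosh s).inv₀ fun s =>
        (mul_pos hε (Real.cosh_pos s)).ne')
    have hae : T =ᵐ[volume] T' := by
      filter_upwards [hkl] with s hs
      have h0 := Real.cosh_pos s
      simp only [Pi.sub_apply, hF] at hs
      simp only [hT']
      rw [← hs]
      field_simp
      ring
    refine ⟨T', hc, hp.congr_T hae, ?_⟩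
    have : ∫ s, T' s ^ 2 = ∫ s, T s ^ 2 := integral_congr_ae (by
      filter_upwards [hae] with s hs
      rw [hs])
    rw [profileEnergy, this, profileEnergy]
  · have hbs := hs.of_hasDerivAt hab
    have hcs := hbs.of_hasDerivAt hbc
    have hb' := ha.of_hasDerivAt hab
    have hc' := hb'.of_hasDerivAt hbc
    have h1 := ha.continuous
    have h2 := hb'.continuous
    have h3 := hc'.continuous
    have el := hp.euler_lagrange hmin (Variation.of_hasCompactSupport hf ha hs hab hbc)
    have iA := integrable_mul_of_hasCompactSupport h3 hcs hFl
    have iB := integrable_mul_of_hasCompactSupport h2 hbs hPc.locallyIntegrable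
    have iB' := integrable_mul_of_hasCompactSupport h2 hbs hQ₁c.locallyIntegrable
    have iC := integrable_mul_of_hasCompactSupport h1 hs hQl
    have iD := integrable_mul_of_hasCompactSupport h3 hcs hP₁c.locallyIntegrable
    have j1 := integrable_mul_of_hasCompactSupport h2 hbs hg.locallyIntegrable
    have j2 : Integrable fun s => a s * Real.cos (f s) * Real.sin (f s) :=
      (by fun_prop : Continuous _).integrable_of_hasCompactSupport hs.mul_right.mul_right
    have j3 : Integrable fun s =>
        Real.cosh s * (c s - Real.cos (2 * f s) * a s) * T s :=
      integrable_mul_of_hasCompactSupport (by fun_prop)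
        (HasCompactSupport.mul_left (hcs.sub hs.mul_left)) hT
    have j4 : Integrable fun s => Real.cosh s * (2 * g s * b s + Real.sin (2 * f s) * a s)
        * (Real.cosh s * (g s ^ 2 + Real.sin (f s) ^ 2)) :=
      (by fun_prop : Continuous _).integrable_of_hasCompactSupport
        (HasCompactSupport.mul_right (HasCompactSupport.mul_left (hbs.mul_left.add hs.mul_left)))
    have e : (∫ s, c s * F s) + (∫ s, b s * P s) + ∫ s, a s * Q s = 0 := by
      rw [← el, ← integral_const_mul, ← integral_const_mul, ← integral_add_three iA iB iC,
        ← integral_add_four j1 j2 (j3.const_mul ε) (j4.const_mul ε)]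
      refine integral_congr_ae (Filter.Eventually.of_forall fun s => ?_)
      simp only [hF, hP, hQ, hq]
      ring
    have p1 := integral_mul_eq_neg_integral_deriv_mul_primitive hab h2 hs hQl
    have p2 := integral_mul_eq_neg_integral_deriv_mul_primitive hbc h3 hbs hPQ.locallyIntegrable
    simp only [mul_sub] at p2
    rw [integral_sub iB iB'] at p2
    simp only [Pi.sub_apply, mul_sub]
    rw [integral_sub iA iD]
    linarith

/-! ### Energy bounds for profiles -/

open Filter Topology in
/-- Every profile has energy above `8`: the angle `π` is attained, and `g² + sin² f` is at least
`2 |(cos f)'|` on both sides of it. -/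
theorem Profile.eight_lt_profileEnergy {f g T : ℝ → ℝ} (hp : Profile f g T) {ε : ℝ} (hε : 0 < ε) :
    8 < profileEnergy ε f g T := by
  have hf := hp.continuous
  have hg := hp.continuous_deriv
  have hco := Real.continuous_cosh
  have hpi := Real.pi_pos
  -- the two sides of a point `c` with `f c = π` contribute `4` each
  obtain ⟨c, hc⟩ : ∃ c, f c = Real.pi := by
    obtain ⟨a, ha⟩ := (hp.tendsto_atBot.eventually_lt_const hpi).exists
    obtain ⟨b, hb⟩ := (hp.tendsto_atTop.eventually_const_lt (by linarith : Real.pi < 2 * Real.pi)).exists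
    exact mem_range_of_exists_le_of_exists_ge hf ⟨a, ha.le⟩ ⟨b, hb.le⟩
  have hI : Integrable fun s => g s ^ 2 + Real.sin (f s) ^ 2 :=
    hp.memLp_deriv.integrable_sq.add hp.memLp_sin.integrable_sq
  have hd : ∀ s, HasDerivAt (fun s => -(2 * Real.cos (f s))) (2 * (g s * Real.sin (f s))) s :=
    fun s => (((hp.hasDerivAt s).cos.const_mul 2).neg).congr_deriv (by ring)
  have hd' : ∀ s, HasDerivAt (fun s => 2 * Real.cos (f s)) (-(2 * (g s * Real.sin (f s)))) s :=
    fun s => ((hp.hasDerivAt s).cos.const_mul 2).congr_deriv (by ring)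
  have c1 : Continuous fun s => 2 * (g s * Real.sin (f s)) := by fun_prop
  have c2 : Continuous fun s => g s ^ 2 + Real.sin (f s) ^ 2 := by fun_prop
  have key : ∀ n : ℝ, |c| ≤ n → 2 * (1 + Real.cos (f (-n))) + 2 * (1 + Real.cos (f n))
      ≤ ∫ s, (g s ^ 2 + Real.sin (f s) ^ 2) := fun n hn => by
    have hn' := abs_le.1 hn
    have i1 : ∫ s in (-n)..c, 2 * (g s * Real.sin (f s))
        ≤ ∫ s in (-n)..c, (g s ^ 2 + Real.sin (f s) ^ 2) :=
      intervalIntegral.integral_mono_on hn'.1 (c1.intervalIntegrable _ _)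
        (c2.intervalIntegrable _ _) fun s _ => by nlinarith [sq_nonneg (g s - Real.sin (f s))]
    have i2 : ∫ s in c..n, -(2 * (g s * Real.sin (f s)))
        ≤ ∫ s in c..n, (g s ^ 2 + Real.sin (f s) ^ 2) :=
      intervalIntegral.integral_mono_on hn'.2 (c1.neg.intervalIntegrable _ _)
        (c2.intervalIntegrable _ _) fun s _ => by nlinarith [sq_nonneg (g s + Real.sin (f s))]
    rw [intervalIntegral.integral_eq_sub_of_hasDerivAt (fun s _ => hd s)
      (c1.intervalIntegrable _ _), hc, Real.cos_pi] at i1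
    rw [intervalIntegral.integral_eq_sub_of_hasDerivAt (fun s _ => hd' s)
      (c1.neg.intervalIntegrable _ _), hc, Real.cos_pi] at i2
    have i3 : ∫ s in (-n)..n, (g s ^ 2 + Real.sin (f s) ^ 2)
        ≤ ∫ s, (g s ^ 2 + Real.sin (f s) ^ 2) := by
      rw [intervalIntegral.integral_of_le (by linarith)]
      exact setIntegral_le_integral hI (Eventually.of_forall fun s => by positivity)
    rw [← intervalIntegral.integral_add_adjacent_intervals (c2.intervalIntegrable (-n) c)
      (c2.intervalIntegrable c n)] at i3
    linarith
  have hlim : Tendsto (fun n => 2 * (1 + Real.cos (f (-n))) + 2 * (1 + Real.cos (f n))) atTop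
      (𝓝 (2 * (1 + Real.cos 0) + 2 * (1 + Real.cos (2 * Real.pi)))) := by
    have l1 := (Real.continuous_cos.tendsto _).comp
      (hp.tendsto_atBot.comp tendsto_neg_atTop_atBot)
    have l2 := (Real.continuous_cos.tendsto _).comp hp.tendsto_atTop
    exact ((l1.const_add 1).const_mul 2).add ((l2.const_add 1).const_mul 2)
  have h8 := le_of_tendsto hlim ((eventually_ge_atTop |c|).mono key)
  rw [Real.cos_zero, Real.cos_two_pi, integral_add hp.memLp_deriv.integrable_sq
    hp.memLp_sin.integrable_sq] at h8
  -- the inequality is strict because the bending energy of a nonconstant profile is positive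
  have hpos : 0 < ∫ s, (Real.cosh s * (g s ^ 2 + Real.sin (f s) ^ 2)) ^ 2 := by
    obtain ⟨s, hs⟩ : ∃ s, g s ≠ 0 := by
      by_contra! h
      have h1 := is_const_of_deriv_eq_zero (fun s => (hp.hasDerivAt s).differentiableAt)
        fun s => by rw [(hp.hasDerivAt s).deriv, h]
      have h2 : f = fun _ => f 0 := funext fun s => h1 s 0
      have e1 := hp.tendsto_atBot
      have e2 := hp.tendsto_atTop
      rw [h2] at e1 e2
      have e3 := tendsto_nhds_unique e1 tendsto_const_nhds
      have e4 := tendsto_nhds_unique e2 tendsto_const_nhds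
      linarith
    refine integral_pos_of_integrable_nonneg_nonzero (f := fun s =>
      (Real.cosh s * (g s ^ 2 + Real.sin (f s) ^ 2)) ^ 2) (x := s) (by fun_prop) hp.memLp_quad.integrable_sq (fun s => sq_nonneg _) ?_
    have h1 : 0 < g s ^ 2 := by positivity
    have h2 := Real.cosh_pos s
    positivity
  have hT : 0 ≤ ∫ s, T s ^ 2 := integral_nonneg fun s => sq_nonneg _
  rw [profileEnergy]
  nlinarith [mul_pos hε hpos, mul_nonneg hε.le hT]

theorem inv_cosh_le_one (s : ℝ) : (Real.cosh s)⁻¹ ≤ 1 := inv_le_one_of_one_le₀ (Real.one_le_cosh s)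

theorem inv_cosh_pos (s : ℝ) : 0 < (Real.cosh s)⁻¹ := inv_pos.2 (Real.cosh_pos s)

theorem continuous_inv_cosh : Continuous fun s : ℝ => (Real.cosh s)⁻¹ :=
  Real.continuous_cosh.inv₀ fun s => (Real.cosh_pos s).ne'

theorem integrable_inv_cosh : Integrable fun s : ℝ => (Real.cosh s)⁻¹ := by
  refine (integrable_inv_one_add_sq.const_mul 2).mono' continuous_inv_cosh.aestronglyMeasurable
    (Filter.Eventually.of_forall fun s => ?_)
  rw [Real.norm_of_nonneg (inv_cosh_pos s).le, ← div_eq_mul_inv, inv_eq_one_div,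
    div_le_div_iff₀ (Real.cosh_pos s) (by positivity)]
  have h : Real.cosh s = 1 + 2 * Real.sinh (s / 2) ^ 2 := by
    have h1 := Real.cosh_two_mul (s / 2)
    have h2 := Real.cosh_sq (s / 2)
    rw [mul_div_cancel₀ s (two_ne_zero' ℝ)] at h1
    linarith
  have h2 : (s / 2) ^ 2 ≤ Real.sinh (s / 2) ^ 2 := by
    rw [sq_le_sq, Real.abs_sinh]
    exact Real.self_le_sinh_iff.2 (abs_nonneg _)
  nlinarith

theorem memLp_inv_cosh_line : MemLp (fun s : ℝ => (Real.cosh s)⁻¹) 2 volume := by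
  rw [memLp_two_iff_integrable_sq continuous_inv_cosh.aestronglyMeasurable]
  refine integrable_inv_cosh.mono' (continuous_inv_cosh.pow 2).aestronglyMeasurable
    (Filter.Eventually.of_forall fun s => ?_)
  rw [Real.norm_of_nonneg (by positivity), sq]
  exact mul_le_of_le_one_left (inv_cosh_pos s).le (inv_cosh_le_one s)

open Filter in
theorem integral_inv_cosh_sq_le : ∫ s : ℝ, (Real.cosh s)⁻¹ ^ 2 ≤ 2 := by
  have h := intervalIntegral_tendsto_integral memLp_inv_cosh_line.integrable_sq
    tendsto_neg_atTop_atBot tendsto_id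
  refine le_of_tendsto' h fun n => ?_
  rw [id, intervalIntegral.integral_eq_sub_of_hasDerivAt (fun s _ => hasDerivAt_tanh s)
    ((continuous_inv_cosh.pow 2).intervalIntegrable _ _)]
  linarith [Real.tanh_lt_one n, Real.neg_one_lt_tanh (-n)]

/-- The Gudermannian function, shifted so as to increase from `0` to `π`. -/
def gd (x : ℝ) : ℝ := 2 * Real.arctan (Real.exp x)

theorem sin_gd (x : ℝ) : Real.sin (gd x) = (Real.cosh x)⁻¹ := by
  rw [gd, Real.sin_two_mul, Real.sin_arctan, Real.cos_arctan, Real.cosh_eq, Real.exp_neg]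
  have h1 := Real.exp_pos x
  have h2 : 0 < 1 + Real.exp x ^ 2 := by positivity
  have h3 := Real.sq_sqrt h2.le
  have h4 := Real.sqrt_pos.2 h2
  field_simp
  rw [h3]
  ring

theorem cos_gd (x : ℝ) : Real.cos (gd x) = -Real.tanh x := by
  rw [gd, Real.cos_two_mul, Real.cos_arctan, Real.tanh_eq_sinh_div_cosh, Real.sinh_eq,
    Real.cosh_eq, Real.exp_neg]
  have h1 := Real.exp_pos x
  have h2 : 0 < 1 + Real.exp x ^ 2 := by positivity
  have h3 := Real.sq_sqrt h2.le
  have h4 := Real.sqrt_pos.2 h2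
  rw [div_pow, h3]
  field_simp
  ring

theorem hasDerivAt_gd (x : ℝ) : HasDerivAt gd (Real.cosh x)⁻¹ x := by
  refine ((Real.hasDerivAt_exp x).arctan.const_mul 2).congr_deriv ?_
  rw [Real.cosh_eq, Real.exp_neg]
  have h1 := Real.exp_pos x
  field_simp
  ring

open Filter Topology in
theorem tendsto_gd_atBot : Tendsto gd atBot (𝓝 0) := by
  have h := ((Real.continuous_arctan.tendsto 0).comp Real.tendsto_exp_atBot).const_mul 2
  rw [Real.arctan_zero, mul_zero] at h
  exact h

open Filter Topology in
theorem tendsto_gd_atTop : Tendsto gd atTop (𝓝 Real.pi) := by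
  have h := ((tendsto_nhds_of_tendsto_nhdsWithin Real.tendsto_arctan_atTop).comp
    Real.tendsto_exp_atTop).const_mul 2
  rw [mul_div_cancel₀ _ (two_ne_zero' ℝ)] at h
  exact h

theorem inv_cosh_add_le (s t : ℝ) :
    (Real.cosh (s + t))⁻¹ ≤ Real.exp |t| * (Real.cosh s)⁻¹ := by
  rw [← div_eq_mul_inv, inv_eq_one_div, div_le_div_iff₀ (Real.cosh_pos _) (Real.cosh_pos _), one_mul]
  have h1 : Real.cosh s ≤ Real.cosh (s + t) * Real.cosh t + |Real.sinh (s + t)| * |Real.sinh t| := by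
    have : Real.cosh s = Real.cosh (s + t) * Real.cosh t - Real.sinh (s + t) * Real.sinh t := by
      rw [← Real.cosh_sub]; ring_nf
    rw [this, ← abs_mul]
    linarith [neg_abs_le (Real.sinh (s + t) * Real.sinh t)]
  have h2 : |Real.sinh (s + t)| ≤ Real.cosh (s + t) := by
    rw [Real.abs_sinh, ← Real.cosh_abs]; exact (Real.sinh_lt_cosh _).le
  have h3 : Real.exp |t| = Real.cosh t + |Real.sinh t| := by
    rw [Real.abs_sinh, ← Real.cosh_abs t, Real.cosh_add_sinh]
  rw [h3]
  nlinarith [abs_nonneg (Real.sinh t)]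

/-- The interaction of two bubbles at distance `2t` is of order `1 / t`. The crude bound `t ≤ sinh
t` suffices. -/
theorem inv_cosh_mul_inv_cosh_le {t : ℝ} (ht : 0 < t) (s : ℝ) :
    (Real.cosh (s + t))⁻¹ * (Real.cosh (s - t))⁻¹ ≤ (2 * t)⁻¹ * (Real.cosh s)⁻¹ := by
  rw [← mul_inv, ← mul_inv]
  have h0 := Real.cosh_pos s
  refine inv_anti₀ (by positivity) ?_
  have h1 : Real.cosh (s + t) * Real.cosh (s - t) = Real.cosh s ^ 2 + Real.sinh t ^ 2 := by
    rw [Real.cosh_add, Real.cosh_sub]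
    have e1 := Real.cosh_sq s
    have e2 := Real.cosh_sq t
    linear_combination (Real.sinh t ^ 2) * e1 + Real.cosh s ^ 2 * e2
  have h2 := Real.self_le_sinh_iff.2 ht.le
  rw [h1]
  nlinarith [sq_nonneg (Real.cosh s - Real.sinh t)]

/-- Two bubbles, concentrated at the heights `-t` and `t`, form a profile. For large `t` its
Dirichlet energy is close to `8`, and its bending energy is finite. -/
theorem exists_profile_le {t : ℝ} (ht : 0 < t) :
    ∃ f g T, Profile f g T ∧ (∫ s, g s ^ 2) + (∫ s, Real.sin (f s) ^ 2)
      ≤ 8 + 2 / t * ∫ s, (Real.cosh s)⁻¹ := by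
  set p : ℝ → ℝ := fun s => (Real.cosh (s + t))⁻¹ with hp
  set m : ℝ → ℝ := fun s => (Real.cosh (s - t))⁻¹ with hm
  set P : ℝ → ℝ := fun s => Real.tanh (s + t) with hP
  set M : ℝ → ℝ := fun s => Real.tanh (s - t) with hM
  -- everything is dominated by `κ`, whose size depends on `t`; only the Dirichlet energy is
  -- estimated uniformly in `t`
  set κ : ℝ → ℝ := fun s => Real.exp t * (Real.cosh s)⁻¹ with hκ
  have hpκ : ∀ s, p s ≤ κ s := fun s => by
    have := inv_cosh_add_le s t
    rwa [abs_of_pos ht] at this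
  have hmκ : ∀ s, m s ≤ κ s := fun s => by
    have := inv_cosh_add_le s (-t)
    rwa [abs_neg, abs_of_pos ht] at this
  have hp0 : ∀ s, 0 < p s := fun s => inv_cosh_pos _
  have hm0 : ∀ s, 0 < m s := fun s => inv_cosh_pos _
  have hκ0 : ∀ s, 0 < κ s := fun s => mul_pos (Real.exp_pos t) (inv_cosh_pos s)
  have hPp : ∀ s, P s ^ 2 + p s ^ 2 = 1 := fun s => tanh_sq_add_inv_cosh_sq _
  have hMm : ∀ s, M s ^ 2 + m s ^ 2 = 1 := fun s => tanh_sq_add_inv_cosh_sq _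
  have hP1 : ∀ s, |P s| ≤ 1 := fun s => (Real.abs_tanh_lt_one _).le
  have hM1 : ∀ s, |M s| ≤ 1 := fun s => (Real.abs_tanh_lt_one _).le
  have cp : Continuous p := continuous_inv_cosh.comp (continuous_add_const t)
  have cm : Continuous m := continuous_inv_cosh.comp (continuous_sub_right t)
  have cP : Continuous P := (contDiff_tanh (n := 1)).continuous.comp (continuous_add_const t)
  have cM : Continuous M := (contDiff_tanh (n := 1)).continuous.comp (continuous_sub_right t)
  have cκ : Continuous κ := continuous_inv_cosh.const_mul _
  have cc := Real.continuous_cosh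
  set f : ℝ → ℝ := fun s => gd (s + t) + gd (s - t) with hf
  have hsin : ∀ s, Real.sin (f s) = -(p s * M s + P s * m s) := fun s => by
    rw [hf]; simp only [Real.sin_add, sin_gd, cos_gd, hp, hm, hP, hM]; ring
  have hcos : ∀ s, Real.cos (f s) = P s * M s - p s * m s := fun s => by
    rw [hf]; simp only [Real.cos_add, sin_gd, cos_gd, hp, hm, hP, hM]; ring
  have dp : ∀ s, HasDerivAt p (-P s * p s) s := fun s =>
    (hasDerivAt_inv_cosh (s + t)).comp_add_const s t
  have dm : ∀ s, HasDerivAt m (-M s * m s) s := fun s =>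
    (hasDerivAt_inv_cosh (s - t)).comp_sub_const s t
  have df : ∀ s, HasDerivAt f (p s + m s) s := fun s =>
    ((hasDerivAt_gd (s + t)).comp_add_const s t).add ((hasDerivAt_gd (s - t)).comp_sub_const s t)
  -- each bubble is a harmonic map, so the tension `f'' - sin f cos f` is the interaction term `A`
  set A : ℝ → ℝ := fun s => -(2 * (p s * m s * (m s * P s + p s * M s))) with hA
  have hAeq : ∀ s, A s + Real.sin (f s) * Real.cos (f s) = -P s * p s + -M s * m s := fun s => by
    rw [hsin, hcos]
    simp only [hA]
    linear_combination (-(p s * P s)) * hMm s - m s * M s * hPp s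
  have cA : Continuous A := by fun_prop
  have hκ2 : ∀ s, Real.cosh s * κ s = Real.exp t := fun s => by
    have := (Real.cosh_pos s).ne'
    simp only [hκ]; field_simp
  have hκL : MemLp κ 2 volume := memLp_inv_cosh_line.const_mul _
  have hg1 : ∀ s, |p s + m s| ≤ 2 * κ s := fun s => by
    rw [abs_of_pos (add_pos (hp0 s) (hm0 s))]; linarith [hpκ s, hmκ s]
  have hs1 : ∀ s, |Real.sin (f s)| ≤ 2 * κ s := fun s => by
    rw [hsin, abs_neg]
    refine (abs_add_le _ _).trans ?_
    rw [abs_mul, abs_mul, abs_of_pos (hp0 s), abs_of_pos (hm0 s)]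
    nlinarith [hpκ s, hmκ s, hp0 s, hm0 s, hP1 s, hM1 s]
  have hA1 : ∀ s, |A s| ≤ 4 * κ s ^ 3 := fun s => by
    simp only [hA]
    rw [abs_neg, abs_mul, abs_two, abs_mul, abs_mul, abs_of_pos (hp0 s), abs_of_pos (hm0 s)]
    have h1 : |m s * P s + p s * M s| ≤ 2 * κ s := by
      refine (abs_add_le _ _).trans ?_
      rw [abs_mul, abs_mul, abs_of_pos (hp0 s), abs_of_pos (hm0 s)]
      nlinarith [hpκ s, hmκ s, hp0 s, hm0 s, hP1 s, hM1 s]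
    have h2 : p s * m s ≤ κ s * κ s := mul_le_mul (hpκ s) (hmκ s) (hm0 s).le (hκ0 s).le
    calc 2 * (p s * m s * |m s * P s + p s * M s|) ≤ 2 * (κ s * κ s * (2 * κ s)) := by
          have := mul_le_mul h2 h1 (abs_nonneg _) (mul_pos (hκ0 s) (hκ0 s)).le
          linarith
      _ = _ := by ring
  have hκe : ∀ s, κ s ≤ Real.exp t := fun s =>
    mul_le_of_le_one_right (Real.exp_pos t).le (inv_cosh_le_one s)
  have cf : Continuous f := continuous_iff_continuousAt.2 fun s => (df s).continuousAt
  have prof : Profile f (fun s => p s + m s) (fun s => Real.cosh s * A s) := by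
    refine ⟨df, ?_, fun x y => ?_, ?_, ?_, ?_, ?_, ?_⟩
    · refine (hκL.const_mul (4 * Real.exp t ^ 2)).mono'
        (by fun_prop : Continuous _).aestronglyMeasurable (Filter.Eventually.of_forall fun s => ?_)
      rw [norm_mul, Real.norm_of_nonneg (Real.cosh_pos s).le, Real.norm_eq_abs]
      calc Real.cosh s * |A s| ≤ Real.cosh s * (4 * κ s ^ 3) :=
            mul_le_mul_of_nonneg_left (hA1 s) (Real.cosh_pos s).le
        _ = 4 * (Real.cosh s * κ s) * κ s * κ s := by ring
        _ ≤ 4 * Real.exp t * Real.exp t * κ s := by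
            rw [hκ2]
            have := hκ0 s
            have := Real.exp_pos t
            have := hκe s
            gcongr
        _ = _ := by ring
    · have e : ∀ s, Real.cosh s * A s * (Real.cosh s)⁻¹ + Real.sin (f s) * Real.cos (f s)
          = -P s * p s + -M s * m s := fun s => by
        rw [← hAeq, mul_comm (Real.cosh s), mul_inv_cancel_right₀ (Real.cosh_pos s).ne']
      simp only [e]
      exact (intervalIntegral.integral_eq_sub_of_hasDerivAt (fun s _ => (dp s).add (dm s))
        ((by fun_prop : Continuous _).intervalIntegrable _ _)).symm
    · rw [← add_zero (0 : ℝ)]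
      exact (tendsto_gd_atBot.comp (Filter.tendsto_atBot_add_const_right _ t
        Filter.tendsto_id)).add (tendsto_gd_atBot.comp (Filter.tendsto_atBot_add_const_right _ (-t)
        Filter.tendsto_id))
    · rw [two_mul]
      exact (tendsto_gd_atTop.comp (Filter.tendsto_atTop_add_const_right _ t
        Filter.tendsto_id)).add (tendsto_gd_atTop.comp (Filter.tendsto_atTop_add_const_right _ (-t)
        Filter.tendsto_id))
    · exact (hκL.const_mul 2).mono' (cp.add cm).aestronglyMeasurable
        (Filter.Eventually.of_forall hg1)
    · exact (hκL.const_mul 2).mono' (by fun_prop : Continuous _).aestronglyMeasurable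
        (Filter.Eventually.of_forall hs1)
    · refine (hκL.const_mul (8 * Real.exp t)).mono'
        (by fun_prop : Continuous _).aestronglyMeasurable (Filter.Eventually.of_forall fun s => ?_)
      have hc := Real.cosh_pos s
      rw [Real.norm_of_nonneg (by positivity)]
      calc Real.cosh s * ((p s + m s) ^ 2 + Real.sin (f s) ^ 2)
          ≤ Real.cosh s * ((2 * κ s) ^ 2 + (2 * κ s) ^ 2) := by
            refine mul_le_mul_of_nonneg_left (add_le_add ?_ ?_) hc.le
            · exact sq_le_sq' (by linarith [(abs_le.1 (hg1 s)).1]) (abs_le.1 (hg1 s)).2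
            · exact sq_le_sq' (by linarith [(abs_le.1 (hs1 s)).1]) (abs_le.1 (hs1 s)).2
        _ = 8 * (Real.cosh s * κ s) * κ s := by ring
        _ = _ := by rw [hκ2]
  refine ⟨f, _, _, prof, ?_⟩
  have ip : Integrable fun s => p s ^ 2 :=
    (memLp_inv_cosh_line.integrable_sq).comp_add_right t
  have im : Integrable fun s => m s ^ 2 :=
    (memLp_inv_cosh_line.integrable_sq).comp_sub_right t
  have ep : ∫ s, p s ^ 2 ≤ 2 :=
    (integral_add_right_eq_self (fun s => (Real.cosh s)⁻¹ ^ 2) t).trans_le integral_inv_cosh_sq_le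
  have em : ∫ s, m s ^ 2 ≤ 2 :=
    (integral_sub_right_eq_self (fun s => (Real.cosh s)⁻¹ ^ 2) t).trans_le integral_inv_cosh_sq_le
  rw [← integral_add prof.memLp_deriv.integrable_sq prof.memLp_sin.integrable_sq]
  calc ∫ s, ((p s + m s) ^ 2 + Real.sin (f s) ^ 2)
      ≤ ∫ s, (2 * p s ^ 2 + 2 * m s ^ 2 + 2 / t * (Real.cosh s)⁻¹) := by
        refine integral_mono (prof.memLp_deriv.integrable_sq.add prof.memLp_sin.integrable_sq)
          (((ip.const_mul 2).add (im.const_mul 2)).add (integrable_inv_cosh.const_mul _)) fun s => ?_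
        -- `(p + m)² + (p M + P m)² ≤ 2 p² + 2 m² + 4 p m`
        have h1 : p s * m s ≤ (2 * t)⁻¹ * (Real.cosh s)⁻¹ := inv_cosh_mul_inv_cosh_le ht s
        have h2 : 4 * ((2 * t)⁻¹ * (Real.cosh s)⁻¹) = 2 / t * (Real.cosh s)⁻¹ := by
          field_simp; norm_num
        have h3 : |P s * M s| ≤ 1 := by
          rw [abs_mul]; exact mul_le_one₀ (hP1 s) (abs_nonneg _) (hM1 s)
        have h4 : p s * m s * (P s * M s) ≤ p s * m s :=
          mul_le_of_le_one_right (mul_pos (hp0 s) (hm0 s)).le (abs_le.1 h3).2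
        have h5 : M s ^ 2 ≤ 1 := by nlinarith [hMm s, sq_nonneg (m s)]
        have h6 : P s ^ 2 ≤ 1 := by nlinarith [hPp s, sq_nonneg (p s)]
        simp only [hsin]
        nlinarith [mul_le_mul_of_nonneg_left h5 (sq_nonneg (p s)),
          mul_le_mul_of_nonneg_left h6 (sq_nonneg (m s))]
    _ = 2 * (∫ s, p s ^ 2) + 2 * (∫ s, m s ^ 2) + 2 / t * ∫ s, (Real.cosh s)⁻¹ := by
        rw [integral_add_three (ip.const_mul 2) (im.const_mul 2) (integrable_inv_cosh.const_mul _),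
          integral_const_mul, integral_const_mul, integral_const_mul]
    _ ≤ _ := by linarith

/-! ### Decay at the poles and the corotational map of a profile -/

open Filter Topology in
/-- Fatou's lemma, as a criterion for integrability. -/
theorem integrable_of_tendsto_of_integral_le {F : ℕ → ℝ → ℝ} {G : ℝ → ℝ} {C : ℝ}
    (hF : ∀ n, Integrable (F n)) (h0 : ∀ n x, 0 ≤ F n x)
    (hG : ∀ x, Tendsto (fun n => F n x) atTop (𝓝 (G x))) (hC : ∀ n, ∫ x, F n x ≤ C) :
    Integrable G := by
  refine integrable_of_tendsto (Eventually.of_forall hG) (fun n => (hF n).1) (ne_top_of_le_ne_top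
    (ENNReal.ofReal_ne_top (r := C)) (liminf_le_of_le (by isBoundedDefault) fun b hb => ?_))
  obtain ⟨n, hn⟩ := hb.exists
  refine hn.trans ?_
  have e : ∫⁻ x, ‖F n x‖ₑ = ENNReal.ofReal (∫ x, F n x) := by
    rw [ofReal_integral_eq_lintegral_ofReal (hF n) (Eventually.of_forall (h0 n))]
    exact lintegral_congr fun x => Real.enorm_of_nonneg (h0 n x)
  rw [e]
  exact ENNReal.ofReal_le_ofReal (hC n)

theorem abs_sinh_le_cosh (s : ℝ) : |Real.sinh s| ≤ Real.cosh s := by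
  rw [Real.abs_sinh, ← Real.cosh_abs]; exact (Real.sinh_lt_cosh _).le

open Filter in
/-- Square integrable solutions of `p' = tanh p + R` decay like `R`. This follows by testing the
equation with `-N p`, for the bounded weights `N = k cosh sinh / (k + cosh²)`, and letting
`k → ∞`. -/
theorem memLp_cosh_mul_of_hasDerivAt {p R : ℝ → ℝ}
    (hp : ∀ s, HasDerivAt p (Real.tanh s * p s + R s) s) (hpL : MemLp p 2 volume)
    (hR : Continuous R) (hRL : MemLp (fun s => Real.cosh s * R s) 2 volume) :
    MemLp (fun s => Real.cosh s * p s) 2 volume := by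
  have cp : Continuous p := continuous_iff_continuousAt.2 fun s => (hp s).continuousAt
  have cc := Real.continuous_cosh
  have cs := Real.continuous_sinh
  have ct : Continuous Real.tanh := (contDiff_tanh (n := 0)).continuous
  have hRL0 := hRL.of_cosh_mul hR
  have bound : ∀ k : ℕ, Integrable (fun s => k / (k + Real.cosh s ^ 2) * (Real.sinh s * p s) ^ 2) ∧
      ∫ s, k / (k + Real.cosh s ^ 2) * (Real.sinh s * p s) ^ 2
        ≤ ∫ s, (Real.cosh s * R s) ^ 2 := by
    intro k
    have hk0 : (0 : ℝ) ≤ k := Nat.cast_nonneg k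
    have pos : ∀ s, 0 < (k : ℝ) + Real.cosh s ^ 2 := fun s => by
      have := Real.cosh_pos s
      positivity
    have ci : Continuous fun s => (k : ℝ) / (k + Real.cosh s ^ 2) :=
      continuous_const.div (by fun_prop) fun s => (pos s).ne'
    set N : ℝ → ℝ := fun s => k / (k + Real.cosh s ^ 2) * (Real.cosh s * Real.sinh s) with hN
    -- the derivative of `N`
    set D : ℝ → ℝ := fun s => k / (k + Real.cosh s ^ 2)
      * (((Real.sinh s ^ 2 + Real.cosh s ^ 2) * k + Real.cosh s ^ 2) / (k + Real.cosh s ^ 2)) with hD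
    have hfrac : ∀ s, 0 ≤ (k : ℝ) / (k + Real.cosh s ^ 2) ∧ (k : ℝ) / (k + Real.cosh s ^ 2) ≤ 1 ∧
        (k : ℝ) / (k + Real.cosh s ^ 2) * Real.cosh s ^ 2 ≤ k := fun s => by
      refine ⟨div_nonneg hk0 (pos s).le, div_le_one_of_le₀ ?_ (pos s).le, ?_⟩
      · linarith [sq_nonneg (Real.cosh s)]
      · rw [div_mul_eq_mul_div, div_le_iff₀ (pos s)]
        nlinarith
    have hsh : ∀ s, Real.sinh s ^ 2 ≤ Real.cosh s ^ 2 := fun s => by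
      linarith [Real.cosh_sq s]
    have hNb : ∀ s, |N s| ≤ k := fun s => by
      rw [hN, abs_mul, abs_of_nonneg (hfrac s).1, abs_mul, abs_of_pos (Real.cosh_pos s)]
      refine le_trans (mul_le_mul_of_nonneg_left ?_ (hfrac s).1) (hfrac s).2.2
      rw [sq]
      exact mul_le_mul_of_nonneg_left (abs_sinh_le_cosh s) (Real.cosh_pos s).le
    have hD0 : ∀ s, 0 ≤ D s := fun s => by
      have := pos s
      simp only [hD]
      positivity
    have hDb : ∀ s, D s ≤ 2 * k + 1 := fun s => by
      have h1 : ((Real.sinh s ^ 2 + Real.cosh s ^ 2) * k + Real.cosh s ^ 2) / (k + Real.cosh s ^ 2)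
          ≤ 2 * k + 1 := by
        rw [div_le_iff₀ (pos s)]
        nlinarith [hsh s, sq_nonneg (Real.cosh s)]
      have h2 : 0 ≤ ((Real.sinh s ^ 2 + Real.cosh s ^ 2) * k + Real.cosh s ^ 2)
          / (k + Real.cosh s ^ 2) := by
        have := pos s
        positivity
      exact (mul_le_of_le_one_left h2 (hfrac s).2.1).trans h1
    have hNd : ∀ s, HasDerivAt N (D s) s := fun s => by
      have h1 := ((hasDerivAt_const s (k : ℝ)).div
        (((Real.hasDerivAt_cosh s).pow 2).const_add (k : ℝ)) (pos s).ne').mul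
        ((Real.hasDerivAt_cosh s).mul (Real.hasDerivAt_sinh s))
      refine h1.congr_deriv ?_
      have hne := (pos s).ne'
      simp only [hD, Pi.mul_apply, Pi.div_apply, Pi.pow_apply]
      push_cast
      field_simp
      linear_combination (Real.cosh s ^ 2 * k) * Real.cosh_sq s
    have cN : Continuous N := ci.mul (cc.mul cs)
    have cD : Continuous D := ci.mul ((by fun_prop : Continuous fun s =>
      (Real.sinh s ^ 2 + Real.cosh s ^ 2) * k + Real.cosh s ^ 2).div (by fun_prop)
      fun s => (pos s).ne')
    have iDp : Integrable fun s => D s * p s ^ 2 := by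
      refine (hpL.integrable_sq.const_mul (2 * k + 1)).mono' (by fun_prop : Continuous _
        ).aestronglyMeasurable (Eventually.of_forall fun s => ?_)
      rw [Real.norm_of_nonneg (mul_nonneg (hD0 s) (sq_nonneg _))]
      exact mul_le_mul_of_nonneg_right (hDb s) (sq_nonneg _)
    have iNp : Integrable fun s => N s * p s ^ 2 := by
      refine (hpL.integrable_sq.const_mul (k : ℝ)).mono' (by fun_prop : Continuous _
        ).aestronglyMeasurable (Eventually.of_forall fun s => ?_)
      rw [norm_mul, Real.norm_of_nonneg (sq_nonneg _)]
      exact mul_le_mul_of_nonneg_right (hNb s) (sq_nonneg _)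
    have im : Integrable (fun s => k / (k + Real.cosh s ^ 2) * (Real.sinh s * p s) ^ 2) := by
      refine (hpL.integrable_sq.const_mul (k : ℝ)).mono' (by fun_prop : Continuous _
        ).aestronglyMeasurable (Eventually.of_forall fun s => ?_)
      rw [Real.norm_of_nonneg (mul_nonneg (hfrac s).1 (sq_nonneg _)), mul_pow, ← mul_assoc]
      exact mul_le_mul_of_nonneg_right ((mul_le_mul_of_nonneg_left (hsh s) (hfrac s).1).trans
        (hfrac s).2.2) (sq_nonneg _)
    have iNR : Integrable fun s => N s * p s * R s := by
      refine ((hpL.norm.integrable_mul hRL0.norm).const_mul (k : ℝ)).mono' (by fun_prop : Continuous _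
        ).aestronglyMeasurable (Eventually.of_forall fun s => ?_)
      rw [norm_mul, norm_mul, mul_assoc]
      exact mul_le_mul_of_nonneg_right (hNb s) (mul_nonneg (norm_nonneg _) (norm_nonneg _))
    refine ⟨im, ?_⟩
    -- the integral of `(N p²)'` vanishes; the term with `D = N'` is nonnegative and is dropped
    have h0 : ∫ s, (D s * p s ^ 2 + 2 * (k / (k + Real.cosh s ^ 2) * (Real.sinh s * p s) ^ 2)
        + 2 * (N s * p s * R s)) = 0 := by
      refine integral_eq_zero_of_hasDerivAt_of_integrable (f := fun s => N s * p s ^ 2) (fun s => ?_)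
        ((iDp.add (im.const_mul 2)).add (iNR.const_mul 2)) iNp
      refine ((hNd s).mul ((hp s).pow 2)).congr_deriv ?_
      have e : N s * Real.tanh s = k / (k + Real.cosh s ^ 2) * Real.sinh s ^ 2 := by
        have := (Real.cosh_pos s).ne'
        rw [Real.tanh_eq_sinh_div_cosh, hN]
        field_simp
      simp only [Pi.pow_apply, Nat.cast_ofNat, Nat.add_one_sub_one, pow_one]
      linear_combination (2 * p s ^ 2) * e
    rw [integral_add_three iDp (im.const_mul 2) (iNR.const_mul 2), integral_const_mul,
      integral_const_mul] at h0
    have h1 : 0 ≤ ∫ s, D s * p s ^ 2 := integral_nonneg fun s => mul_nonneg (hD0 s) (sq_nonneg _)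
    have h2 : ∫ s, -(2 * (N s * p s * R s)) ≤ ∫ s,
        (k / (k + Real.cosh s ^ 2) * (Real.sinh s * p s) ^ 2 + (Real.cosh s * R s) ^ 2) := by
      refine integral_mono (iNR.const_mul 2).neg (im.add hRL.integrable_sq) fun s => ?_
      simp only
      have h3 : -(2 * (N s * p s * R s)) ≤ k / (k + Real.cosh s ^ 2)
          * ((Real.sinh s * p s) ^ 2 + (Real.cosh s * R s) ^ 2) := by
        have : -(2 * (N s * p s * R s)) = k / (k + Real.cosh s ^ 2)
            * (-(2 * (Real.sinh s * p s) * (Real.cosh s * R s))) := by simp only [hN]; ring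
        rw [this]
        exact mul_le_mul_of_nonneg_left (by
          nlinarith [sq_nonneg (Real.sinh s * p s + Real.cosh s * R s)]) (hfrac s).1
      have h4 := mul_le_mul_of_nonneg_right (hfrac s).2.1 (sq_nonneg (Real.cosh s * R s))
      linarith
    rw [integral_neg, integral_const_mul, integral_add im hRL.integrable_sq] at h2
    linarith
  have hlim := integrable_of_tendsto_of_integral_le (fun k => (bound k).1)
    (fun k s => by have := Real.cosh_pos s; positivity) (G := fun s => (Real.sinh s * p s) ^ 2)
    (fun s => by
      simpa using (tendsto_natCast_div_add_atTop (𝕜 := ℝ) (Real.cosh s ^ 2)).mul_const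
        ((Real.sinh s * p s) ^ 2))
    fun k => (bound k).2
  rw [memLp_two_iff_integrable_sq (by fun_prop : Continuous fun s => Real.cosh s * p s).aestronglyMeasurable]
  refine (hpL.integrable_sq.add hlim).congr (Eventually.of_forall fun s => ?_)
  simp only [Pi.add_apply, mul_pow]
  linear_combination -(p s ^ 2) * Real.cosh_sq s

section

variable {f g T : ℝ → ℝ}

/-- The second derivative of a profile. -/
def secondDeriv (f T : ℝ → ℝ) (s : ℝ) : ℝ :=
  T s * (Real.cosh s)⁻¹ + Real.sin (f s) * Real.cos (f s)

theorem Profile.continuous_secondDeriv (hp : Profile f g T) (hT : Continuous T) :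
    Continuous (secondDeriv f T) := by
  have h1 := hp.continuous
  have h2 := continuous_inv_cosh
  unfold secondDeriv
  fun_prop

theorem Profile.hasDerivAt_deriv (hp : Profile f g T) (hT : Continuous T) (s : ℝ) :
    HasDerivAt g (secondDeriv f T s) s := by
  have hc := hp.continuous_secondDeriv hT
  have e : g = fun s => g 0 + ∫ t in (0 : ℝ)..s, secondDeriv f T t := funext hp.eq_add
  rw [e]
  exact (intervalIntegral.integral_hasDerivAt_right (hc.intervalIntegrable _ _)
    (hc.stronglyMeasurableAtFilter _ _) hc.continuousAt).const_add _

theorem Profile.contDiff_deriv (hp : Profile f g T) (hT : Continuous T) : ContDiff ℝ 1 g := by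
  have : deriv g = secondDeriv f T := funext fun s => (hp.hasDerivAt_deriv hT s).deriv
  exact contDiff_one_iff_deriv.2 ⟨fun s => (hp.hasDerivAt_deriv hT s).differentiableAt,
    this ▸ hp.continuous_secondDeriv hT⟩

theorem Profile.contDiff (hp : Profile f g T) (hT : Continuous T) : ContDiff ℝ 2 f := by
  have h : deriv f = g := funext fun s => (hp.hasDerivAt s).deriv
  rw [show (2 : WithTop ℕ∞) = 1 + 1 by norm_num, contDiff_succ_iff_deriv]
  exact ⟨fun s => (hp.hasDerivAt s).differentiableAt, by simp, h ▸ hp.contDiff_deriv hT⟩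

/-- The mixed derivative of the corotational map decays at the poles. -/
theorem Profile.memLp_mixed (hp : Profile f g T) (hT : Continuous T) :
    MemLp (fun s => Real.cosh s * (g s * Real.cos (f s) + Real.tanh s * Real.sin (f s)))
      2 volume := by
  have cf := hp.continuous
  have cg := hp.continuous_deriv
  have cc := Real.continuous_cosh
  have ci := continuous_inv_cosh
  have ct : Continuous Real.tanh := (contDiff_tanh (n := 0)).continuous
  -- `p = (sin f)' + tanh sin f` solves `p' = tanh p + R`
  refine memLp_cosh_mul_of_hasDerivAt (R := fun s => T s * (Real.cosh s)⁻¹ * Real.cos (f s)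
    - (g s ^ 2 + Real.sin (f s) ^ 2) * Real.sin (f s)
    + 2 * ((Real.cosh s)⁻¹ ^ 2 * Real.sin (f s))) (fun s => ?_) ?_ (by fun_prop) ?_
  · refine (((hp.hasDerivAt_deriv hT s).mul (hp.hasDerivAt s).cos).add
      ((hasDerivAt_tanh s).mul (hp.hasDerivAt s).sin)).congr_deriv ?_
    rw [secondDeriv]
    linear_combination Real.sin (f s) * Real.sin_sq_add_cos_sq (f s)
      - Real.sin (f s) * tanh_sq_add_inv_cosh_sq s
  · refine (hp.memLp_deriv.norm.add hp.memLp_sin.norm).mono'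
      (by fun_prop : Continuous _).aestronglyMeasurable (Filter.Eventually.of_forall fun s => ?_)
    refine (norm_add_le _ _).trans (add_le_add ?_ ?_)
    · rw [norm_mul]; exact mul_le_of_le_one_right (norm_nonneg _) (Real.abs_cos_le_one _)
    · rw [norm_mul]; exact mul_le_of_le_one_left (norm_nonneg _) (Real.abs_tanh_lt_one s).le
  · refine ((hp.memLp_T.norm.add hp.memLp_quad).add (memLp_inv_cosh_line.const_mul 2)).mono'
      (by fun_prop : Continuous _).aestronglyMeasurable (Filter.Eventually.of_forall fun s => ?_)
    have h0 := Real.cosh_pos s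
    have e : Real.cosh s * (T s * (Real.cosh s)⁻¹ * Real.cos (f s)
        - (g s ^ 2 + Real.sin (f s) ^ 2) * Real.sin (f s)
        + 2 * ((Real.cosh s)⁻¹ ^ 2 * Real.sin (f s)))
        = T s * Real.cos (f s) - Real.cosh s * (g s ^ 2 + Real.sin (f s) ^ 2) * Real.sin (f s)
          + 2 * (Real.cosh s)⁻¹ * Real.sin (f s) := by
      field_simp
    have n1 : ‖T s * Real.cos (f s)‖ ≤ ‖T s‖ := by
      rw [norm_mul]; exact mul_le_of_le_one_right (norm_nonneg _) (Real.abs_cos_le_one _)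
    have n2 : ‖Real.cosh s * (g s ^ 2 + Real.sin (f s) ^ 2) * Real.sin (f s)‖
        ≤ Real.cosh s * (g s ^ 2 + Real.sin (f s) ^ 2) := by
      rw [norm_mul, Real.norm_of_nonneg (by positivity)]
      exact mul_le_of_le_one_right (by positivity) (Real.abs_sin_le_one _)
    have n3 : ‖2 * (Real.cosh s)⁻¹ * Real.sin (f s)‖ ≤ 2 * (Real.cosh s)⁻¹ := by
      rw [norm_mul, Real.norm_of_nonneg (by positivity)]
      exact mul_le_of_le_one_right (by positivity) (Real.abs_sin_le_one _)
    rw [e]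
    exact (norm_add_le _ _).trans (add_le_add ((norm_sub_le _ _).trans (add_le_add n1 n2)) n3)

/-- The remaining second derivative of the corotational map decays at the poles: up to square integrable terms, it is `cos f tanh` times the mixed one. -/
theorem Profile.memLp_axial (hp : Profile f g T) (hT : Continuous T) :
    MemLp (fun s => Real.cosh s * (Real.sin (f s) * Real.cos (f s) + Real.tanh s * g s))
      2 volume := by
  have cf := hp.continuous
  have cg := hp.continuous_deriv
  have cc := Real.continuous_cosh
  have ct : Continuous Real.tanh := (contDiff_tanh (n := 0)).continuous
  refine (((hp.memLp_mixed hT).norm.add hp.memLp_quad).add memLp_inv_cosh_line).mono'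
    (by fun_prop : Continuous _).aestronglyMeasurable (Filter.Eventually.of_forall fun s => ?_)
  have h0 := Real.cosh_pos s
  have ht := (Real.abs_tanh_lt_one s).le
  have e : Real.cosh s * (Real.sin (f s) * Real.cos (f s) + Real.tanh s * g s)
      = Real.tanh s * Real.cos (f s)
          * (Real.cosh s * (g s * Real.cos (f s) + Real.tanh s * Real.sin (f s)))
        + Real.cosh s * (Real.tanh s * Real.sin (f s) * (g s * Real.sin (f s)))
        + (Real.cosh s)⁻¹ * (Real.sin (f s) * Real.cos (f s)) := by
    have h1 : Real.tanh s ^ 2 = 1 - (Real.cosh s)⁻¹ ^ 2 := by linarith [tanh_sq_add_inv_cosh_sq s]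
    have h2 : Real.cosh s * (Real.cosh s)⁻¹ = 1 := mul_inv_cancel₀ h0.ne'
    have h3 := Real.sin_sq_add_cos_sq (f s)
    linear_combination (-(Real.cosh s * Real.tanh s * g s)) * h3
      - Real.cosh s * Real.sin (f s) * Real.cos (f s) * h1
      + (Real.cosh s)⁻¹ * Real.sin (f s) * Real.cos (f s) * h2
  have hsc : |Real.sin (f s) * Real.cos (f s)| ≤ 1 := by
    rw [abs_mul]; exact mul_le_one₀ (Real.abs_sin_le_one _) (abs_nonneg _) (Real.abs_cos_le_one _)
  have hgs : |g s * Real.sin (f s)| ≤ g s ^ 2 + Real.sin (f s) ^ 2 := by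
    rw [abs_le]
    constructor <;> nlinarith [sq_nonneg (g s + Real.sin (f s)), sq_nonneg (g s - Real.sin (f s)),
      sq_nonneg (g s), sq_nonneg (Real.sin (f s))]
  rw [e]
  refine (norm_add_le _ _).trans (add_le_add ((norm_add_le _ _).trans (add_le_add ?_ ?_)) ?_)
  · rw [norm_mul]
    refine mul_le_of_le_one_left (norm_nonneg _) ?_
    rw [norm_mul]
    exact mul_le_one₀ ht (abs_nonneg _) (Real.abs_cos_le_one _)
  · rw [norm_mul, Real.norm_of_nonneg h0.le]
    refine mul_le_mul_of_nonneg_left ?_ h0.le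
    rw [norm_mul]
    refine (mul_le_of_le_one_left (norm_nonneg _) ?_).trans hgs
    rw [norm_mul]
    exact mul_le_one₀ ht (abs_nonneg _) (Real.abs_sin_le_one _)
  · rw [norm_mul, Real.norm_of_nonneg (inv_cosh_pos s).le]
    exact mul_le_of_le_one_right (inv_cosh_pos s).le hsc

end

instance isFiniteMeasure_angle :
    IsFiniteMeasure ((volume : Measure ℝ).restrict (Set.Ioo (-Real.pi) Real.pi)) :=
  ⟨by simp⟩

theorem memLp_comp_fst {h : ℝ → ℝ} (hh : MemLp h 2 volume) :
    MemLp (fun p : ℝ × ℝ => h p.1) 2 strip := by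
  rw [strip_eq_prod]
  exact hh.comp_fst _

theorem integral_strip_comp_fst {h : ℝ → ℝ} (hh : Integrable h) :
    ∫ p, h p.1 ∂strip = 2 * Real.pi * ∫ s, h s := by
  have hi : Integrable (fun p : ℝ × ℝ => h p.1) strip := by
    rw [strip_eq_prod]
    exact hh.comp_fst _
  rw [integral_strip hi, ← integral_const_mul]
  congr 1
  funext s
  simp only [angInt]
  rw [intervalIntegral.integral_const, smul_eq_mul]
  ring

/-- The corotational map with angle function `f`. -/
def profileMap (f : ℝ → ℝ) : ℝ × ℝ → E3 := corot (fun s => Real.sin (f s)) (fun s => Real.cos (f s))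

/-- The unit tangent vector along the meridian at `profileMap f p`. -/
def meridian (f : ℝ → ℝ) : ℝ × ℝ → E3 := corot (fun s => Real.cos (f s)) (fun s => -Real.sin (f s))

theorem norm_profileMap (f : ℝ → ℝ) (p : ℝ × ℝ) : ‖profileMap f p‖ = 1 := by
  have h : ‖profileMap f p‖ ^ 2 = 1 := by
    rw [profileMap, norm_corot_sq]; exact Real.sin_sq_add_cos_sq _
  nlinarith [norm_nonneg (profileMap f p)]

theorem corot_smul_add (x z x' z' : ℝ → ℝ) (c d : ℝ) (p : ℝ × ℝ) :
    c • corot x z p + d • corot x' z' p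
      = corot (fun s => c * x s + d * x' s) (fun s => c * z s + d * z' s) p := by
  simp only [corot]
  module

theorem norm_le_add_of_sq {E : Type*} [NormedAddCommGroup E] {v : E} {a b : ℝ}
    (h : ‖v‖ ^ 2 = a ^ 2 + b ^ 2) : ‖v‖ ≤ |a| + |b| := by
  have h1 := sq_abs a
  have h2 := sq_abs b
  nlinarith [norm_nonneg v, abs_nonneg a, abs_nonneg b, mul_nonneg (abs_nonneg a) (abs_nonneg b)]

section

variable {f g T : ℝ → ℝ}

theorem contDiff_profileMap (hf : ContDiff ℝ 2 f) : ContDiff ℝ 2 (profileMap f) :=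
  contDiff_corot (Real.contDiff_sin.comp hf) (Real.contDiff_cos.comp hf)

theorem contDiff_meridian (hf : ContDiff ℝ 2 f) : ContDiff ℝ 2 (meridian f) :=
  contDiff_corot (Real.contDiff_cos.comp hf) (Real.contDiff_sin.comp hf).neg

theorem Profile.ds_profileMap (hp : Profile f g T) (hT : Continuous T) :
    ∂ₛ (profileMap f)
      = corot (fun s => Real.cos (f s) * g s) (fun s => -Real.sin (f s) * g s) :=
  ds_corot ((contDiff_profileMap (hp.contDiff hT)).differentiable (by norm_num))
    (fun s => (hp.hasDerivAt s).sin) fun s => (hp.hasDerivAt s).cos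

theorem Profile.ds_profileMap_eq_smul (hp : Profile f g T) (hT : Continuous T) (p : ℝ × ℝ) :
    ∂ₛ (profileMap f) p = g p.1 • meridian f p := by
  rw [hp.ds_profileMap hT, meridian]
  simp only [corot]
  module

theorem Profile.ds_meridian (hp : Profile f g T) (hT : Continuous T) (p : ℝ × ℝ) :
    ∂ₛ (meridian f) p = -(g p.1 • profileMap f p) := by
  rw [meridian, ds_corot ((contDiff_meridian (hp.contDiff hT)).differentiable (by norm_num))
    (fun s => (hp.hasDerivAt s).cos) fun s => (hp.hasDerivAt s).sin.neg, profileMap]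
  simp only [corot]
  module

theorem Profile.da_profileMap (hp : Profile f g T) (hT : Continuous T) :
    ∂ₐ (profileMap f) = fun p => Real.sin (f p.1) • perpVec p.2 :=
  da_corot ((contDiff_profileMap (hp.contDiff hT)).differentiable (by norm_num))

theorem Profile.ds_ds_profileMap (hp : Profile f g T) (hT : Continuous T) :
    ∂ₛ (∂ₛ (profileMap f)) = corot
      (fun s => -Real.sin (f s) * g s * g s + Real.cos (f s) * secondDeriv f T s)
      (fun s => -(Real.cos (f s) * g s) * g s + -Real.sin (f s) * secondDeriv f T s) := by
  have hd := (contDiff_pd₁ (contDiff_profileMap (hp.contDiff hT)) (1, 0)).differentiable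
    (by norm_num)
  rw [hp.ds_profileMap hT] at hd ⊢
  exact ds_corot hd (fun s => (hp.hasDerivAt s).cos.mul (hp.hasDerivAt_deriv hT s))
    fun s => (hp.hasDerivAt s).sin.neg.mul (hp.hasDerivAt_deriv hT s)

theorem Profile.ds_da_profileMap (hp : Profile f g T) (hT : Continuous T) :
    ∂ₛ (∂ₐ (profileMap f)) = fun p => (Real.cos (f p.1) * g p.1) • perpVec p.2 := by
  have hd := (contDiff_pd₁ (contDiff_profileMap (hp.contDiff hT)) (0, 1)).differentiable
    (by norm_num)
  rw [hp.da_profileMap hT] at hd ⊢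
  exact ds_smul_perpVec (x := fun s => Real.sin (f s)) (x' := fun s => Real.cos (f s) * g s) hd
    fun s => (hp.hasDerivAt s).sin

theorem Profile.da_da_profileMap (hp : Profile f g T) (hT : Continuous T) :
    ∂ₐ (∂ₐ (profileMap f)) = fun p => -(Real.sin (f p.1) • rotVec p.2) := by
  have hd := (contDiff_pd₁ (contDiff_profileMap (hp.contDiff hT)) (0, 1)).differentiable
    (by norm_num)
  rw [hp.da_profileMap hT] at hd ⊢
  exact da_smul_perpVec (x := fun s => Real.sin (f s)) hd

theorem Profile.laplacian_profileMap (hp : Profile f g T) (hT : Continuous T) (p : ℝ × ℝ) :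
    ∂ₛ (∂ₛ (profileMap f)) p + ∂ₐ (∂ₐ (profileMap f)) p = corot
      (fun s => -Real.sin (f s) * g s * g s + Real.cos (f s) * secondDeriv f T s - Real.sin (f s))
      (fun s => -(Real.cos (f s) * g s) * g s + -Real.sin (f s) * secondDeriv f T s) p := by
  rw [hp.ds_ds_profileMap hT, hp.da_da_profileMap hT]
  simp only [corot]
  module

theorem Profile.norm_ds_profileMap_sq (hp : Profile f g T) (hT : Continuous T) (p : ℝ × ℝ) :
    ‖∂ₛ (profileMap f) p‖ ^ 2 = g p.1 ^ 2 := by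
  rw [hp.ds_profileMap hT, norm_corot_sq]
  linear_combination g p.1 ^ 2 * Real.sin_sq_add_cos_sq (f p.1)

theorem Profile.norm_da_profileMap_sq (hp : Profile f g T) (hT : Continuous T) (p : ℝ × ℝ) :
    ‖∂ₐ (profileMap f) p‖ ^ 2 = Real.sin (f p.1) ^ 2 := by
  rw [hp.da_profileMap hT, norm_smul, norm_perpVec, mul_one, Real.norm_eq_abs, sq_abs]

theorem Profile.norm_laplacian_sq (hp : Profile f g T) (hT : Continuous T) (p : ℝ × ℝ) :
    ‖∂ₛ (∂ₛ (profileMap f)) p + ∂ₐ (∂ₐ (profileMap f)) p‖ ^ 2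
      = (T p.1 * (Real.cosh p.1)⁻¹) ^ 2 + (g p.1 ^ 2 + Real.sin (f p.1) ^ 2) ^ 2 := by
  rw [hp.laplacian_profileMap hT, norm_corot_sq]
  have e : T p.1 * (Real.cosh p.1)⁻¹
      = secondDeriv f T p.1 - Real.sin (f p.1) * Real.cos (f p.1) := by
    rw [secondDeriv]; ring
  rw [e]
  linear_combination (g p.1 ^ 4 + secondDeriv f T p.1 ^ 2 - Real.sin (f p.1) ^ 2)
    * Real.sin_sq_add_cos_sq (f p.1)

/-- The mixed and axial decay estimates complete the control of the covariant Hessian, of which the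
energy only sees the trace. -/
theorem Profile.cylW22 (hp : Profile f g T) (hT : Continuous T) : CylW22 (profileMap f) := by
  have hc2 := contDiff_profileMap (hp.contDiff hT)
  refine ⟨hc2, anglePeriodic_corot _ _, ⟨1, fun p => (norm_profileMap f p).le⟩, ?_⟩
  set r : ℝ → ℝ := fun s => Real.cosh s * (Real.sin (f s) * Real.cos (f s) + Real.tanh s * g s)
    with hr
  set q : ℝ → ℝ := fun s => Real.cosh s * (g s * Real.cos (f s) + Real.tanh s * Real.sin (f s))
    with hq
  set H : ℝ → ℝ := fun s => |T s| + |r s| + |q s| + |r s|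
    + 4 * (Real.cosh s * (g s ^ 2 + Real.sin (f s) ^ 2)) + |g s| + |Real.sin (f s)| with hH
  have hHL : MemLp H 2 volume :=
    ((((((hp.memLp_T.norm).add (hp.memLp_axial hT).norm).add (hp.memLp_mixed hT).norm).add
      (hp.memLp_axial hT).norm).add (hp.memLp_quad.const_mul 4)).add hp.memLp_deriv.norm).add
      hp.memLp_sin.norm
  refine (memLp_comp_fst hHL).mono' (continuous_sobSize hc2).aestronglyMeasurable
    (Filter.Eventually.of_forall fun p => ?_)
  rw [Real.norm_of_nonneg (sobSize_nonneg _ p)]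
  set s := p.1
  have hch := Real.cosh_pos s
  have hinv : Real.cosh s * (Real.cosh s)⁻¹ = 1 := mul_inv_cancel₀ hch.ne'
  have trig := Real.sin_sq_add_cos_sq (f s)
  have n1 : ‖∂ₛ (profileMap f) p‖ = |g s| := by
    rw [← abs_norm, ← sq_eq_sq_iff_abs_eq_abs, hp.norm_ds_profileMap_sq hT]
  have n2 : ‖∂ₐ (profileMap f) p‖ = |Real.sin (f s)| := by
    rw [← abs_norm, ← sq_eq_sq_iff_abs_eq_abs, hp.norm_da_profileMap_sq hT]
  have n3 : ‖∂ₛ (∂ₛ (profileMap f)) p + Real.tanh p.1 • ∂ₛ (profileMap f) p‖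
      ≤ |secondDeriv f T s + Real.tanh s * g s| + |g s ^ 2| := by
    refine norm_le_add_of_sq ?_
    rw [hp.ds_ds_profileMap hT, hp.ds_profileMap hT, ← one_smul ℝ (corot _ _ p), corot_smul_add,
      norm_corot_sq]
    linear_combination ((secondDeriv f T s + Real.tanh s * g s) ^ 2 + g s ^ 4) * trig
  have n4 : ‖∂ₛ (∂ₐ (profileMap f)) p + Real.tanh p.1 • ∂ₐ (profileMap f) p‖
      = |g s * Real.cos (f s) + Real.tanh s * Real.sin (f s)| := by
    rw [hp.ds_da_profileMap hT, hp.da_profileMap hT]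
    simp only
    rw [smul_smul, ← add_smul, norm_smul, norm_perpVec, mul_one, Real.norm_eq_abs,
      mul_comm (Real.cos _)]
  have n5 : ‖∂ₐ (∂ₐ (profileMap f)) p - Real.tanh p.1 • ∂ₛ (profileMap f) p‖
      ≤ |Real.sin (f s) * Real.cos (f s) + Real.tanh s * g s| + |Real.sin (f s) ^ 2| := by
    refine norm_le_add_of_sq ?_
    have e : ∂ₐ (∂ₐ (profileMap f)) p - Real.tanh p.1 • ∂ₛ (profileMap f) p
        = corot (fun s => -Real.sin (f s) - Real.tanh s * (Real.cos (f s) * g s))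
          (fun s => -(Real.tanh s * (-Real.sin (f s) * g s))) p := by
      rw [hp.da_da_profileMap hT, hp.ds_profileMap hT]
      simp only [corot]
      module
    rw [e, norm_corot_sq]
    linear_combination (Real.tanh s ^ 2 * g s ^ 2 - Real.sin (f s) ^ 2) * trig
  have n6 : Real.cosh s * |secondDeriv f T s + Real.tanh s * g s| ≤ |T s| + |r s| := by
    have e : Real.cosh s * (secondDeriv f T s + Real.tanh s * g s) = T s + r s := by
      rw [secondDeriv, hr]
      linear_combination T s * hinv
    rw [← abs_of_pos hch, ← abs_mul, e]
    exact abs_add_le _ _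
  have n7 : Real.cosh s * |Real.sin (f s) * Real.cos (f s) + Real.tanh s * g s| = |r s| := by
    rw [hr, abs_mul, abs_of_pos hch]
  have n8 : Real.cosh s * |g s * Real.cos (f s) + Real.tanh s * Real.sin (f s)| = |q s| := by
    rw [hq, abs_mul, abs_of_pos hch]
  rw [abs_of_nonneg (sq_nonneg (g s))] at n3
  rw [abs_of_nonneg (sq_nonneg (Real.sin (f s)))] at n5
  have hB : 0 ≤ Real.cosh s * (g s ^ 2 + Real.sin (f s) ^ 2) := by positivity
  have m3 := mul_le_mul_of_nonneg_left n3 hch.le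
  have m5 := mul_le_mul_of_nonneg_left n5 hch.le
  rw [sobSize, n4, hp.norm_ds_profileMap_sq hT, hp.norm_da_profileMap_sq hT, n1, n2]
  simp only [hH]
  change Real.cosh s * (_ + _ + _ + g s ^ 2 + Real.sin (f s) ^ 2) + |g s| + |Real.sin (f s)| ≤ _
  nlinarith

/-- The energy of a corotational map is `π` times the energy of its profile. -/
theorem Profile.energy_eq (hp : Profile f g T) (hT : Continuous T) {u : S2 → E3}
    (hu : ∀ᵐ x ∂area, u x = profileMap f (coord x)) (ε : ℝ) :
    energy ε u = Real.pi * profileEnergy ε f g T := by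
  have h : ∀ p : ℝ × ℝ, cylEnergyDens ε (profileMap f) p
      = g p.1 ^ 2 + Real.sin (f p.1) ^ 2 + ε * T p.1 ^ 2
        + ε * (Real.cosh p.1 * (g p.1 ^ 2 + Real.sin (f p.1) ^ 2)) ^ 2 := fun p => by
    have hinv : Real.cosh p.1 * (Real.cosh p.1)⁻¹ = 1 := mul_inv_cancel₀ (Real.cosh_pos _).ne'
    rw [cylEnergyDens, norm_smul, mul_pow, hp.norm_laplacian_sq hT, hp.norm_ds_profileMap_sq hT,
      hp.norm_da_profileMap_sq hT, Real.norm_eq_abs, sq_abs]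
    linear_combination ε * T p.1 ^ 2 * (Real.cosh p.1 * (Real.cosh p.1)⁻¹ + 1) * hinv
  have i1 := hp.memLp_deriv.integrable_sq
  have i2 := hp.memLp_sin.integrable_sq
  have i3 := hp.memLp_T.integrable_sq.const_mul ε
  have i4 := hp.memLp_quad.integrable_sq.const_mul ε
  rw [EpsHarmonic.energy_eq (hp.cylW22 hT) hu]
  simp only [h]
  rw [integral_strip_comp_fst (h := fun s => g s ^ 2 + Real.sin (f s) ^ 2 + ε * T s ^ 2
    + ε * (Real.cosh s * (g s ^ 2 + Real.sin (f s) ^ 2)) ^ 2) (((i1.add i2).add i3).add i4),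
    integral_add_four i1 i2 i3 i4, integral_const_mul, integral_const_mul, profileEnergy]
  ring

end

/-! ### Admissible variations from ambient vector fields -/

open Filter Topology in
/-- Functions in `W^{1,2}(ℝ)` vanish at infinity. -/
theorem tendsto_zero_of_memLp {a b : ℝ → ℝ} (hab : ∀ s, HasDerivAt a (b s) s)
    (ha : MemLp a 2 volume) (hb : MemLp b 2 volume) :
    Tendsto a atBot (𝓝 0) ∧ Tendsto a atTop (𝓝 0) := by
  have hd : ∀ s, HasDerivAt (fun s => a s ^ 2) (2 * (a s * b s)) s := fun s =>
    ((hab s).pow 2).congr_deriv (by simp; ring)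
  have hi : Integrable fun s => 2 * (a s * b s) := (ha.integrable_mul hb).const_mul 2
  have key : ∀ {l : Filter ℝ}, Tendsto (fun s => a s ^ 2) l (𝓝 0) → Tendsto a l (𝓝 0) := by
    intro l h
    have h1 := h.sqrt
    rw [Real.sqrt_zero] at h1
    rw [tendsto_zero_iff_abs_tendsto_zero]
    exact h1.congr fun s => Real.sqrt_sq_eq_abs _
  exact ⟨key (tendsto_zero_of_hasDerivAt_of_integrableOn_Iic (a := 0) (fun s _ => hd s)
      hi.integrableOn ha.integrable_sq.integrableOn),
    key (tendsto_zero_of_hasDerivAt_of_integrableOn_Ioi (a := 0) (fun s _ => hd s)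
      hi.integrableOn ha.integrable_sq.integrableOn)⟩

/-- The tangential directions that ambient fields with horizontal part `β` and vertical part `γ`
induce are admissible. The bounds reflect that the horizontal part of a smooth field has mean zero
at the poles. -/
theorem Profile.exists_variation {f g T : ℝ → ℝ} (hp : Profile f g T) (hT : Continuous T)
    {β β' β'' γ γ' γ'' : ℝ → ℝ}
    (hβ : ∀ s, HasDerivAt β (β' s) s) (hβ' : ∀ s, HasDerivAt β' (β'' s) s) (cβ : Continuous β'')
    (hγ : ∀ s, HasDerivAt γ (γ' s) s) (hγ' : ∀ s, HasDerivAt γ' (γ'' s) s) (cγ : Continuous γ'')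
    {C : ℝ} (b0 : ∀ s, |β s| ≤ C * (Real.cosh s)⁻¹) (b1 : ∀ s, |β' s| ≤ C * (Real.cosh s)⁻¹)
    (b2 : ∀ s, |β'' s - β s| ≤ C * (Real.cosh s)⁻¹ ^ 2) (c0 : ∀ s, |γ s| ≤ C)
    (c1 : ∀ s, |γ' s| ≤ C * (Real.cosh s)⁻¹) (c2 : ∀ s, |γ'' s| ≤ C * (Real.cosh s)⁻¹ ^ 2) :
    ∃ b c, Variation f (fun s => Real.cos (f s) * β s - Real.sin (f s) * γ s) b c := by
  have cf := hp.continuous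
  have cg := hp.continuous_deriv
  have cw := hp.continuous_secondDeriv hT
  have cc := Real.continuous_cosh
  have cβ0 : Continuous β := continuous_iff_continuousAt.2 fun s => (hβ s).continuousAt
  have cβ1 : Continuous β' := continuous_iff_continuousAt.2 fun s => (hβ' s).continuousAt
  have cγ0 : Continuous γ := continuous_iff_continuousAt.2 fun s => (hγ s).continuousAt
  have cγ1 : Continuous γ' := continuous_iff_continuousAt.2 fun s => (hγ' s).continuousAt
  have hC : 0 ≤ C := (abs_nonneg _).trans (c0 0)
  set a : ℝ → ℝ := fun s => Real.cos (f s) * β s - Real.sin (f s) * γ s with ha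
  set w := secondDeriv f T
  set b : ℝ → ℝ := fun s => (-Real.sin (f s) * g s * β s + Real.cos (f s) * β' s)
    - (Real.cos (f s) * g s * γ s + Real.sin (f s) * γ' s) with hb
  set c : ℝ → ℝ := fun s =>
    (((-(Real.cos (f s) * g s) * g s + -Real.sin (f s) * w s) * β s + -Real.sin (f s) * g s * β' s)
      + (-Real.sin (f s) * g s * β' s + Real.cos (f s) * β'' s))
    - (((-Real.sin (f s) * g s * g s + Real.cos (f s) * w s) * γ s + Real.cos (f s) * g s * γ' s)
      + (Real.cos (f s) * g s * γ' s + Real.sin (f s) * γ'' s)) with hc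
  have dsin := fun s => (hp.hasDerivAt s).sin
  have dcos := fun s => (hp.hasDerivAt s).cos
  have dg := hp.hasDerivAt_deriv hT
  have hab : ∀ s, HasDerivAt a (b s) s := fun s =>
    ((dcos s).mul (hβ s)).sub ((dsin s).mul (hγ s))
  have hbc : ∀ s, HasDerivAt b (c s) s := fun s =>
    ((((dsin s).neg.mul (dg s)).mul (hβ s)).add ((dcos s).mul (hβ' s))).sub
      ((((dcos s).mul (dg s)).mul (hγ s)).add ((dsin s).mul (hγ' s)))
  have ca : Continuous a := by fun_prop
  have cb : Continuous b := by fun_prop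
  have cC : Continuous c := by fun_prop
  have sin1 := fun s => Real.abs_sin_le_one (f s)
  have cos1 := fun s => Real.abs_cos_le_one (f s)
  have S0 := inv_cosh_pos
  have S1 := inv_cosh_le_one
  have ch := Real.cosh_pos
  have cS : ∀ s, Real.cosh s * (Real.cosh s)⁻¹ = 1 := fun s => mul_inv_cancel₀ (ch s).ne'
  have two : ∀ {x y X Y : ℝ}, |x| ≤ X → |y| ≤ Y → |x * y| ≤ X * Y := fun {x y X Y} hx hy => by
    rw [abs_mul]; exact mul_le_mul hx hy (abs_nonneg _) ((abs_nonneg _).trans hx)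
  have ba : ∀ s, |a s| ≤ C * (Real.cosh s)⁻¹ + C * |Real.sin (f s)| := fun s => by
    refine (abs_sub _ _).trans (add_le_add ?_ ?_)
    · simpa using two (cos1 s) (b0 s)
    · rw [mul_comm C]; exact two le_rfl (c0 s)
  have bb : ∀ s, |b s| ≤ 2 * C * |g s| + 2 * C * (Real.cosh s)⁻¹ := fun s => by
    have e : b s = g s * (-(Real.sin (f s) * β s) - Real.cos (f s) * γ s)
        + (Real.cos (f s) * β' s - Real.sin (f s) * γ' s) := by simp only [hb]; ring
    have e1 : |-(Real.sin (f s) * β s) - Real.cos (f s) * γ s| ≤ C + C := by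
      refine (abs_sub _ _).trans (add_le_add ?_ ?_)
      · rw [abs_neg]
        refine (two (sin1 s) (b0 s)).trans ?_
        rw [one_mul]
        exact mul_le_of_le_one_right hC (S1 s)
      · simpa using two (cos1 s) (c0 s)
    have e2 : |Real.cos (f s) * β' s - Real.sin (f s) * γ' s|
        ≤ C * (Real.cosh s)⁻¹ + C * (Real.cosh s)⁻¹ := by
      refine (abs_sub _ _).trans (add_le_add ?_ ?_)
      · simpa using two (cos1 s) (b1 s)
      · simpa using two (sin1 s) (c1 s)
    rw [e]
    have e3 := two (le_refl |g s|) e1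
    have e4 := abs_add_le (g s * (-(Real.sin (f s) * β s) - Real.cos (f s) * γ s))
      (Real.cos (f s) * β' s - Real.sin (f s) * γ' s)
    linarith
  have sq_two : ∀ x y : ℝ, (x + y) ^ 2 ≤ 2 * x ^ 2 + 2 * y ^ 2 := fun x y => by
    nlinarith [sq_nonneg (x - y)]
  have La : MemLp a 2 volume :=
    ((memLp_inv_cosh_line.const_mul C).add (hp.memLp_sin.norm.const_mul C)).mono'
      ca.aestronglyMeasurable (Filter.Eventually.of_forall ba)
  have Lb : MemLp b 2 volume :=
    ((hp.memLp_deriv.norm.const_mul (2 * C)).add (memLp_inv_cosh_line.const_mul (2 * C))).mono'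
      cb.aestronglyMeasurable (Filter.Eventually.of_forall bb)
  refine ⟨b, c, hab, hbc, cC, (tendsto_zero_of_memLp hab La Lb).1,
    (tendsto_zero_of_memLp hab La Lb).2, La, Lb, ?_, ?_, ?_⟩
  · refine ((memLp_inv_cosh_line.const_mul (2 * C ^ 2)).add
      (hp.memLp_quad.const_mul (2 * C ^ 2))).mono' (by fun_prop : Continuous _).aestronglyMeasurable
      (Filter.Eventually.of_forall fun s => ?_)
    rw [Real.norm_of_nonneg (mul_nonneg (ch s).le (sq_nonneg _)), ← sq_abs]
    have h1 : |a s| ^ 2 ≤ 2 * (C * (Real.cosh s)⁻¹) ^ 2 + 2 * (C * |Real.sin (f s)|) ^ 2 :=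
      (pow_le_pow_left₀ (abs_nonneg _) (ba s) 2).trans (sq_two _ _)
    have h2 := mul_le_mul_of_nonneg_left h1 (ch s).le
    have h3 : Real.cosh s * (2 * (C * (Real.cosh s)⁻¹) ^ 2 + 2 * (C * |Real.sin (f s)|) ^ 2)
        = 2 * C ^ 2 * (Real.cosh s)⁻¹ + 2 * C ^ 2 * (Real.cosh s * Real.sin (f s) ^ 2) := by
      rw [mul_pow C |_|, sq_abs]
      linear_combination 2 * C ^ 2 * (Real.cosh s)⁻¹ * cS s
    have h4 : 0 ≤ 2 * C ^ 2 * (Real.cosh s * g s ^ 2) := by have := ch s; positivity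
    simp only [Pi.add_apply]
    linarith
  · refine ((memLp_inv_cosh_line.const_mul (8 * C ^ 2)).add
      (hp.memLp_quad.const_mul (8 * C ^ 2))).mono' (by fun_prop : Continuous _).aestronglyMeasurable
      (Filter.Eventually.of_forall fun s => ?_)
    rw [Real.norm_of_nonneg (mul_nonneg (ch s).le (sq_nonneg _)), ← sq_abs]
    have h1 : |b s| ^ 2 ≤ 2 * (2 * C * |g s|) ^ 2 + 2 * (2 * C * (Real.cosh s)⁻¹) ^ 2 :=
      (pow_le_pow_left₀ (abs_nonneg _) (bb s) 2).trans (sq_two _ _)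
    have h2 := mul_le_mul_of_nonneg_left h1 (ch s).le
    have h3 : Real.cosh s * (2 * (2 * C * |g s|) ^ 2 + 2 * (2 * C * (Real.cosh s)⁻¹) ^ 2)
        = 8 * C ^ 2 * (Real.cosh s)⁻¹ + 8 * C ^ 2 * (Real.cosh s * g s ^ 2) := by
      rw [mul_pow (2 * C) |_|, sq_abs]
      linear_combination 8 * C ^ 2 * (Real.cosh s)⁻¹ * cS s
    have h4 : 0 ≤ 8 * C ^ 2 * (Real.cosh s * Real.sin (f s) ^ 2) := by have := ch s; positivity
    simp only [Pi.add_apply]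
    linarith
  · refine (((memLp_inv_cosh_line.const_mul (2 * C)).add (hp.memLp_quad.const_mul (5 * C))).add
      ((hp.memLp_T.norm.add hp.memLp_deriv.norm).const_mul (2 * C))).mono'
      (by fun_prop : Continuous _).aestronglyMeasurable (Filter.Eventually.of_forall fun s => ?_)
    set S := (Real.cosh s)⁻¹
    set B := g s ^ 2 + Real.sin (f s) ^ 2 with hB
    -- inserting `f'' = T / cosh + sin f cos f`, the terms without decay combine to `β'' - β`, which
    -- is small at the poles
    have e : Real.cosh s * (c s - Real.cos (2 * f s) * a s)
        = Real.cos (f s) * (Real.cosh s * (β'' s - β s))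
        - Real.cosh s * (2 * Real.sin (f s) * g s) * β' s
        - Real.cos (f s) * (Real.cosh s * g s ^ 2 * β s) - Real.sin (f s) * (T s * β s)
        + Real.cos (f s) * (Real.cosh s * Real.sin (f s) ^ 2 * β s)
        - Real.sin (f s) * (Real.cosh s * γ'' s) - 2 * Real.cos (f s) * (g s * (Real.cosh s * γ' s))
        + Real.sin (f s) * (Real.cosh s * g s ^ 2 * γ s) - Real.cos (f s) * (T s * γ s)
        - Real.sin (f s) * (Real.cosh s * Real.sin (f s) ^ 2 * γ s) := by
      have h1 := Real.sin_sq_add_cos_sq (f s)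
      have h2 : Real.cosh s * w s = T s + Real.cosh s * (Real.sin (f s) * Real.cos (f s)) := by
        simp only [w, secondDeriv]
        linear_combination T s * cS s
      simp only [hc, ha]
      rw [Real.cos_two_mul]
      linear_combination (-(Real.sin (f s) * β s) - Real.cos (f s) * γ s) * h2
        + Real.cosh s * (Real.sin (f s) * γ s - 2 * Real.cos (f s) * β s) * h1
    have hS : 0 < S := S0 s
    have hS1 : S ≤ 1 := S1 s
    have hcB : 0 ≤ Real.cosh s * B := by have := ch s; positivity
    have k1 : |Real.cosh s * (β'' s - β s)| ≤ C * S := by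
      rw [abs_mul, abs_of_pos (ch s)]
      refine (mul_le_mul_of_nonneg_left (b2 s) (ch s).le).trans_eq ?_
      linear_combination C * S * cS s
    have k6 : |Real.cosh s * γ'' s| ≤ C * S := by
      rw [abs_mul, abs_of_pos (ch s)]
      refine (mul_le_mul_of_nonneg_left (c2 s) (ch s).le).trans_eq ?_
      linear_combination C * S * cS s
    have k7 : |Real.cosh s * γ' s| ≤ C := by
      rw [abs_mul, abs_of_pos (ch s)]
      refine (mul_le_mul_of_nonneg_left (c1 s) (ch s).le).trans_eq ?_
      linear_combination C * cS s
    have bβ : |β s| ≤ C := (b0 s).trans (mul_le_of_le_one_right hC hS1)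
    have bβ' : |β' s| ≤ C := (b1 s).trans (mul_le_of_le_one_right hC hS1)
    have q1 : |Real.cosh s * (2 * Real.sin (f s) * g s)| ≤ Real.cosh s * B := by
      rw [abs_mul, abs_of_pos (ch s)]
      refine mul_le_mul_of_nonneg_left ?_ (ch s).le
      rw [abs_le]
      constructor <;> nlinarith [sq_nonneg (g s + Real.sin (f s)),
        sq_nonneg (g s - Real.sin (f s))]
    have q2 : |Real.cosh s * g s ^ 2| ≤ Real.cosh s * B := by
      have := ch s
      rw [abs_of_nonneg (by positivity)]
      exact mul_le_mul_of_nonneg_left (le_add_of_nonneg_right (sq_nonneg _)) this.le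
    have q3 : |Real.cosh s * Real.sin (f s) ^ 2| ≤ Real.cosh s * B := by
      have := ch s
      rw [abs_of_nonneg (by positivity)]
      exact mul_le_mul_of_nonneg_left (le_add_of_nonneg_left (sq_nonneg _)) this.le
    have t1 := abs_le.1 (two (cos1 s) k1)
    have t2 := abs_le.1 (two q1 bβ')
    have t3 := abs_le.1 (two (cos1 s) (two q2 bβ))
    have t4 := abs_le.1 (two (sin1 s) (two (le_refl |T s|) bβ))
    have t5 := abs_le.1 (two (cos1 s) (two q3 bβ))
    have t6 := abs_le.1 (two (sin1 s) k6)
    have t7 := abs_le.1 (two (cos1 s) (two (le_refl |g s|) k7))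
    have t8 := abs_le.1 (two (sin1 s) (two q2 (c0 s)))
    have t9 := abs_le.1 (two (cos1 s) (two (le_refl |T s|) (c0 s)))
    have t10 := abs_le.1 (two (sin1 s) (two q3 (c0 s)))
    rw [e, Real.norm_eq_abs]
    simp only [Pi.add_apply, Real.norm_eq_abs]
    rw [abs_le]
    constructor <;> linarith [t1.1, t1.2, t2.1, t2.2, t3.1, t3.2, t4.1, t4.2, t5.1, t5.2, t6.1,
      t6.2, t7.1, t7.2, t8.1, t8.2, t9.1, t9.2, t10.1, t10.2]

/-! ### Angular averages -/

theorem continuous_angInt {F : Type*} [NormedAddCommGroup F] [NormedSpace ℝ F] {v : ℝ × ℝ → F}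
    (hv : Continuous v) : Continuous (angInt v) :=
  intervalIntegral.continuous_parametric_intervalIntegral_of_continuous'
    (f := fun s a => v (s, a)) hv _ _

theorem angInt_mul_left (c : ℝ → ℝ) (v : ℝ × ℝ → ℝ) (s : ℝ) :
    angInt (fun p => c p.1 * v p) s = c s * angInt v s := by
  unfold angInt
  exact intervalIntegral.integral_const_mul (c s) fun a => v (s, a)

/-- Integration by parts over the circle. -/
theorem angInt_inner_da {v w : ℝ × ℝ → E3} (hv : ContDiff ℝ 1 v) (hw : ContDiff ℝ 1 w)
    (pv : AnglePeriodic v) (pw : AnglePeriodic w) (s : ℝ) :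
    angInt (fun p => ⟪v p, ∂ₐ w p⟫) s = -angInt (fun p => ⟪∂ₐ v p, w p⟫) s := by
  have h := angInt_da (hv.inner ℝ hw) (fun s a => by simp only [pv s a, pw s a]) s
  have e : ∂ₐ (fun p => ⟪v p, w p⟫) = fun p => ⟪v p, ∂ₐ w p⟫ + ⟪∂ₐ v p, w p⟫ :=
    funext fun p => pd_inner (hv.differentiable one_ne_zero) (hw.differentiable one_ne_zero) _ p
  rw [e, angInt_add (hv.continuous.inner (contDiff_pd (m := 0) hw (by norm_num) _).continuous)
    ((contDiff_pd (m := 0) hv (by norm_num) _).continuous.inner hw.continuous)] at h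
  linarith

theorem hasDerivAt_angInt_inner {v : ℝ × ℝ → E3} (hv : ContDiff ℝ 1 v) {k : ℝ → E3}
    (hk : ContDiff ℝ 1 k) (s : ℝ) :
    HasDerivAt (angInt fun p => ⟪v p, k p.2⟫) (angInt (fun p => ⟪∂ₛ v p, k p.2⟫) s) s := by
  have hk2 : ContDiff ℝ 1 fun p : ℝ × ℝ => k p.2 := hk.comp contDiff_snd
  have e : ∂ₛ (fun p => ⟪v p, k p.2⟫) = fun p => ⟪∂ₛ v p, k p.2⟫ := by
    funext ⟨s, a⟩
    rw [pd_inner (hv.differentiable one_ne_zero) (hk2.differentiable one_ne_zero),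
      ds_eq (hk2.differentiable one_ne_zero) (hasDerivAt_const s (k a)), inner_zero_right, zero_add]
  rw [← e]
  exact hasDerivAt_angInt (hv.inner ℝ hk2) s

theorem contDiff_rotVec_snd {n : WithTop ℕ∞} : ContDiff ℝ n fun p : ℝ × ℝ => rotVec p.2 :=
  contDiff_rotVec.comp contDiff_snd

theorem contDiff_perpVec_snd {n : WithTop ℕ∞} : ContDiff ℝ n fun p : ℝ × ℝ => perpVec p.2 :=
  contDiff_perpVec.comp contDiff_snd

theorem da_rotVec : ∂ₐ (fun p : ℝ × ℝ => rotVec p.2) = fun p => perpVec p.2 := by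
  funext ⟨s, a⟩
  exact da_eq (contDiff_rotVec_snd.differentiable one_ne_zero) (hasDerivAt_rotVec a)

theorem da_perpVec : ∂ₐ (fun p : ℝ × ℝ => perpVec p.2) = fun p => -rotVec p.2 := by
  funext ⟨s, a⟩
  exact da_eq (contDiff_perpVec_snd.differentiable one_ne_zero) (hasDerivAt_perpVec a)

theorem anglePeriodic_rotVec : AnglePeriodic fun p : ℝ × ℝ => rotVec p.2 := fun _ a =>
  rotVec_add_two_pi a

theorem anglePeriodic_perpVec : AnglePeriodic fun p : ℝ × ℝ => perpVec p.2 := fun _ a => by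
  simp [perpVec]

theorem angInt_neg (v : ℝ × ℝ → ℝ) (s : ℝ) : angInt (fun p => -v p) s = -angInt v s :=
  intervalIntegral.integral_neg

/-- The average of the horizontal radial component only involves the angular derivative of the
field, so it decays at the poles although the field does not. -/
theorem angInt_inner_rotVec {v : ℝ × ℝ → E3} (hv : ContDiff ℝ 1 v) (pv : AnglePeriodic v) (s : ℝ) :
    angInt (fun p => ⟪v p, rotVec p.2⟫) s = angInt (fun p => ⟪∂ₐ v p, perpVec p.2⟫) s := by
  have h := angInt_inner_da hv contDiff_perpVec_snd pv anglePeriodic_perpVec s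
  simp only [da_perpVec, inner_neg_right, angInt_neg] at h
  linarith

theorem angInt_inner_da_da_rotVec {v : ℝ × ℝ → E3} (hv : ContDiff ℝ 2 v) (pv : AnglePeriodic v)
    (s : ℝ) :
    angInt (fun p => ⟪∂ₐ (∂ₐ v) p, rotVec p.2⟫) s = -angInt (fun p => ⟪v p, rotVec p.2⟫) s := by
  rw [angInt_inner_rotVec (hv.of_le one_le_two) pv]
  have h := angInt_inner_da (contDiff_pd₁ hv (0, 1)) contDiff_rotVec_snd (pv.pd _)
    anglePeriodic_rotVec s
  rw [da_rotVec] at h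
  rw [h, neg_neg]

theorem angInt_inner_da_stdVec {v : ℝ × ℝ → E3} (hv : ContDiff ℝ 1 v) (pv : AnglePeriodic v)
    (k : E3) (s : ℝ) : angInt (fun p => ⟪∂ₐ v p, k⟫) s = 0 := by
  have h := angInt_da (hv.inner ℝ (contDiff_const (c := k)))
    (fun s a => by simp only [pv s a]) s
  have e : ∂ₐ (fun p => ⟪v p, k⟫) = fun p => ⟪∂ₐ v p, k⟫ := by
    funext ⟨s, a⟩
    rw [pd_inner (hv.differentiable one_ne_zero) (differentiable_const k),
      da_eq (differentiable_const k) (hasDerivAt_const a k), inner_zero_right, zero_add]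
  rwa [e] at h

theorem norm_stdVec (i : Fin 3) : ‖stdVec i‖ = 1 := by simp [stdVec]

theorem abs_angInt_inner_le {v : ℝ × ℝ → E3} {k : ℝ → E3} (hk : ∀ a, ‖k a‖ = 1) {s C : ℝ}
    (h : ∀ a, ‖v (s, a)‖ ≤ C) : |angInt (fun p => ⟪v p, k p.2⟫) s| ≤ C * (2 * Real.pi) := by
  rw [← Real.norm_eq_abs]
  refine norm_angInt_le (v := fun p => ⟪v p, k p.2⟫) fun a => ?_
  have h1 := norm_inner_le_norm (𝕜 := ℝ) (v (s, a)) (k a)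
  rw [hk a, mul_one] at h1
  exact h1.trans (h a)

/-- A smooth ambient field induces an admissible variation of the profile: the average of its
meridian component. -/
theorem Profile.exists_variation_angInt {f g T : ℝ → ℝ} (hp : Profile f g T) (hT : Continuous T)
    {φ : E3 → E3} (hφ : ContDiff ℝ ∞ φ) :
    ∃ b c, Variation f (angInt fun p => ⟪φ (cyl p), meridian f p⟫) b c := by
  obtain ⟨hW, C, hC0, hC⟩ := exists_sobSize_smooth_le hφ
  obtain ⟨M, hM⟩ := hW.bounded
  have hM0 : 0 ≤ M := (norm_nonneg _).trans (hM 0)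
  set v : ℝ × ℝ → E3 := fun p => φ (cyl p)
  have hv2 := hW.contDiff
  have hv1 : ContDiff ℝ 1 v := hv2.of_le one_le_two
  have pv := hW.periodic
  have hs1 : ContDiff ℝ 1 (∂ₛ v) := contDiff_pd₁ hv2 _
  have ha1 : ContDiff ℝ 1 (∂ₐ v) := contDiff_pd₁ hv2 _
  have css := continuous_pd₂ hv2 (1, 0) (1, 0)
  have caa := continuous_pd₂ hv2 (0, 1) (0, 1)
  have hpi := Real.pi_pos
  have S0 := inv_cosh_pos
  set K : ℝ := (2 * C + M) * (2 * Real.pi) with hK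
  have bd1 : ∀ s a, ‖∂ₛ v (s, a)‖ ≤ C * (Real.cosh s)⁻¹ := fun s a =>
    (sobSize_bounds v (s, a)).1.trans (hC _)
  have bd2 : ∀ s a, ‖∂ₐ v (s, a)‖ ≤ C * (Real.cosh s)⁻¹ := fun s a =>
    (sobSize_bounds v (s, a)).2.1.trans (hC _)
  -- the flat Laplacian is `1 / cosh²` times the Laplacian on the sphere, so it decays faster than
  -- the single second derivatives
  have bd3 : ∀ s a, ‖∂ₛ (∂ₛ v) (s, a) + ∂ₐ (∂ₐ v) (s, a)‖ ≤ 2 * C * (Real.cosh s)⁻¹ ^ 2 :=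
    fun s a => by
      have h1 := cosh_laplacian_le v (s, a)
      have h2 := hC (s, a)
      have h3 : Real.cosh s * ‖∂ₛ (∂ₛ v) (s, a) + ∂ₐ (∂ₐ v) (s, a)‖
          ≤ 2 * C * (Real.cosh s)⁻¹ := by
        simp only at h1 h2
        linarith
      have h4 := mul_le_mul_of_nonneg_left h3 (S0 s).le
      rw [← mul_assoc, inv_mul_cancel₀ (Real.cosh_pos s).ne', one_mul] at h4
      exact h4.trans_eq (by ring)
  have i1 : ∀ s, C * (Real.cosh s)⁻¹ * (2 * Real.pi) ≤ K * (Real.cosh s)⁻¹ := fun s => by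
    have h1 : 0 ≤ (C + M) * (2 * Real.pi) * (Real.cosh s)⁻¹ := by have := S0 s; positivity
    rw [hK]; linarith
  have i2 : ∀ s, 2 * C * (Real.cosh s)⁻¹ ^ 2 * (2 * Real.pi) ≤ K * (Real.cosh s)⁻¹ ^ 2 :=
    fun s => by
      have h1 : 0 ≤ M * (2 * Real.pi) * (Real.cosh s)⁻¹ ^ 2 := by positivity
      rw [hK]; linarith
  have i3 : M * (2 * Real.pi) ≤ K := by
    have h1 : 0 ≤ C * (2 * Real.pi) := by positivity
    rw [hK]; linarith
  have k0 : ContDiff ℝ 1 fun _ : ℝ => stdVec 2 := contDiff_const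
  have crot : Continuous fun p : ℝ × ℝ => rotVec p.2 := (contDiff_rotVec_snd (n := 0)).continuous
  have hβ := hasDerivAt_angInt_inner hv1 contDiff_rotVec
  have hβ' := hasDerivAt_angInt_inner hs1 contDiff_rotVec
  have hγ := hasDerivAt_angInt_inner hv1 k0
  have hγ' := hasDerivAt_angInt_inner hs1 k0
  have cβ : Continuous (angInt fun p => ⟪∂ₛ (∂ₛ v) p, rotVec p.2⟫) :=
    continuous_angInt (css.inner crot)
  have cγ : Continuous (angInt fun p => ⟪∂ₛ (∂ₛ v) p, stdVec 2⟫) :=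
    continuous_angInt (css.inner continuous_const)
  have b0 : ∀ s, |angInt (fun p => ⟪v p, rotVec p.2⟫) s| ≤ K * (Real.cosh s)⁻¹ := fun s => by
    rw [angInt_inner_rotVec hv1 pv]
    exact (abs_angInt_inner_le norm_perpVec (bd2 s)).trans (i1 s)
  have b1 : ∀ s, |angInt (fun p => ⟪∂ₛ v p, rotVec p.2⟫) s| ≤ K * (Real.cosh s)⁻¹ := fun s =>
    (abs_angInt_inner_le norm_rotVec (bd1 s)).trans (i1 s)
  have b2 : ∀ s, |angInt (fun p => ⟪∂ₛ (∂ₛ v) p, rotVec p.2⟫) s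
      - angInt (fun p => ⟪v p, rotVec p.2⟫) s| ≤ K * (Real.cosh s)⁻¹ ^ 2 := fun s => by
    have e : angInt (fun p => ⟪∂ₛ (∂ₛ v) p, rotVec p.2⟫) s - angInt (fun p => ⟪v p, rotVec p.2⟫) s
        = angInt (fun p => ⟪∂ₛ (∂ₛ v) p + ∂ₐ (∂ₐ v) p, rotVec p.2⟫) s := by
      simp only [inner_add_left]
      rw [angInt_add (css.inner crot) (caa.inner crot), angInt_inner_da_da_rotVec hv2 pv]
      ring
    rw [e]
    exact (abs_angInt_inner_le (v := fun p => ∂ₛ (∂ₛ v) p + ∂ₐ (∂ₐ v) p) norm_rotVec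
      (bd3 s)).trans (i2 s)
  have c0 : ∀ s, |angInt (fun p => ⟪v p, stdVec 2⟫) s| ≤ K := fun s =>
    (abs_angInt_inner_le (v := v) (k := fun _ => stdVec 2) (fun _ => norm_stdVec 2) fun a => hM (s, a)).trans i3
  have c1 : ∀ s, |angInt (fun p => ⟪∂ₛ v p, stdVec 2⟫) s| ≤ K * (Real.cosh s)⁻¹ := fun s =>
    (abs_angInt_inner_le (v := ∂ₛ v) (k := fun _ => stdVec 2) (fun _ => norm_stdVec 2) (bd1 s)).trans (i1 s)
  have c2 : ∀ s, |angInt (fun p => ⟪∂ₛ (∂ₛ v) p, stdVec 2⟫) s| ≤ K * (Real.cosh s)⁻¹ ^ 2 :=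
    fun s => by
      have e : angInt (fun p => ⟪∂ₛ (∂ₛ v) p, stdVec 2⟫) s
          = angInt (fun p => ⟪∂ₛ (∂ₛ v) p + ∂ₐ (∂ₐ v) p, stdVec 2⟫) s := by
        simp only [inner_add_left]
        rw [angInt_add (css.inner continuous_const) (caa.inner continuous_const),
          angInt_inner_da_stdVec ha1 (pv.pd _), add_zero]
      rw [e]
      exact (abs_angInt_inner_le (v := fun p => ∂ₛ (∂ₛ v) p + ∂ₐ (∂ₐ v) p) (k := fun _ => stdVec 2)
        (fun _ => norm_stdVec 2)
        (bd3 s)).trans (i2 s)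
  -- `β` and `γ` are the averages of the horizontal radial and of the vertical component
  have key := hp.exists_variation hT hβ hβ' cβ hγ hγ' cγ b0 b1 b2 c0 c1 c2
  have e : (angInt fun p => ⟪v p, meridian f p⟫)
      = fun s => Real.cos (f s) * angInt (fun p => ⟪v p, rotVec p.2⟫) s
        - Real.sin (f s) * angInt (fun p => ⟪v p, stdVec 2⟫) s := by
    funext s
    rw [← angInt_mul_left (fun s => Real.cos (f s)), ← angInt_mul_left (fun s => Real.sin (f s)),
      sub_eq_add_neg, ← angInt_neg, ← angInt_add]
    · refine congrArg (fun w => angInt w s) (funext fun p => ?_)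
      simp only [meridian, corot, inner_add_right, inner_smul_right]
      ring
    · exact (Real.continuous_cos.comp (hp.continuous.comp continuous_fst)).mul
        (hv1.continuous.inner crot)
    · exact ((Real.continuous_sin.comp (hp.continuous.comp continuous_fst)).mul
        (hv1.continuous.inner continuous_const)).neg
  rw [e]
  exact key

theorem angInt_mul_add {c : ℝ → ℝ} {v w : ℝ × ℝ → ℝ} (hc : Continuous c) (hv : Continuous v)
    (hw : Continuous w) (s : ℝ) :
    angInt (fun p => c p.1 * v p + w p) s = c s * angInt v s + angInt w s := by
  have h := angInt_add (v := fun p => c p.1 * v p) ((hc.comp continuous_fst).mul hv) hw s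
  rw [h, angInt_mul_left]

/-! ### Corotational critical points are critical -/

section

variable {f g T : ℝ → ℝ} {ψ : ℝ × ℝ → E3}

theorem inner_profileMap_self (f : ℝ → ℝ) (p : ℝ × ℝ) : ⟪profileMap f p, profileMap f p⟫ = 1 := by
  rw [real_inner_self_eq_norm_sq, norm_profileMap, one_pow]

theorem inner_profileMap_meridian (f : ℝ → ℝ) (p : ℝ × ℝ) :
    ⟪profileMap f p, meridian f p⟫ = 0 := by
  rw [inner_eq]
  simp only [profileMap, meridian, corot_zero, corot_one, corot_two]
  linear_combination Real.sin (f p.1) * Real.cos (f p.1) * Real.sin_sq_add_cos_sq p.2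

theorem rotVec_eq_profileMap (f : ℝ → ℝ) (p : ℝ × ℝ) :
    rotVec p.2 = Real.sin (f p.1) • profileMap f p + Real.cos (f p.1) • meridian f p := by
  simp only [profileMap, meridian, corot]
  linear_combination (norm := module) (-Real.sin_sq_add_cos_sq (f p.1)) • (rotVec p.2)

/-- The weighted second derivative of the profile is the tangential part of the Laplacian (the
tension), the Dirichlet density its normal part. -/
theorem Profile.laplacian_profileMap_eq (hp : Profile f g T) (hT : Continuous T) (p : ℝ × ℝ) :
    ∂ₛ (∂ₛ (profileMap f)) p + ∂ₐ (∂ₐ (profileMap f)) p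
      = (T p.1 * (Real.cosh p.1)⁻¹) • meridian f p
        - (g p.1 ^ 2 + Real.sin (f p.1) ^ 2) • profileMap f p := by
  rw [hp.laplacian_profileMap hT]
  have h := Real.sin_sq_add_cos_sq (f p.1)
  have e : Real.cos (f p.1) ^ 2 = 1 - Real.sin (f p.1) ^ 2 := by linarith
  simp only [profileMap, meridian, corot, secondDeriv]
  match_scalars
  · linear_combination Real.sin (f p.1) * e
  · ring

theorem Profile.ds_inner_meridian (hp : Profile f g T) (hT : Continuous T) (hψ : ContDiff ℝ 2 ψ)
    (hψv : ∀ p, ⟪ψ p, profileMap f p⟫ = 0) (p : ℝ × ℝ) :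
    ∂ₛ (fun p => ⟪ψ p, meridian f p⟫) p = ⟪∂ₛ ψ p, meridian f p⟫ := by
  rw [pd_inner (hψ.differentiable two_ne_zero)
    ((contDiff_meridian (hp.contDiff hT)).differentiable two_ne_zero), hp.ds_meridian hT,
    inner_neg_right, inner_smul_right, hψv]
  simp

/-- Obtained by differentiating the tangency condition `⟪ψ, profileMap f⟫ = 0` once. -/
theorem Profile.inner_ds_profileMap (hp : Profile f g T) (hT : Continuous T) (hψ : ContDiff ℝ 2 ψ)
    (hψv : ∀ p, ⟪ψ p, profileMap f p⟫ = 0) (p : ℝ × ℝ) :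
    ⟪∂ₛ ψ p, profileMap f p⟫ = -(g p.1 * ⟪ψ p, meridian f p⟫) := by
  have h := pd_inner (hψ.differentiable two_ne_zero)
    ((contDiff_profileMap (hp.contDiff hT)).differentiable two_ne_zero) (1, 0) p
  have h0 : (fun p => ⟪ψ p, profileMap f p⟫) = fun _ => 0 := funext hψv
  rw [h0, hp.ds_profileMap_eq_smul hT, inner_smul_right] at h
  have h1 : ∂ₛ (fun _ : ℝ × ℝ => (0 : ℝ)) p = 0 := by simp [pd]
  rw [h1] at h
  linarith

theorem Profile.ds_ds_inner_meridian (hp : Profile f g T) (hT : Continuous T) (hψ : ContDiff ℝ 2 ψ)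
    (hψv : ∀ p, ⟪ψ p, profileMap f p⟫ = 0) (p : ℝ × ℝ) :
    ∂ₛ (∂ₛ (fun p => ⟪ψ p, meridian f p⟫)) p
      = ⟪∂ₛ (∂ₛ ψ) p, meridian f p⟫ + g p.1 ^ 2 * ⟪ψ p, meridian f p⟫ := by
  rw [funext (hp.ds_inner_meridian hT hψ hψv),
    pd_inner ((contDiff_pd₁ hψ _).differentiable one_ne_zero)
    ((contDiff_meridian (hp.contDiff hT)).differentiable two_ne_zero), hp.ds_meridian hT,
    inner_neg_right, inner_smul_right, hp.inner_ds_profileMap hT hψ hψv]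
  ring

/-- Obtained by differentiating the tangency condition `⟪ψ, profileMap f⟫ = 0` twice. -/
theorem Profile.inner_ds_ds_profileMap (hp : Profile f g T) (hT : Continuous T) (hψ : ContDiff ℝ 2 ψ)
    (hψv : ∀ p, ⟪ψ p, profileMap f p⟫ = 0) (p : ℝ × ℝ) :
    ⟪∂ₛ (∂ₛ ψ) p, profileMap f p⟫ = -(secondDeriv f T p.1 * ⟪ψ p, meridian f p⟫)
      - 2 * g p.1 * ⟪∂ₛ ψ p, meridian f p⟫ := by
  obtain ⟨s, a⟩ := p
  have hd1 := (contDiff_pd₁ hψ (1, 0)).differentiable one_ne_zero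
  have hm := hψ.inner ℝ (contDiff_meridian (hp.contDiff hT))
  have h1 := (hasDerivAt_ds hd1 s a).inner ℝ
    (hasDerivAt_ds ((contDiff_profileMap (hp.contDiff hT)).differentiable two_ne_zero) s a)
  have h2 := ((hp.hasDerivAt_deriv hT s).mul
    (hasDerivAt_ds (hm.differentiable two_ne_zero) s a)).neg
  rw [hp.ds_inner_meridian hT hψ hψv] at h2
  have h3 := h1.unique (h2.congr_of_eventuallyEq (Filter.Eventually.of_forall fun s =>
    hp.inner_ds_profileMap hT hψ hψv (s, a)))
  rw [hp.ds_profileMap_eq_smul hT, inner_smul_right] at h3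
  simp only at h3 ⊢
  linarith

theorem inner_rotVec_eq (hψv : ∀ p, ⟪ψ p, profileMap f p⟫ = 0) (p : ℝ × ℝ) :
    ⟪ψ p, rotVec p.2⟫ = Real.cos (f p.1) * ⟪ψ p, meridian f p⟫ := by
  rw [rotVec_eq_profileMap f p, inner_add_right, inner_smul_right, inner_smul_right, hψv]
  ring

/-- The first variation at a corotational map, integrated over the angle. -/
theorem Profile.angInt_inner_laplacian (hp : Profile f g T) (hT : Continuous T) (hψ : ContDiff ℝ 2 ψ)
    (hψv : ∀ p, ⟪ψ p, profileMap f p⟫ = 0)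
    (pψ : AnglePeriodic ψ) (s : ℝ) :
    angInt (fun p => ⟪∂ₛ (∂ₛ ψ) p + ∂ₐ (∂ₐ ψ) p,
        ∂ₛ (∂ₛ (profileMap f)) p + ∂ₐ (∂ₐ (profileMap f)) p⟫) s
      = T s * (Real.cosh s)⁻¹ * (angInt (∂ₛ (∂ₛ fun p => ⟪ψ p, meridian f p⟫)) s
          - Real.cos (2 * f s) * angInt (fun p => ⟪ψ p, meridian f p⟫) s)
        + (g s ^ 2 + Real.sin (f s) ^ 2) * (2 * g s * angInt (∂ₛ fun p => ⟪ψ p, meridian f p⟫) s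
          + Real.sin (2 * f s) * angInt (fun p => ⟪ψ p, meridian f p⟫) s) := by
  have cf := hp.continuous
  have cg := hp.continuous_deriv
  have cS := continuous_inv_cosh
  have cw := hp.continuous_secondDeriv hT
  have hm : ContDiff ℝ 2 fun p => ⟪ψ p, meridian f p⟫ :=
    hψ.inner ℝ (contDiff_meridian (hp.contDiff hT))
  have caa := continuous_pd₂ hψ (0, 1) (0, 1)
  set a : ℝ × ℝ → ℝ := fun p => ⟪ψ p, meridian f p⟫ with ha
  set A : ℝ → ℝ := fun s => T s * (Real.cosh s)⁻¹ with hA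
  set B : ℝ → ℝ := fun s => g s ^ 2 + Real.sin (f s) ^ 2 with hB
  have cA : Continuous A := hT.mul cS
  have cB : Continuous B := (cg.pow 2).add ((Real.continuous_sin.comp cf).pow 2)
  have e : (fun p => ⟪∂ₛ (∂ₛ ψ) p + ∂ₐ (∂ₐ ψ) p,
        ∂ₛ (∂ₛ (profileMap f)) p + ∂ₐ (∂ₐ (profileMap f)) p⟫)
      = fun p => A p.1 * ∂ₛ (∂ₛ a) p + ((B p.1 * secondDeriv f T p.1 - A p.1 * g p.1 ^ 2) * a p
        + (2 * g p.1 * B p.1 * ∂ₛ a p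
          + ((A p.1 * Real.cos (f p.1) - B p.1 * Real.sin (f p.1)) * ⟪∂ₐ (∂ₐ ψ) p, rotVec p.2⟫
            + (-(A p.1 * Real.sin (f p.1)) - B p.1 * Real.cos (f p.1))
              * ⟪∂ₐ (∂ₐ ψ) p, stdVec 2⟫))) := by
    funext p
    have h1 : ⟪∂ₐ (∂ₐ ψ) p, A p.1 • meridian f p - B p.1 • profileMap f p⟫
        = (A p.1 * Real.cos (f p.1) - B p.1 * Real.sin (f p.1)) * ⟪∂ₐ (∂ₐ ψ) p, rotVec p.2⟫
            + (-(A p.1 * Real.sin (f p.1)) - B p.1 * Real.cos (f p.1))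
              * ⟪∂ₐ (∂ₐ ψ) p, stdVec 2⟫ := by
      simp only [meridian, profileMap, corot, inner_sub_right, inner_smul_right, inner_add_right]
      ring
    rw [hp.laplacian_profileMap_eq hT, inner_add_left, h1, inner_sub_right, inner_smul_right,
      inner_smul_right, hp.inner_ds_ds_profileMap hT hψ hψv,
      hp.ds_ds_inner_meridian hT hψ hψv, hp.ds_inner_meridian hT hψ hψv]
    ring
  have c1 : Continuous fun p => ⟪∂ₐ (∂ₐ ψ) p, rotVec p.2⟫ :=
    caa.inner (contDiff_rotVec_snd (n := 0)).continuous
  have c2 : Continuous fun p => ⟪∂ₐ (∂ₐ ψ) p, stdVec 2⟫ := caa.inner continuous_const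
  have ca := hm.continuous
  have cas := continuous_pd₁ hm (1, 0)
  have cass := continuous_pd₂ hm (1, 0) (1, 0)
  -- two integrations by parts over the circle move the angular derivatives from `ψ` to `rotVec`
  have r1 := angInt_inner_da_da_rotVec hψ pψ s
  rw [funext (inner_rotVec_eq hψv), angInt_mul_left (fun s => Real.cos (f s))] at r1
  rw [e, angInt_mul_add cA cass (by fun_prop),
    angInt_mul_add (c := fun s => B s * secondDeriv f T s - A s * g s ^ 2) (by fun_prop) ca
      (by fun_prop),
    angInt_mul_add (c := fun s => 2 * g s * B s) (by fun_prop) cas (by fun_prop),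
    angInt_mul_add (c := fun s => A s * Real.cos (f s) - B s * Real.sin (f s)) (by fun_prop) c1
      (by fun_prop),
    angInt_mul_left (fun s => -(A s * Real.sin (f s)) - B s * Real.cos (f s)),
    angInt_inner_da_stdVec (contDiff_pd₁ hψ _) (pψ.pd _), r1]
  have hw : secondDeriv f T s = A s + Real.sin (f s) * Real.cos (f s) := rfl
  rw [hw, Real.cos_two_mul, Real.sin_two_mul]
  simp only [hB, ha]
  linear_combination (A s * angInt (fun p => ⟪ψ p, meridian f p⟫) s)
    * Real.sin_sq_add_cos_sq (f s)

/-- A corotational map whose profile has least energy is critical for all variations: testing the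
first variation with `ψ` gives the Euler-Lagrange expression of the profile, tested with the
average over the angle of the meridian component of `ψ`. -/
theorem Profile.first_variation_eq_zero {ε : ℝ} (hp : Profile f g T) (hT : Continuous T)
    (hmin : ∀ f' g' T', Profile f' g' T' → profileEnergy ε f g T ≤ profileEnergy ε f' g' T')
    (hψ : CylW22 ψ) (hψv : ∀ p, ⟪ψ p, profileMap f p⟫ = 0) {b c : ℝ → ℝ}
    (hv : Variation f (angInt fun p => ⟪ψ p, meridian f p⟫) b c) :
    (∫ p, ⟪∂ₛ (profileMap f) p, ∂ₛ ψ p⟫ ∂strip) + (∫ p, ⟪∂ₐ (profileMap f) p, ∂ₐ ψ p⟫ ∂strip)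
      + ε * ∫ p, ⟪Real.cosh p.1 • (∂ₛ (∂ₛ (profileMap f)) p + ∂ₐ (∂ₐ (profileMap f)) p),
          Real.cosh p.1 • (∂ₛ (∂ₛ ψ) p + ∂ₐ (∂ₐ ψ) p)⟫ ∂strip = 0 := by
  have hW := hp.cylW22 hT
  have h2 := hψ.contDiff
  have hm : ContDiff ℝ 2 fun p => ⟪ψ p, meridian f p⟫ :=
    h2.inner ℝ (contDiff_meridian (hp.contDiff hT))
  have hb : b = angInt (∂ₛ fun p => ⟪ψ p, meridian f p⟫) := funext fun s =>
    (hv.hasDerivAt s).unique (hasDerivAt_angInt (hm.of_le one_le_two) s)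
  have hc : c = angInt (∂ₛ (∂ₛ fun p => ⟪ψ p, meridian f p⟫)) := funext fun s =>
    (hb ▸ hv.hasDerivAt_deriv s).unique (hasDerivAt_angInt (contDiff_pd₁ hm _) s)
  have memΛ : ∀ {w : ℝ × ℝ → E3}, CylW22 w →
      MemLp (fun p => Real.cosh p.1 • (∂ₛ (∂ₛ w) p + ∂ₐ (∂ₐ w) p)) 2 strip := fun {w} hw =>
    hw.memLp_of_le (C := 2) (continuous_cosh_fst.smul
      ((continuous_pd₂ hw.contDiff _ _).add (continuous_pd₂ hw.contDiff _ _))) fun p => by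
        rw [norm_smul, Real.norm_of_nonneg (Real.cosh_pos _).le]
        exact cosh_laplacian_le w p
  rw [integral_strip (integrable_inner_of_memLp hW.cylW12.memLp_ds hψ.cylW12.memLp_ds),
    integral_strip (integrable_inner_of_memLp hW.cylW12.memLp_da hψ.cylW12.memLp_da),
    integral_strip (integrable_inner_of_memLp (memΛ hW) (memΛ hψ))]
  have t1 : ∀ s, angInt (fun p => ⟪∂ₛ (profileMap f) p, ∂ₛ ψ p⟫) s = b s * g s := fun s => by
    have e : (fun p => ⟪∂ₛ (profileMap f) p, ∂ₛ ψ p⟫)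
        = fun p => g p.1 * ∂ₛ (fun p => ⟪ψ p, meridian f p⟫) p := funext fun p => by
      rw [hp.ds_inner_meridian hT h2 hψv, hp.ds_profileMap_eq_smul hT, inner_smul_left,
        real_inner_comm]
      rfl
    rw [e, angInt_mul_left, hb, mul_comm]
  have t2 : ∀ s, angInt (fun p => ⟪∂ₐ (profileMap f) p, ∂ₐ ψ p⟫) s
      = angInt (fun p => ⟪ψ p, meridian f p⟫) s * Real.cos (f s) * Real.sin (f s) := fun s => by
    rw [angInt_inner_da (contDiff_pd₁ hW.contDiff _) (h2.of_le one_le_two) (hW.periodic.pd _)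
      hψ.periodic, hp.da_da_profileMap hT]
    have e : (fun p => ⟪-(Real.sin (f p.1) • rotVec p.2), ψ p⟫)
        = fun p => (-(Real.sin (f p.1) * Real.cos (f p.1))) * ⟪ψ p, meridian f p⟫ :=
      funext fun p => by
        rw [inner_neg_left, inner_smul_left, real_inner_comm, inner_rotVec_eq hψv]
        simp only [conj_trivial]
        ring
    rw [e, angInt_mul_left fun s => -(Real.sin (f s) * Real.cos (f s))]
    ring
  have t3 : ∀ s, angInt (fun p => ⟪Real.cosh p.1 • (∂ₛ (∂ₛ (profileMap f)) p
        + ∂ₐ (∂ₐ (profileMap f)) p), Real.cosh p.1 • (∂ₛ (∂ₛ ψ) p + ∂ₐ (∂ₐ ψ) p)⟫) s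
      = (Real.cosh s * (c s - Real.cos (2 * f s) * angInt (fun p => ⟪ψ p, meridian f p⟫) s)) * T s
        + (Real.cosh s * (2 * g s * b s
          + Real.sin (2 * f s) * angInt (fun p => ⟪ψ p, meridian f p⟫) s))
          * (Real.cosh s * (g s ^ 2 + Real.sin (f s) ^ 2)) := fun s => by
    have e : (fun p => ⟪Real.cosh p.1 • (∂ₛ (∂ₛ (profileMap f)) p
        + ∂ₐ (∂ₐ (profileMap f)) p), Real.cosh p.1 • (∂ₛ (∂ₛ ψ) p + ∂ₐ (∂ₐ ψ) p)⟫)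
        = fun p => Real.cosh p.1 ^ 2 * ⟪∂ₛ (∂ₛ ψ) p + ∂ₐ (∂ₐ ψ) p,
          ∂ₛ (∂ₛ (profileMap f)) p + ∂ₐ (∂ₐ (profileMap f)) p⟫ := funext fun p => by
      rw [inner_smul_left, inner_smul_right, real_inner_comm]
      simp only [conj_trivial]
      ring
    rw [e, angInt_mul_left fun s => Real.cosh s ^ 2,
      hp.angInt_inner_laplacian hT h2 hψv hψ.periodic, hc, hb]
    have h : Real.cosh s * (Real.cosh s)⁻¹ = 1 := mul_inv_cancel₀ (Real.cosh_pos s).ne'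
    linear_combination Real.cosh s * T s *
      (angInt (∂ₛ (∂ₛ fun p => ⟪ψ p, meridian f p⟫)) s
          - Real.cos (2 * f s) * angInt (fun p => ⟪ψ p, meridian f p⟫) s) * h
  simp only [t1, t2, t3]
  have h3 := integral_add (hv.memLp_second.integrable_mul hp.memLp_T)
    ((hv.memLp_cross hp).integrable_mul hp.memLp_quad)
  simp only [Pi.mul_apply] at h3
  rw [h3, mul_add, ← add_assoc]
  exact hp.euler_lagrange hmin hv

end

/-! ### The maps of the sphere induced by profiles -/

/-- The north pole. -/
def northPole : S2 := ⟨stdVec 2, by simp [norm_stdVec]⟩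

open Classical in
/-- The corotational map of the sphere with angle function `f`, which sends both poles to the north
pole. It is continuous when `f` goes from `0` to `2π`. -/
def corotSphere (f : ℝ → ℝ) (x : S2) : S2 :=
  if (x : E3) 2 ∈ Set.Ioo (-1 : ℝ) 1 then ⟨profileMap f (coord x), by simp [norm_profileMap]⟩
  else northPole

theorem coe_corotSphere {f : ℝ → ℝ} {x : S2} (h : (x : E3) 2 ∈ Set.Ioo (-1 : ℝ) 1) :
    (corotSphere f x : E3) = profileMap f (coord x) := by
  rw [corotSphere, if_pos h]

theorem corotSphere_of_notMem {f : ℝ → ℝ} {x : S2} (h : (x : E3) 2 ∉ Set.Ioo (-1 : ℝ) 1) :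
    corotSphere f x = northPole := by
  rw [corotSphere, if_neg h]

theorem ae_corotSphere (f : ℝ → ℝ) :
    ∀ᵐ x ∂area, (corotSphere f x : E3) = profileMap f (coord x) := by
  filter_upwards [ae_cylS_coord] with x hx
  refine coe_corotSphere ?_
  rw [← hx, coe_cylS, cyl_two]
  exact ⟨Real.neg_one_lt_tanh _, Real.tanh_lt_one _⟩

theorem continuousAt_artanh {z : ℝ} (hz : z ∈ Set.Ioo (-1 : ℝ) 1) : ContinuousAt Real.artanh z := by
  have h1 : (1 - z) ≠ 0 := by linarith [hz.2]
  have h2 : 0 < (1 + z) / (1 - z) := div_pos (by linarith [hz.1]) (by linarith [hz.2])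
  have h3 : √((1 + z) / (1 - z)) ≠ 0 := (Real.sqrt_pos.2 h2).ne'
  unfold Real.artanh
  fun_prop (disch := assumption)

theorem norm_profileMap_sub_sq (f : ℝ → ℝ) (p : ℝ × ℝ) :
    ‖profileMap f p - stdVec 2‖ ^ 2 = 2 - 2 * Real.cos (f p.1) := by
  have e : profileMap f p - stdVec 2
      = corot (fun s => Real.sin (f s)) (fun s => Real.cos (f s) - 1) p := by
    simp only [profileMap, corot]
    module
  rw [e, norm_corot_sq]
  linear_combination Real.sin_sq_add_cos_sq (f p.1)

/-- A formula for the corotational map that does not involve the angular coordinate, hence is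
continuous across the branch cut of `Complex.arg`. -/
theorem profileMap_coord (f : ℝ → ℝ) {x : S2} (h : (x : E3) 2 ∈ Set.Ioo (-1 : ℝ) 1) :
    profileMap f (coord x) = (Real.cosh (coord x).1 * Real.sin (f (coord x).1)) •
      ((x : E3) - (x : E3) 2 • stdVec 2) + Real.cos (f (coord x).1) • stdVec 2 := by
  have hx : (x : E3) = cyl (coord x) := by
    conv_lhs => rw [← cylS_coord h]
    rfl
  have h2 : (x : E3) 2 = Real.tanh (coord x).1 := by rw [hx, cyl_two]
  have e : (x : E3) - (x : E3) 2 • stdVec 2 = (Real.cosh (coord x).1)⁻¹ • rotVec (coord x).2 := by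
    rw [h2, hx]
    exact add_sub_cancel_right _ _
  rw [e, smul_smul, mul_right_comm, mul_inv_cancel₀ (Real.cosh_pos _).ne', one_mul]
  rfl

open Filter Topology in
/-- Near the poles `|u - N|² = 2 - 2 cos f` is small, as `f` tends to `0` or `2π` there. -/
theorem Profile.continuous_corotSphere {f g T : ℝ → ℝ} (hp : Profile f g T) :
    Continuous (corotSphere f) := by
  refine Continuous.subtype_mk (f := fun x => (corotSphere f x : E3)) ?_ _
  have c2 : Continuous fun x : S2 => (x : E3) 2 := by fun_prop
  refine continuous_iff_continuousAt.2 fun x => ?_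
  by_cases h : (x : E3) 2 ∈ Set.Ioo (-1 : ℝ) 1
  · have ca : ContinuousAt (fun x : S2 => (coord x).1) x :=
      ContinuousAt.comp (g := Real.artanh) (continuousAt_artanh h) c2.continuousAt
    have cf : ContinuousAt (fun x : S2 => f (coord x).1) x :=
      ContinuousAt.comp (g := f) hp.continuous.continuousAt ca
    have hG : ContinuousAt (fun x : S2 => (Real.cosh (coord x).1 * Real.sin (f (coord x).1)) •
      ((x : E3) - (x : E3) 2 • stdVec 2) + Real.cos (f (coord x).1) • stdVec 2) x := by
      have h1 : ContinuousAt (fun x : S2 => Real.cosh (coord x).1) x :=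
        ContinuousAt.comp (g := Real.cosh) Real.continuous_cosh.continuousAt ca
      have h2 : ContinuousAt (fun x : S2 => Real.sin (f (coord x).1)) x :=
        ContinuousAt.comp (g := Real.sin) Real.continuous_sin.continuousAt cf
      have h3 : ContinuousAt (fun x : S2 => Real.cos (f (coord x).1)) x :=
        ContinuousAt.comp (g := Real.cos) Real.continuous_cos.continuousAt cf
      have h4 : ContinuousAt (fun x : S2 => (x : E3) - (x : E3) 2 • stdVec 2) x :=
        (continuous_subtype_val.sub (c2.smul continuous_const)).continuousAt
      exact ((h1.mul h2).smul h4).add (h3.smul continuousAt_const)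
    refine hG.congr ?_
    filter_upwards [c2.continuousAt.preimage_mem_nhds (isOpen_Ioo.mem_nhds h)] with y hy
    rw [coe_corotSphere hy, profileMap_coord f hy]
  · rw [Metric.continuousAt_iff']
    intro r hr
    have lim : ∀ {l : Filter ℝ}, Tendsto (fun s => Real.cos (f s)) l (𝓝 1) →
        ∀ᶠ s in l, 2 - 2 * Real.cos (f s) < r ^ 2 := fun {l} hl => by
      have := (hl.const_mul 2).const_sub 2
      rw [mul_one, sub_self] at this
      exact this.eventually_lt_const (by positivity)
    have cos0 : Tendsto Real.cos (𝓝 0) (𝓝 1) := Real.cos_zero ▸ Real.continuous_cos.tendsto 0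
    have cos2 : Tendsto Real.cos (𝓝 (2 * Real.pi)) (𝓝 1) :=
      Real.cos_two_pi ▸ Real.continuous_cos.tendsto (2 * Real.pi)
    have hb := lim (cos0.comp hp.tendsto_atBot)
    have ht := lim (cos2.comp hp.tendsto_atTop)
    obtain ⟨b, hb⟩ := eventually_atBot.1 hb
    obtain ⟨t, ht⟩ := eventually_atTop.1 ht
    set R := max (-b) t
    have hR : ∀ s, R ≤ |s| → 2 - 2 * Real.cos (f s) < r ^ 2 := fun s hs => by
      rcases le_abs'.1 hs with h | h
      · exact hb s (by linarith [le_max_left (-b) t])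
      · exact ht s ((le_max_right _ _).trans h)
    have hx2 : 1 - (x : E3) 2 ^ 2 < (Real.cosh R)⁻¹ ^ 2 := by
      have h1 : 1 ≤ (x : E3) 2 ^ 2 := by
        by_contra! h'
        exact h (abs_lt.1 ((sq_lt_one_iff_abs_lt_one _).1 h'))
      have : 0 < (Real.cosh R)⁻¹ := inv_cosh_pos R
      have : 0 < (Real.cosh R)⁻¹ ^ 2 := by positivity
      linarith
    filter_upwards [((continuous_const.sub (c2.pow 2)).tendsto x).eventually_lt_const hx2]
      with y hy
    rw [corotSphere_of_notMem h, dist_eq_norm]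
    by_cases hy2 : (y : E3) 2 ∈ Set.Ioo (-1 : ℝ) 1
    · rw [coe_corotSphere hy2]
      refine lt_of_pow_lt_pow_left₀ 2 hr.le ?_
      change ‖profileMap f (coord y) - stdVec 2‖ ^ 2 < r ^ 2
      rw [norm_profileMap_sub_sq]
      refine hR _ ?_
      by_contra! hlt
      have h2 : (y : E3) 2 = Real.tanh (coord y).1 := by
        conv_lhs => rw [← cylS_coord hy2]
        simp
      change 1 - (y : E3) 2 ^ 2 < _ at hy
      rw [h2] at hy
      have h3 := tanh_sq_add_inv_cosh_sq (coord y).1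
      have h4 : Real.cosh (coord y).1 ≤ Real.cosh R :=
        Real.cosh_le_cosh.2 (hlt.le.trans (le_abs_self R))
      have h5 : (Real.cosh R)⁻¹ ≤ (Real.cosh (coord y).1)⁻¹ := inv_anti₀ (Real.cosh_pos _) h4
      have h6 := pow_le_pow_left₀ (inv_cosh_pos R).le h5 2
      linarith
    · rw [corotSphere_of_notMem hy2, sub_self, norm_zero]
      exact hr

/-- The angle takes the value `π` somewhere, so the south pole is attained as well as the north
pole. -/
theorem Profile.corotSphere_ne_const {f g T : ℝ → ℝ} (hp : Profile f g T) :
    ¬ ∃ c : S2, ∀ x, corotSphere f x = c := by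
  rintro ⟨c, hc⟩
  obtain ⟨s, hs⟩ : ∃ s, f s = Real.pi := by
    have h1 := (hp.tendsto_atBot.eventually_lt_const Real.pi_pos).exists
    have h2 := (hp.tendsto_atTop.eventually_const_lt
      (show Real.pi < 2 * Real.pi by linarith [Real.pi_pos])).exists
    obtain ⟨a, ha⟩ := h1
    obtain ⟨b, hb⟩ := h2
    exact mem_range_of_exists_le_of_exists_ge hp.continuous ⟨a, ha.le⟩ ⟨b, hb.le⟩
  have e1 : (corotSphere f (cylS (s, 0)) : E3) 2 = -1 := by
    have hm : (cylS (s, 0) : E3) 2 ∈ Set.Ioo (-1 : ℝ) 1 := by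
      rw [coe_cylS, cyl_two]
      exact ⟨Real.neg_one_lt_tanh _, Real.tanh_lt_one _⟩
    rw [coe_corotSphere hm, coord_cylS ⟨by simp [Real.pi_pos], Real.pi_pos.le⟩, profileMap,
      corot_two, hs, Real.cos_pi]
  have e2 : (corotSphere f northPole : E3) 2 = 1 := by
    rw [corotSphere_of_notMem (by simp [northPole])]
    simp [northPole]
  rw [hc] at e1 e2
  linarith

/-- The degree density is the derivative of `cos f` along the axis, and `cos f` has the same limit
`1` at both ends. -/
theorem Profile.degree_eq_zero {f g T : ℝ → ℝ} (hp : Profile f g T) (hT : Continuous T)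
    {u : S2 → E3} (hu : ∀ᵐ x ∂area, u x = profileMap f (coord x)) : degree u = 0 := by
  set k : ℝ × ℝ → ℝ := fun p => -(Real.cosh p.1 ^ 2 * (g p.1 * Real.sin (f p.1))) with hk
  have cf := hp.continuous
  have cg := hp.continuous_deriv
  have ck : Continuous k := by
    have := Real.continuous_cosh
    fun_prop
  -- the area density cancels `cosh²`, which leaves `(cos f)'` to be integrated
  have hj : ∀ᵐ x ∂area, jacobian u x = k (coord x) := by
    filter_upwards [jacobian_ae_eq (hp.cylW22 hT) hu] with x hx
    rw [hx, hp.ds_profileMap_eq_smul hT, hp.da_profileMap hT, inner_eq]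
    simp only [hk, cross, profileMap, meridian, corot_zero, corot_one, corot_two, PiLp.smul_apply,
      perpVec_zero, perpVec_one, perpVec_two, smul_eq_mul, PiLp.toLp_apply, Matrix.cons_val_zero,
      Matrix.cons_val_one, Matrix.cons_val]
    linear_combination (-(Real.cosh (coord x).1 ^ 2 * g (coord x).1 * Real.sin (f (coord x).1)))
      * (Real.sin_sq_add_cos_sq (f (coord x).1)
        * (Real.sin (coord x).2 ^ 2 + Real.cos (coord x).2 ^ 2)
        + Real.sin_sq_add_cos_sq (coord x).2)
  have hi : Integrable fun s => -Real.sin (f s) * g s :=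
    hp.memLp_sin.neg.integrable_mul hp.memLp_deriv
  have h0 : ∫ s, -Real.sin (f s) * g s = 0 := by
    rw [integral_of_hasDerivAt_of_tendsto (fun s => (hp.hasDerivAt s).cos) hi
      ((Real.continuous_cos.tendsto 0).comp hp.tendsto_atBot)
      ((Real.continuous_cos.tendsto (2 * Real.pi)).comp hp.tendsto_atTop)]
    simp
  have h1 : ∫ p, (Real.cosh p.1)⁻¹ ^ 2 • k (coord (cylS p)) ∂strip
      = ∫ p, -Real.sin (f p.1) * g p.1 ∂strip := by
    refine integral_congr_ae (ae_strip fun p hp => ?_)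
    have h : Real.cosh p.1 * (Real.cosh p.1)⁻¹ = 1 := mul_inv_cancel₀ (Real.cosh_pos _).ne'
    simp only [coord_cylS (Set.Ioo_subset_Ioc_self hp), hk, smul_eq_mul]
    linear_combination (-(g p.1 * Real.sin (f p.1))) *
      (Real.cosh p.1 * (Real.cosh p.1)⁻¹ + 1) * h
  rw [degree, integral_congr_ae hj,
    integral_area (stronglyMeasurable_comp_coord ck).aestronglyMeasurable, h1,
    integral_strip_comp_fst hi, h0]
  simp

/-- The projected variation by `φ` starts in the direction of the tangential part of `φ`, whose
meridian component is that of `φ`. -/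
theorem Profile.isEpsHarmonic {f g T : ℝ → ℝ} {ε : ℝ} (hp : Profile f g T) (hT : Continuous T)
    (hmin : ∀ f' g' T', Profile f' g' T' → profileEnergy ε f g T ≤ profileEnergy ε f' g' T') :
    IsEpsHarmonic ε (corotSphere f) where
  continuous := hp.continuous_corotSphere
  memW22 := memW22_of_cyl (hp.cylW22 hT) (ae_corotSphere f)
  critical φ hφ := by
    obtain ⟨hW, hd⟩ := hasDerivAt_energy_nearestPoint (hp.cylW22 hT) (norm_profileMap f)
      (ae_corotSphere f) hφ ε rfl
    obtain ⟨b, c, hv⟩ := hp.exists_variation_angInt hT hφ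
    have e : (fun p => ⟪φ (cyl p) - ⟪profileMap f p, φ (cyl p)⟫ • profileMap f p, meridian f p⟫)
        = fun p => ⟪φ (cyl p), meridian f p⟫ := funext fun p => by
      rw [inner_sub_left, inner_smul_left, inner_profileMap_meridian, mul_zero, sub_zero]
    rw [← e] at hv
    rwa [hp.first_variation_eq_zero hT hmin hW (fun p => ?_) hv] at hd
    rw [inner_sub_left, inner_smul_left, inner_profileMap_self, real_inner_comm]
    simp

end EpsHarmonic
end

theorem theorem1p3 :
    ∀ δ : ℝ, 0 < δ → ∃ ε₀ : ℝ, 0 < ε₀ ∧ ∀ ε : ℝ, 0 < ε → ε < ε₀ →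
      ∃ u : EpsHarmonic.S2 → EpsHarmonic.S2,
        EpsHarmonic.IsEpsHarmonic ε u ∧
        (¬ ∃ c : EpsHarmonic.S2, ∀ x, u x = c) ∧
        EpsHarmonic.degree (fun x => (u x : EpsHarmonic.E3)) = 0 ∧
        8 * Real.pi < EpsHarmonic.energy ε (fun x => (u x : EpsHarmonic.E3)) ∧
        EpsHarmonic.energy ε (fun x => (u x : EpsHarmonic.E3)) < 8 * Real.pi + δ := by
  intro δ hδ
  have hpi := Real.pi_pos
  set I : ℝ := ∫ s, (Real.cosh s)⁻¹ with hI
  have hI0 : 0 ≤ I := MeasureTheory.integral_nonneg fun s => (EpsHarmonic.inv_cosh_pos s).le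
  -- the separation of the bubbles is chosen such that the excess of the Dirichlet energy, and then
  -- `ε₀` such that the bending energy, is at most `δ / (2π)`, in units of `π`
  obtain ⟨f₁, g₁, T₁, hp₁, hle⟩ :=
    EpsHarmonic.exists_profile_le (t := 4 * Real.pi * (I + 1) / δ) (by positivity)
  set E : ℝ := (∫ s, T₁ s ^ 2) + ∫ s, (Real.cosh s * (g₁ s ^ 2 + Real.sin (f₁ s) ^ 2)) ^ 2 with hE
  have hE0 : 0 ≤ E := add_nonneg (MeasureTheory.integral_nonneg fun s => sq_nonneg _)
    (MeasureTheory.integral_nonneg fun s => sq_nonneg _)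
  refine ⟨δ / (2 * Real.pi) / (E + 1), by positivity, fun ε hε hlt => ?_⟩
  obtain ⟨f, g, T', hp', hmin'⟩ :=
    EpsHarmonic.Profile.exists_minimizer hε ⟨f₁, g₁, T₁, hp₁⟩
  -- replace `T'` by its continuous representative
  obtain ⟨T, hT, hp, heq⟩ := hp'.exists_continuous hε hmin'
  rw [← heq] at hmin'
  have hu := EpsHarmonic.ae_corotSphere f
  refine ⟨EpsHarmonic.corotSphere f, hp.isEpsHarmonic hT hmin', hp.corotSphere_ne_const,
    hp.degree_eq_zero hT hu, ?_, ?_⟩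
  · rw [hp.energy_eq hT hu]
    nlinarith [hp.eight_lt_profileEnergy hε]
  · rw [hp.energy_eq hT hu]
    have h1 : 2 / (4 * Real.pi * (I + 1) / δ) * I ≤ δ / (2 * Real.pi) := by
      have : 2 / (4 * Real.pi * (I + 1) / δ) * I = δ / (2 * Real.pi) * (I / (I + 1)) := by
        field_simp
        ring
      rw [this]
      exact mul_le_of_le_one_right (by positivity) ((div_le_one (by positivity)).2 (by linarith))
    have h2 : ε * E < δ / (2 * Real.pi) := by
      rw [lt_div_iff₀ (by positivity)] at hlt
      linarith
    have h3 := hmin' _ _ _ hp₁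
    have h4 : EpsHarmonic.profileEnergy ε f g T < 8 + δ / (2 * Real.pi) + δ / (2 * Real.pi) := by
      refine h3.trans_lt ?_
      rw [EpsHarmonic.profileEnergy]
      linarith
    have h5 : Real.pi * (8 + δ / (2 * Real.pi) + δ / (2 * Real.pi)) = 8 * Real.pi + δ := by
      field_simp
      ring
    rw [← h5]
    exact mul_lt_mul_of_pos_left h4 hpi
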